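/- Let $1\le r\le d-1$, $t\in[0,1)$ and $\eta>0$ be fixed. For $n\ge 1$ one observes on $[0,1]$ the $d$-dimensional process $$dY(s)=X(s)\,ds+\eta n^{-1/2}\,dW(s),\qquad X(s)=X(0)+\int_0^s\sigma(u)\,dB(u),\qquad \Sigma:=\sigma\sigma^\top,$$ with independent Brownian motions $B$, $W$, a deterministic $\sigma\in L^2([0,1])$ and an initial value $X(0)$ that is independent of $(B,W)$ and has an arbitrary fixed law $\nu$; the law of $Y$ depends on $\sigma$ only through $\Sigma$, and $\mathbb E_\Sigma$ denotes expectation under it. Write $\lambda_1(S)\ge\dots\ge\lambda_d(S)$ for the ordered eigenvalues of a symmetric matrix $S$ and $\|\cdot\|$ for the spectral norm. For $\beta\in(0,1]$, $L>0$, $\underline\lambda_r\ge0$ let $\mathcal H_0([0,1],\beta,L,\underline\lambda_r)$ be the set of all positive semi-definite $\Sigma:[0,1]\to\mathbb R^{d\times d}$ with $\|\Sigma(s)-\Sigma(u)\|\le L|s-u|^\beta$, $\operatorname{rank}\Sigma(s)\le r$ and $\lambda_r(\Sigma(s))\ge\underline\lambda_r$ for all $s,u\in[0,1]$. For $\lambda>0$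 let $\mathcal H_1(I_{t,h},\lambda)$ be the set of all integrable positive semi-definite $\Sigma:[0,1]\to\mathbb R^{d\times d}$ with $\lambda_{r+1}(\Sigma(s))\ge\lambda$ for all $s\in I_{t,h}=[t,t+h]$. Put, with $\underline\lambda_r^{-1}=\infty$ if $\underline\lambda_r=0$, $$v_n=\big((\underline\lambda_r^{-1}L^2)^{1/(\beta+1)}n^{-\beta/(\beta+1)}\big)\wedge\big(L^{2/(\beta+2)}n^{-\beta/(\beta+2)}\big).$$ (a) For every $\alpha'\in(0,1)$ there is a constant $c_{\alpha'}>0$ (which may depend on the fixed $d,r,t,\eta$, but not on $\beta$, $\nu$, $L$, $\underline\lambda_r$) such that for all $\beta\in(0,1]$, all $\nu$, all $L=L_n>0$ and $\underline\lambda_r=\underline\lambda_{r,n}\ge0$, constant or varying arbitrarily with $n$, and all $h_n\in(0,1-t]$ with $h_n\to0$ and $$h_n\le c_{\alpha'}^{1/(2\beta)}\big((\underline\lambda_r^{-1}L^2n)^{-1/(2\beta+2)}\vee(Ln)^{-1/(\beta+2)}\big),\qquad n\ge1,$$ one has $$\liminf_{n\to\infty}\inf_{\phi_n}\Big(\sup_{\Sigma\in\mathcal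 H_0([0,1],\beta,L,\underline\lambda_r)}\mathbb E_\Sigma[\phi_n]+\sup_{\Sigma\in\mathcal H_1(I_{t,h_n},c_{\alpha'}v_n)}\mathbb E_\Sigma[1-\phi_n]\Big)\ge\alpha',$$ where the infimum is over all (randomised) tests, i.e. measurable functions $\phi_n$ of the observed path $(Y(s))_{s\in[0,1]}$ with values in $[0,1]$. (b) Consequently no level-$\alpha$ test is consistent: for every $\alpha\in(0,1)$ there is $c>0$ (with the same dependence) such that in the same setting, with $c$ in place of $c_{\alpha'}$, for all tests $\phi_n$ with $\sup_{\Sigma\in\mathcal H_0([0,1],\beta,L,\underline\lambda_r)}\mathbb E_\Sigma[\phi_n]\le\alpha$ for all large $n$, the quantity $\sup_{\Sigma\in\mathcal H_1(I_{t,h_n},cv_n)}\mathbb E_\Sigma[1-\phi_n]$ does not converge to $0$. -/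

import Mathlib

open MeasureTheory ProbabilityTheory Filter Topology Set
open scoped ENNReal MatrixOrder

noncomputable section

namespace RankTest

/-! ### Gaussian white noise over a Hilbert space

For a real Hilbert space `H` we fix a Hilbert basis `(b_k)`, take independent standard normal
variables `ξ_k` on the product space, and let `isonormal f = ∑_k ⟨b_k, f⟩ ξ_k`, the sum converging
in `L²` of the probability space. For `H = L²([0,1]; ℝ^p)` this is the Wiener integral
`f ↦ ∫ ⟨f(s), dB(s)⟩` with respect to a `p`-dimensional Brownian motion `B`, where
`B_j(t) = isonormal (1_{[0,t]} e_j)`. -/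

section Isonormal

variable (H : Type) [NormedAddCommGroup H] [InnerProductSpace ℝ H] [CompleteSpace H]

/-- The index set of the chosen Hilbert basis. -/
def NoiseIndex : Set H := (exists_hilbertBasis ℝ H).choose

/-- The chosen Hilbert basis of `H`. -/
def noiseBasis : HilbertBasis (NoiseIndex H) ℝ H := (exists_hilbertBasis ℝ H).choose_spec.choose

/-- The law of a family of independent standard normal variables. -/
def noiseMeasure : Measure (NoiseIndex H → ℝ) := Measure.infinitePi fun _ => gaussianReal 0 1

instance : IsProbabilityMeasure (noiseMeasure H) := by
  unfold noiseMeasure; infer_instance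

variable {H}

lemma memLp_noiseCoord (k : NoiseIndex H) :
    MemLp (fun ω : NoiseIndex H → ℝ => ω k) 2 (noiseMeasure H) :=
  (memLp_id_gaussianReal (μ := 0) (v := 1) 2).comp_measurePreserving
    (measurePreserving_eval_infinitePi (fun _ : NoiseIndex H => gaussianReal 0 1) k)

/-- The `k`-th standard normal coordinate, as a square-integrable random variable. -/
def noiseCoord (k : NoiseIndex H) : Lp ℝ 2 (noiseMeasure H) := (memLp_noiseCoord k).toLp _

lemma orthonormal_noiseCoord : Orthonormal ℝ (noiseCoord (H := H)) := by
  classical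
  rw [orthonormal_iff_ite]
  intro j k
  have hinner : inner ℝ (noiseCoord j) (noiseCoord k) = ∫ ω, ω j * ω k ∂(noiseMeasure H) := by
    rw [L2.inner_def]
    refine integral_congr_ae ?_
    filter_upwards [(memLp_noiseCoord j).coeFn_toLp, (memLp_noiseCoord k).coeFn_toLp]
      with ω h1 h2
    simp only [noiseCoord, h1, h2]
    simp [mul_comm]
  have mp (i : NoiseIndex H) :
      MeasurePreserving (fun ω : NoiseIndex H → ℝ => ω i) (noiseMeasure H) (gaussianReal 0 1) :=
    measurePreserving_eval_infinitePi (fun _ : NoiseIndex H => gaussianReal 0 1) i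
  have hmean (i : NoiseIndex H) : ∫ ω, ω i ∂(noiseMeasure H) = 0 := by
    have := (mp i).hasLaw.integral_eq
    rw [integral_id_gaussianReal] at this
    exact this
  have hvar (i : NoiseIndex H) : ∫ ω, ω i * ω i ∂(noiseMeasure H) = 1 := by
    have h := (mp i).hasLaw.variance_eq
    rw [variance_id_gaussianReal, variance_eq_sub (memLp_noiseCoord i)] at h
    simp only [hmean] at h
    simpa [pow_two] using h
  rw [hinner]
  split_ifs with hjk
  · subst hjk; exact hvar j
  · have hind : iIndepFun (fun (i : NoiseIndex H) (ω : NoiseIndex H → ℝ) => ω i)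
        (noiseMeasure H) :=
      iIndepFun_infinitePi (P := fun _ : NoiseIndex H => gaussianReal 0 1)
        (X := fun _ x => x) (fun _ => measurable_id)
    have := (hind.indepFun hjk).integral_fun_mul_eq_mul_integral
      (memLp_noiseCoord j).aestronglyMeasurable (memLp_noiseCoord k).aestronglyMeasurable
    rw [this, hmean, zero_mul]

variable (H) in
/-- The isonormal Gaussian process over `H`: `f ↦ ∑_k ⟨b_k, f⟩ ξ_k`. -/
def isonormal : H →ₗᵢ[ℝ] Lp ℝ 2 (noiseMeasure H) :=
  (orthonormal_noiseCoord (H := H)).orthogonalFamily.linearIsometry.comp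
    (noiseBasis H).repr.toLinearIsometry

end Isonormal

/-! ### The observation model `dY(t) = X(t) dt + η n^{-1/2} dW(t)`, `X(t) = X(0) + ∫₀ᵗ σ dB` -/

/-- The Hilbert space `L²([0,1]; ℝ^m)`. -/
abbrev L2path (m : ℕ) : Type :=
  Lp (EuclideanSpace ℝ (Fin m)) 2 (volume.restrict (Icc (0 : ℝ) 1))

open Classical in
/-- The class in `L²([0,1]; ℝ^m)` of a square-integrable function (zero for other functions). -/
def toL2path {m : ℕ} (f : ℝ → EuclideanSpace ℝ (Fin m)) : L2path m :=
  if h : MemLp f 2 (volume.restrict (Icc (0 : ℝ) 1)) then h.toLp f else 0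

/-- The sample space, carrying the noise that drives `B`, the noise that drives `W`,
and the initial value `X(0)`. -/
abbrev Sample (p d : ℕ) : Type :=
  (NoiseIndex (L2path p) → ℝ) × (NoiseIndex (L2path d) → ℝ) × EuclideanSpace ℝ (Fin d)

/-- `B`, `W` and `X(0)` are independent, and `X(0)` has law `ν`. -/
def sampleMeasure (p d : ℕ) (ν : Measure (EuclideanSpace ℝ (Fin d))) : Measure (Sample p d) :=
  (noiseMeasure (L2path p)).prod ((noiseMeasure (L2path d)).prod ν)

/-- The `i`-th coordinate of `X(t) - X(0) = ∫₀ᵗ σ(s) dB(s)`, as a Wiener integral. -/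
def martingalePart {d p : ℕ} (σ : ℝ → Matrix (Fin d) (Fin p) ℝ) (i : Fin d) (t : ℝ) :
    Lp ℝ 2 (noiseMeasure (L2path p)) :=
  isonormal (L2path p) (toL2path ((Icc 0 t).indicator fun s => WithLp.toLp 2 (σ s i)))

/-- The `i`-th coordinate of the Brownian motion `W` at time `t`. -/
def noiseW {d : ℕ} (i : Fin d) (t : ℝ) : Lp ℝ 2 (noiseMeasure (L2path d)) :=
  isonormal (L2path d) (toL2path ((Icc 0 t).indicator fun _ => EuclideanSpace.single i 1))

/-- Paths on `[0,1]`, with the product σ-algebra (generated by the evaluations). On continuous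
paths it induces the Borel σ-algebra of the uniform topology. -/
abbrev Path (d : ℕ) : Type := unitInterval → EuclideanSpace ℝ (Fin d)

/-- The observed path `Y(t) = ∫₀ᵗ X(s) ds + η n^{-1/2} W(t)`, where
`∫₀ᵗ X(s) ds = t X(0) + ∫₀ᵗ (X(s) - X(0)) ds` and the last integral is taken in
`L²` of the probability space. -/
def obsPath {d p : ℕ} (σ : ℝ → Matrix (Fin d) (Fin p) ℝ) (η : ℝ) (n : ℕ) (ω : Sample p d) :
    Path d := fun t => WithLp.toLp 2 fun i =>
  (t : ℝ) * ω.2.2 i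
    + (∫ s in (0 : ℝ)..(t : ℝ), martingalePart σ i s : Lp ℝ 2 (noiseMeasure (L2path p))) ω.1
    + η * (n : ℝ) ^ (-(1 / 2) : ℝ) * noiseW i t ω.2.1

lemma measurable_obsPath {d p : ℕ} (σ : ℝ → Matrix (Fin d) (Fin p) ℝ) (η : ℝ) (n : ℕ) :
    Measurable (obsPath σ η n) := by
  refine measurable_pi_lambda _ fun t => ?_
  refine (WithLp.measurable_toLp 2 (Fin d → ℝ)).comp (measurable_pi_lambda _ fun i => ?_)
  have h1 := (Lp.stronglyMeasurable
    (∫ s in (0 : ℝ)..(t : ℝ), martingalePart σ i s :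
      Lp ℝ 2 (noiseMeasure (L2path p)))).measurable
  have h2 := (Lp.stronglyMeasurable (noiseW i (t : ℝ))).measurable
  have h3 : Measurable fun ω : Sample p d => ω.2.2 i := by fun_prop
  exact ((h3.const_mul _).add (h1.comp measurable_fst)).add
    ((h2.comp (measurable_fst.comp measurable_snd)).const_mul _)

/-- The law of the observation for the volatility `σ`. -/
def obsLaw {d p : ℕ} (σ : ℝ → Matrix (Fin d) (Fin p) ℝ) (η : ℝ)
    (ν : Measure (EuclideanSpace ℝ (Fin d))) (n : ℕ) : Measure (Path d) :=
  (sampleMeasure p d ν).map (obsPath σ η n)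

instance {d p : ℕ} (σ : ℝ → Matrix (Fin d) (Fin p) ℝ) (η : ℝ)
    (ν : Measure (EuclideanSpace ℝ (Fin d))) [IsProbabilityMeasure ν] (n : ℕ) :
    IsProbabilityMeasure (obsLaw σ η ν n) := by
  have : IsProbabilityMeasure (sampleMeasure p d ν) := by unfold sampleMeasure; infer_instance
  exact Measure.isProbabilityMeasure_map (measurable_obsPath σ η n).aemeasurable

/-- The law `P_Σ` of the observation when the spot covariance is `S`. The law of `X`, hence that
of the observation, depends on `σ` only through `S = σ σᵀ`; we use `σ = S^{1/2}`. -/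
def spotLaw {d : ℕ} (S : ℝ → Matrix (Fin d) (Fin d) ℝ) (η : ℝ)
    (ν : Measure (EuclideanSpace ℝ (Fin d))) (n : ℕ) : Measure (Path d) :=
  obsLaw (fun s => CFC.sqrt (S s)) η ν n

/-! ### Hypotheses -/

open Classical in
/-- `ordEig k A` is the `k`-th largest eigenvalue `λ_k(A)`, `1 ≤ k ≤ d`, counted with
multiplicity, of the symmetric matrix `A`. -/
def ordEig {d : ℕ} (k : ℕ) (A : Matrix (Fin d) (Fin d) ℝ) : ℝ :=
  if h : A.IsHermitian ∧ 1 ≤ k ∧ k ≤ d then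
    h.1.eigenvalues₀ ⟨k - 1, by rw [Fintype.card_fin]; omega⟩
  else 0

/-- The Hölder ball `C^β(I, L)` of positive semi-definite matrix functions on `I`, with respect to
the spectral norm. -/
def holderBall (d : ℕ) (I : Set ℝ) (β L : ℝ) : Set (ℝ → Matrix (Fin d) (Fin d) ℝ) :=
  {S | (∀ s ∈ I, (S s).PosSemidef) ∧
    ∀ s ∈ I, ∀ u ∈ I, ‖Matrix.toEuclideanCLM (𝕜 := ℝ) (S s - S u)‖ ≤ L * |s - u| ^ β}

/-- The null hypothesis `H₀(I, β, L, lam)` of rank at most `r`. -/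
def nullHyp (d r : ℕ) (I : Set ℝ) (β L lam : ℝ) : Set (ℝ → Matrix (Fin d) (Fin d) ℝ) :=
  {S | S ∈ holderBall d I β L ∧ ∀ s ∈ I, (S s).rank ≤ r ∧ lam ≤ ordEig r (S s)}

/-- The alternative `H₁([t, t+h], lam)`: integrable positive semi-definite matrix functions on
`[0,1]` whose `(r+1)`-st eigenvalue is at least `lam` on `[t, t+h]`. -/
def altHyp (d r : ℕ) (t h lam : ℝ) : Set (ℝ → Matrix (Fin d) (Fin d) ℝ) :=
  {S | (∀ s ∈ Icc (0 : ℝ) 1, (S s).PosSemidef) ∧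
    (∀ i j, IntegrableOn (fun s => S s i j) (Icc (0 : ℝ) 1)) ∧
    ∀ s ∈ Icc t (t + h), lam ≤ ordEig (r + 1) (S s)}

/-! ### Rates, tests and error probabilities -/

/-- The detection rate
`v_n = ((lam⁻¹ L²)^{1/(β+1)} n^{-β/(β+1)}) ∧ (L^{2/(β+2)} n^{-β/(β+2)})`,
where `lam⁻¹ = ∞` for `lam = 0`. -/
def detectionRate (β L lam : ℝ) (n : ℕ) : ℝ :=
  if lam = 0 then L ^ (2 / (β + 2)) * (n : ℝ) ^ (-β / (β + 2))
  else min ((lam⁻¹ * L ^ 2) ^ (1 / (β + 1)) * (n : ℝ) ^ (-β / (β + 1)))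
    (L ^ (2 / (β + 2)) * (n : ℝ) ^ (-β / (β + 2)))

/-- The block length `(lam⁻¹ L² n)^{-1/(2β+2)} ∨ (L n)^{-1/(β+2)}`,
where `lam⁻¹ = ∞` for `lam = 0`. -/
def blockLength (β L lam : ℝ) (n : ℕ) : ℝ :=
  if lam = 0 then (L * n) ^ (-1 / (β + 2))
  else max ((lam⁻¹ * L ^ 2 * n) ^ (-1 / (2 * β + 2))) ((L * n) ^ (-1 / (β + 2)))

/-- (Randomised) tests based on the observed path; `φ y` is the probability of rejecting the
null hypothesis when `y` is observed. -/
def tests (d : ℕ) : Set (Path d → ℝ) := {φ | Measurable φ ∧ ∀ y, φ y ∈ Icc (0 : ℝ) 1}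

/-- The maximal error of the first kind, `sup_{Σ ∈ 𝓗} E_Σ[φ]`. -/
def firstKind {d : ℕ} (η : ℝ) (ν : Measure (EuclideanSpace ℝ (Fin d))) (n : ℕ)
    (𝓗 : Set (ℝ → Matrix (Fin d) (Fin d) ℝ)) (φ : Path d → ℝ) : ℝ≥0∞ :=
  ⨆ S ∈ 𝓗, ∫⁻ y, ENNReal.ofReal (φ y) ∂(spotLaw S η ν n)

/-- The maximal error of the second kind, `sup_{Σ ∈ 𝓗} E_Σ[1 - φ]`. -/
def secondKind {d : ℕ} (η : ℝ) (ν : Measure (EuclideanSpace ℝ (Fin d))) (n : ℕ)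
    (𝓗 : Set (ℝ → Matrix (Fin d) (Fin d) ℝ)) (φ : Path d → ℝ) : ℝ≥0∞ :=
  ⨆ S ∈ 𝓗, ∫⁻ y, ENNReal.ofReal (1 - φ y) ∂(spotLaw S η ν n)

/-- The asymptotic setting: parameters `L_n > 0`, `lam_n ≥ 0`, and interval lengths
`h_n ∈ (0, 1 - t]` with `h_n → 0` and
`h_n ≤ c^{1/(2β)} ((lam_n⁻¹ L_n² n)^{-1/(2β+2)} ∨ (L_n n)^{-1/(β+2)})` for `n ≥ 1`. -/
structure Setting (t β c : ℝ) (L lam h : ℕ → ℝ) : Prop where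
  L_pos : ∀ n, 0 < L n
  lam_nonneg : ∀ n, 0 ≤ lam n
  h_mem : ∀ n, h n ∈ Ioc 0 (1 - t)
  h_tendsto : Tendsto h atTop (𝓝 0)
  h_le : ∀ n, 1 ≤ n → h n ≤ c ^ (1 / (2 * β)) * blockLength β (L n) (lam n) n

end RankTest

end

/-!
No test separates the two hypotheses, because a mixture over each of them leads to almost the same
observation law.

Let `b` be the block length, `v` the detection rate and `M = max lam (L b^β)`. Both branches of the
rate satisfy `v = 1 / (n b²)` and `v M = (L b^β)²` (`detectionRate_blockLength`). Under the null,
`σ` has rows `√M e_i` for `i < r`, row `r` equal to `θ √M e_0`, and zero rows below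
(`volMatrix`), where `θ = ζ a g`: here `g` is a bump on a block `[t, T]` of length at most `b`,
`a` is the largest amplitude allowed by the Hölder condition, up to a constant, and `ζ` is uniform
on an interval `[-k, k]`. So row `r` moves along a Brownian motion that is already present in
row `0`, and the rank stays `r`. The alternative adds `√(3 c v)` times an independent Brownian
coordinate to row `r` on the block, which makes the `(r+1)`-st eigenvalue at least `c v`.

The two mixtures are close in total variation (`drift_hiding`). For a frozen driving Brownian
motion the perturbation changes the drift of the `r`-th coordinate of the observation in two ways.
After the block it adds a constant `I(Q)`, the increment of the new martingale over the block. The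
bump adds `ζ I(A)` there, with `‖A‖` comparable to `‖Q‖ / √c`, so that replacing `ζ` by `ζ + I(Q)
/ I(A)` absorbs the constant, and the uniform prior hardly notices this small shift. Inside the
block what remains is a Cameron–Martin shift of `W`, whose size relative to the noise level is of
order `√c`, because `√v b = n^{-1/2}`; Bessel's inequality bounds its second moment
(`sum_norm_sq_driftOp_le`). If the block ends at time `1`, there is nothing after it to absorb.

The law of the observation depends on `σ` only through `σ σᵀ` (`obsLaw_eq_of_mul_transpose_eq`), so
that the triangular `σ` above may replace the symmetric square root. The eigenvalue bounds come from
a min–max argument (`le_ordEig`), and the Bayes risk bound for mixtures is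
`one_le_firstKind_add_secondKind`.
-/

namespace RankTest

/-! ### Isonormal Gaussian processes -/

section Isonormal

variable {H : Type} [NormedAddCommGroup H] [InnerProductSpace ℝ H] [CompleteSpace H]

lemma isonormal_noiseBasis (k : NoiseIndex H) : isonormal H (noiseBasis H k) = noiseCoord k := by
  classical
  change (orthonormal_noiseCoord (H := H)).orthogonalFamily.linearIsometry
    ((noiseBasis H).repr (noiseBasis H k)) = _
  rw [HilbertBasis.repr_self, OrthogonalFamily.linearIsometry_apply_single]
  simp

lemma measurable_isonormal (f : H) : Measurable (isonormal H f) :=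
  (Lp.stronglyMeasurable _).measurable

lemma continuous_integral_cexp (s : ℝ) :
    Continuous fun f : H => ∫ ω, Complex.exp (s * isonormal H f ω * Complex.I) ∂noiseMeasure H := by
  have hint (f : H) : Integrable (fun ω => Complex.exp (s * isonormal H f ω * Complex.I))
      (noiseMeasure H) := by
    refine Integrable.of_bound (C := 1) ?_ (ae_of_all _ fun ω => ?_)
    · have := measurable_isonormal f
      exact Measurable.aestronglyMeasurable (by fun_prop)
    · rw [← Complex.ofReal_mul, Complex.norm_exp_ofReal_mul_I]
  refine LipschitzWith.continuous (K := ‖s‖₊) (LipschitzWith.of_dist_le_mul fun f g => ?_)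
  rw [dist_eq_norm, ← integral_sub (hint f) (hint g)]
  have hsub : isonormal H f - isonormal H g = isonormal H (f - g) := (map_sub _ _ _).symm
  have hL1 : Integrable (isonormal H (f - g)) (noiseMeasure H) :=
    (Lp.memLp (isonormal H (f - g))).integrable (by norm_num)
  calc ‖∫ ω, (Complex.exp (s * isonormal H f ω * Complex.I)
        - Complex.exp (s * isonormal H g ω * Complex.I)) ∂noiseMeasure H‖
      ≤ ∫ ω, ‖s‖ * ‖isonormal H (f - g) ω‖ ∂noiseMeasure H := by
        refine norm_integral_le_of_norm_le (hL1.norm.const_mul _) ?_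
        have h1 := Lp.coeFn_sub (isonormal H f) (isonormal H g)
        rw [hsub] at h1
        filter_upwards [h1] with ω hω
        rw [hω, Pi.sub_apply, ← norm_mul]
        set x := isonormal H f ω
        set y := isonormal H g ω
        have : Complex.exp (s * x * Complex.I) - Complex.exp (s * y * Complex.I)
            = Complex.exp ((s * y : ℝ) * Complex.I)
              * (Complex.exp (Complex.I * (s * (x - y) : ℝ)) - 1) := by
          rw [mul_sub, ← Complex.exp_add]; push_cast; ring_nf
        rw [this, norm_mul, Complex.norm_exp_ofReal_mul_I, one_mul]
        exact Real.norm_exp_I_mul_ofReal_sub_one_le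
    _ = ‖s‖ * ∫ ω, ‖isonormal H (f - g) ω‖ ∂noiseMeasure H := integral_const_mul _ _
    _ ≤ ‖s‖ * ‖isonormal H (f - g)‖ := by
        gcongr
        rw [Lp.norm_def, integral_norm_eq_lintegral_enorm hL1.aestronglyMeasurable,
          ← eLpNorm_one_eq_lintegral_enorm]
        exact ENNReal.toReal_mono (Lp.eLpNorm_ne_top _)
          (eLpNorm_le_eLpNorm_of_exponent_le (by norm_num) hL1.aestronglyMeasurable)
    _ = ‖s‖₊ * dist f g := by rw [LinearIsometry.norm_map, dist_eq_norm]; rfl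

lemma isonormal_add_ae (f g : H) :
    isonormal H (f + g) =ᵐ[noiseMeasure H] fun ω => isonormal H f ω + isonormal H g ω := by
  rw [map_add]; exact Lp.coeFn_add _ _

lemma isonormal_smul_ae (c : ℝ) (f : H) :
    isonormal H (c • f) =ᵐ[noiseMeasure H] fun ω => c * isonormal H f ω := by
  rw [map_smul]; exact Lp.coeFn_smul _ _

lemma isonormal_zero_ae : isonormal H 0 =ᵐ[noiseMeasure H] fun _ => 0 := by
  rw [map_zero]; exact Lp.coeFn_zero _ _ _

lemma isonormal_sum_ae {ι : Type*} (t : Finset ι) (c : ι → ℝ) (f : ι → H) :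
    isonormal H (∑ j ∈ t, c j • f j) =ᵐ[noiseMeasure H]
      fun ω => ∑ j ∈ t, c j * isonormal H (f j) ω := by
  classical
  induction t using Finset.induction_on with
  | empty => simpa using isonormal_zero_ae (H := H)
  | insert a t ha ih =>
    simp only [Finset.sum_insert ha]
    filter_upwards [isonormal_add_ae (c a • f a) (∑ j ∈ t, c j • f j), ih,
      isonormal_smul_ae (c a) (f a)] with ω h1 h2 h3
    rw [h1, h2, h3]

/-- The second moment of `isonormal f`, in the form of an integral. -/
lemma integral_isonormal_sq (f : H) : ∫ ω, isonormal H f ω ^ 2 ∂noiseMeasure H = ‖f‖ ^ 2 := by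
  rw [← LinearIsometry.norm_map (isonormal H) f, ← real_inner_self_eq_norm_sq, L2.inner_def]
  refine integral_congr_ae (ae_of_all _ fun ω => ?_)
  simp [pow_two]

lemma integral_cexp_isonormal_of_mem_span {f : H}
    (hf : f ∈ Submodule.span ℝ (range (noiseBasis H))) (s : ℝ) :
    ∫ ω, Complex.exp (s * isonormal H f ω * Complex.I) ∂noiseMeasure H
      = Complex.exp (-(s ^ 2 * ‖f‖ ^ 2 / 2 : ℝ)) := by
  obtain ⟨c, rfl⟩ := (Finsupp.mem_span_range_iff_exists_finsupp).1 hf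
  set f := c.sum fun i a => a • noiseBasis H i with hfdef
  have hae : isonormal H f =ᵐ[noiseMeasure H] fun ω => ∑ i : c.support, c i * ω i := by
    have h1 := isonormal_sum_ae c.support c (noiseBasis H)
    have h2 : ∀ᵐ ω ∂noiseMeasure H, ∀ i : c.support,
        isonormal H (noiseBasis H i) ω = ω i := by
      rw [ae_all_iff]
      intro i
      rw [isonormal_noiseBasis]
      exact (memLp_noiseCoord (i : NoiseIndex H)).coeFn_toLp
    filter_upwards [h1, h2] with ω h3 h4
    rw [hfdef, Finsupp.sum, h3, ← Finset.sum_coe_sort]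
    exact Finset.sum_congr rfl fun i _ => by rw [h4 i]
  have mp (i : NoiseIndex H) :
      MeasurePreserving (fun ω : NoiseIndex H → ℝ => ω i) (noiseMeasure H) (gaussianReal 0 1) :=
    measurePreserving_eval_infinitePi (fun _ : NoiseIndex H => gaussianReal 0 1) i
  have hG (i : NoiseIndex H) : HasGaussianLaw (fun ω : NoiseIndex H → ℝ => ω i)
      (noiseMeasure H) := (mp i).hasLaw.hasGaussianLaw
  have hind : iIndepFun (fun (i : NoiseIndex H) (ω : NoiseIndex H → ℝ) => ω i)
      (noiseMeasure H) :=
    iIndepFun_infinitePi (P := fun _ : NoiseIndex H => gaussianReal 0 1)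
      (X := fun _ x => x) (fun _ => measurable_id)
  have hind' : iIndepFun (fun (i : c.support) (ω : NoiseIndex H → ℝ) => c i * ω i)
      (noiseMeasure H) :=
    (hind.precomp Subtype.val_injective).comp (fun (i : c.support) x => c i * x)
      (fun i => measurable_const_mul _)
  have hgauss : HasGaussianLaw (isonormal H f) (noiseMeasure H) :=
    (iIndepFun.hasGaussianLaw_fun_sum (fun i : c.support => by
      simpa using (hG i).fun_smul (c i)) hind').congr hae.symm
  have hmean : ∫ ω, isonormal H f ω ∂noiseMeasure H = 0 := by
    rw [integral_congr_ae hae, integral_finsetSum]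
    · refine Finset.sum_eq_zero fun i _ => ?_
      rw [integral_const_mul]
      have := (mp i).hasLaw.integral_eq
      rw [integral_id_gaussianReal] at this
      rw [this, mul_zero]
    · exact fun i _ => ((hG i).integrable).const_mul _
  have hvar : Var[isonormal H f; noiseMeasure H] = ‖f‖ ^ 2 := by
    rw [variance_eq_sub (Lp.memLp _), hmean]
    simpa using integral_isonormal_sq f
  have hlaw := hgauss.map_eq_gaussianReal
  rw [hmean, hvar] at hlaw
  have h := charFun_gaussianReal (μ := 0) (v := (‖f‖ ^ 2).toNNReal) s
  rw [← hlaw, charFun_apply_real, integral_map (measurable_isonormal f).aemeasurable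
    (Measurable.aestronglyMeasurable (by fun_prop))] at h
  rw [h]
  congr 1
  rw [Real.coe_toNNReal _ (by positivity)]
  push_cast; ring

/-- The isonormal process at `f` is centred Gaussian with variance `‖f‖²`. -/
lemma map_isonormal (f : H) :
    (noiseMeasure H).map (isonormal H f) = gaussianReal 0 (‖f‖₊ ^ 2) := by
  have hall : ∀ s : ℝ, ∀ f : H, ∫ ω, Complex.exp (s * isonormal H f ω * Complex.I) ∂noiseMeasure H
      = Complex.exp (-(s ^ 2 * ‖f‖ ^ 2 / 2 : ℝ)) := by
    intro s f
    have hclosed : IsClosed {f : H | ∫ ω, Complex.exp (s * isonormal H f ω * Complex.I)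
        ∂noiseMeasure H = Complex.exp (-(s ^ 2 * ‖f‖ ^ 2 / 2 : ℝ))} :=
      isClosed_eq (continuous_integral_cexp s) (by fun_prop)
    have hmem : f ∈ closure (Submodule.span ℝ (range (noiseBasis H)) : Set H) := by
      rw [← Submodule.topologicalClosure_coe, (noiseBasis H).dense_span]; trivial
    exact closure_minimal (fun g hg => integral_cexp_isonormal_of_mem_span hg s) hclosed hmem
  have := Measure.isProbabilityMeasure_map (μ := noiseMeasure H)
    (measurable_isonormal f).aemeasurable
  refine Measure.ext_of_charFun (funext fun s => ?_)
  rw [charFun_gaussianReal, charFun_apply_real, integral_map (measurable_isonormal f).aemeasurable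
    (Measurable.aestronglyMeasurable (by fun_prop)), hall]
  congr 1
  rw [show ((‖f‖₊ ^ 2 : NNReal) : ℝ) = ‖f‖ ^ 2 from rfl, Complex.ofReal_zero, mul_zero, zero_mul,
    zero_sub]
  push_cast
  ring

end Isonormal

/-- The Cramér–Wold device: the joint law of finitely many real random variables is determined by
the laws of their linear combinations. -/
lemma map_eq_of_forall_map_sum_eq {ι Ω Ω' : Type*} [Fintype ι] [MeasurableSpace Ω]
    [MeasurableSpace Ω'] {P : Measure Ω} {P' : Measure Ω'} [IsProbabilityMeasure P]
    [IsProbabilityMeasure P'] {Z : ι → Ω → ℝ} {Z' : ι → Ω' → ℝ} (hZ : ∀ j, Measurable (Z j))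
    (hZ' : ∀ j, Measurable (Z' j))
    (h : ∀ c : ι → ℝ, P.map (fun ω => ∑ j, c j * Z j ω) = P'.map (fun ω => ∑ j, c j * Z' j ω)) :
    P.map (fun ω j => Z j ω) = P'.map (fun ω j => Z' j ω) := by
  classical
  have h1 : Measurable fun ω j => Z j ω := measurable_pi_lambda _ hZ
  have h2 : Measurable fun ω j => Z' j ω := measurable_pi_lambda _ hZ'
  have := Measure.isProbabilityMeasure_map (μ := P) h1.aemeasurable
  have := Measure.isProbabilityMeasure_map (μ := P') h2.aemeasurable
  refine Measure.ext_of_charFunDual (funext fun L => ?_)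
  have hL (x : ι → ℝ) : L x = ∑ j, L (Pi.single j 1) * x j := by
    conv_lhs => rw [← Finset.univ_sum_single x]
    rw [map_sum]
    refine Finset.sum_congr rfl fun j _ => ?_
    have : (Pi.single j (x j) : ι → ℝ) = x j • Pi.single j 1 := by
      rw [← Pi.single_smul']; simp
    rw [this, map_smul, smul_eq_mul, mul_comm]
  rw [charFunDual_eq_charFun_map_one, charFunDual_eq_charFun_map_one,
    Measure.map_map (by fun_prop) h1, Measure.map_map (by fun_prop) h2]
  have e1 : L ∘ (fun ω j => Z j ω) = fun ω => ∑ j, L (Pi.single j 1) * Z j ω :=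
    funext fun ω => hL _
  have e2 : L ∘ (fun ω j => Z' j ω) = fun ω => ∑ j, L (Pi.single j 1) * Z' j ω :=
    funext fun ω => hL _
  rw [e1, e2, h]

section Gram

variable {H H' : Type} [NormedAddCommGroup H] [InnerProductSpace ℝ H] [CompleteSpace H]
  [NormedAddCommGroup H'] [InnerProductSpace ℝ H'] [CompleteSpace H']

lemma map_sum_isonormal {ι : Type*} [Fintype ι] (f : ι → H) (c : ι → ℝ) :
    (noiseMeasure H).map (fun ω => ∑ j, c j * isonormal H (f j) ω)
      = gaussianReal 0 (‖∑ j, c j • f j‖₊ ^ 2) := by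
  rw [← map_isonormal]
  exact Measure.map_congr (isonormal_sum_ae Finset.univ c f).symm

/-- The joint law of an isonormal family is determined by its Gram matrix. -/
lemma map_isonormal_eq_of_inner_eq {ι : Type*} [Fintype ι] {f : ι → H} {f' : ι → H'}
    (h : ∀ j k, inner ℝ (f j) (f k) = inner ℝ (f' j) (f' k)) :
    (noiseMeasure H).map (fun ω j => isonormal H (f j) ω)
      = (noiseMeasure H').map (fun ω j => isonormal H' (f' j) ω) := by
  refine map_eq_of_forall_map_sum_eq (fun j => measurable_isonormal _)
    (fun j => measurable_isonormal _) fun c => ?_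
  rw [map_sum_isonormal, map_sum_isonormal]
  congr 1
  have : ‖∑ j, c j • f j‖ ^ 2 = ‖∑ j, c j • f' j‖ ^ 2 := by
    rw [← real_inner_self_eq_norm_sq, ← real_inner_self_eq_norm_sq]
    simp only [sum_inner, inner_sum, real_inner_smul_left, real_inner_smul_right, h]
  exact NNReal.coe_injective (by simpa using this)

end Gram


/-! ### Translations of Gaussian and uniform laws -/

lemma gaussianPDFReal_one_le (m x : ℝ) : gaussianPDFReal m 1 x ≤ 1 := by
  rw [gaussianPDFReal]
  have h1 : (√(2 * Real.pi * ((1 : NNReal) : ℝ)))⁻¹ ≤ 1 := by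
    refine inv_le_one_of_one_le₀ (Real.one_le_sqrt.2 ?_)
    have := Real.pi_gt_three
    simp; linarith
  have h2 : Real.exp (-(x - m) ^ 2 / (2 * ((1 : NNReal) : ℝ))) ≤ 1 :=
    Real.exp_le_one_iff.2 (div_nonpos_of_nonpos_of_nonneg (by nlinarith [sq_nonneg (x - m)])
      (by simp))
  exact mul_le_one₀ h1 (Real.exp_nonneg _) h2

lemma gaussianReal_one_le_volume (m : ℝ) (A : Set ℝ) : gaussianReal m 1 A ≤ volume A := by
  rw [gaussianReal_apply m one_ne_zero]
  calc ∫⁻ x in A, gaussianPDF m 1 x ≤ ∫⁻ _ in A, 1 :=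
        lintegral_mono fun x => by
          rw [gaussianPDF, ← ENNReal.ofReal_one]
          exact ENNReal.ofReal_le_ofReal (gaussianPDFReal_one_le m x)
    _ = volume A := by simp

lemma gaussianPDFReal_one_le_iff (m x : ℝ) :
    gaussianPDFReal m 1 x ≤ gaussianPDFReal 0 1 x ↔ x ^ 2 ≤ (x - m) ^ 2 := by
  have hc : 0 < (√(2 * Real.pi * ((1 : NNReal) : ℝ)))⁻¹ := by
    have := Real.pi_pos
    simp; positivity
  rw [gaussianPDFReal, gaussianPDFReal, mul_le_mul_iff_right₀ hc, Real.exp_le_exp]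
  simp only [NNReal.coe_one, sub_zero]
  constructor <;> intro h <;> linarith

lemma gaussianPDFReal_le_one_iff (m x : ℝ) :
    gaussianPDFReal 0 1 x ≤ gaussianPDFReal m 1 x ↔ (x - m) ^ 2 ≤ x ^ 2 := by
  have hc : 0 < (√(2 * Real.pi * ((1 : NNReal) : ℝ)))⁻¹ := by
    have := Real.pi_pos
    simp; positivity
  rw [gaussianPDFReal, gaussianPDFReal, mul_le_mul_iff_right₀ hc, Real.exp_le_exp]
  simp only [NNReal.coe_one, sub_zero]
  constructor <;> intro h <;> linarith

lemma gaussianReal_le_add_of_nonneg {m : ℝ} (hm : 0 ≤ m) {A : Set ℝ} (hA : MeasurableSet A) :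
    gaussianReal m 1 A ≤ gaussianReal 0 1 A + ENNReal.ofReal m := by
  have hU : MeasurableSet (Ioi (m / 2)) := measurableSet_Ioi
  -- To the left of `m / 2` the density of `N(m, 1)` is the smaller one, to the right the larger.
  have h1 : gaussianReal m 1 (A \ Ioi (m / 2)) ≤ gaussianReal 0 1 (A \ Ioi (m / 2)) := by
    rw [gaussianReal_apply _ one_ne_zero, gaussianReal_apply _ one_ne_zero]
    refine setLIntegral_mono' (hA.diff hU) fun x hx => ENNReal.ofReal_le_ofReal ?_
    rw [gaussianPDFReal_one_le_iff]
    have : x ≤ m / 2 := not_lt.1 hx.2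
    nlinarith
  have h2 : gaussianReal 0 1 (Ioi (m / 2) \ A) ≤ gaussianReal m 1 (Ioi (m / 2) \ A) := by
    rw [gaussianReal_apply _ one_ne_zero, gaussianReal_apply _ one_ne_zero]
    refine setLIntegral_mono' (hU.diff hA) fun x hx => ENNReal.ofReal_le_ofReal ?_
    rw [gaussianPDFReal_le_one_iff]
    have : m / 2 < x := hx.1
    nlinarith
  have h3 : gaussianReal m 1 (Ioi (m / 2)) ≤ gaussianReal 0 1 (Ioi (m / 2)) + ENNReal.ofReal m := by
    have e : gaussianReal m 1 (Ioi (m / 2)) = gaussianReal 0 1 (Ioi (-(m / 2))) := by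
      have := gaussianReal_map_add_const (μ := 0) (v := 1) m
      rw [zero_add] at this
      rw [← this, Measure.map_apply (by fun_prop) hU]
      congr 1
      ext x
      simp only [mem_preimage, mem_Ioi]
      constructor <;> intro h <;> linarith
    have hsub : Ioi (-(m / 2)) ⊆ Ioi (m / 2) ∪ Ioc (-(m / 2)) (m / 2) := by
      intro x hx
      rcases lt_or_ge (m / 2) x with h | h
      · exact Or.inl h
      · exact Or.inr ⟨hx, h⟩
    rw [e]
    refine (measure_mono hsub).trans ((measure_union_le _ _).trans ?_)
    gcongr
    refine (gaussianReal_one_le_volume 0 _).trans ?_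
    rw [Real.volume_Ioc]
    exact ENNReal.ofReal_le_ofReal (by linarith)
  rw [← ENNReal.ofReal_toReal (measure_ne_top (gaussianReal m 1) A),
    ← ENNReal.ofReal_toReal (measure_ne_top (gaussianReal 0 1) A),
    ← ENNReal.ofReal_add ENNReal.toReal_nonneg hm]
  refine ENNReal.ofReal_le_ofReal ?_
  have e1 := measureReal_inter_add_sdiff (μ := gaussianReal m 1) (s := A) hU
  have e2 := measureReal_inter_add_sdiff (μ := gaussianReal 0 1) (s := A) hU
  have e3 := measureReal_inter_add_sdiff (μ := gaussianReal m 1) (s := Ioi (m / 2)) hA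
  have e4 := measureReal_inter_add_sdiff (μ := gaussianReal 0 1) (s := Ioi (m / 2)) hA
  rw [inter_comm] at e3 e4
  have k1 : (gaussianReal m 1).real (A \ Ioi (m / 2)) ≤ (gaussianReal 0 1).real (A \ Ioi (m / 2)) :=
    ENNReal.toReal_mono (measure_ne_top _ _) h1
  have k2 : (gaussianReal 0 1).real (Ioi (m / 2) \ A) ≤ (gaussianReal m 1).real (Ioi (m / 2) \ A) :=
    ENNReal.toReal_mono (measure_ne_top _ _) h2
  have k3 : (gaussianReal m 1).real (Ioi (m / 2)) ≤ (gaussianReal 0 1).real (Ioi (m / 2)) + m := by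
    have := ENNReal.toReal_mono (by finiteness) h3
    rwa [ENNReal.toReal_add (by finiteness) (by finiteness), ENNReal.toReal_ofReal hm] at this
  change (gaussianReal m 1).real A ≤ (gaussianReal 0 1).real A + m
  linarith

/-- Translating a standard normal law by `m` changes the probability of a set by at most `m`. -/
lemma gaussianReal_preimage_add_le {m : ℝ} (hm : 0 ≤ m) {A : Set ℝ} (hA : MeasurableSet A) :
    gaussianReal 0 1 ((fun x => x + m) ⁻¹' A) ≤ gaussianReal 0 1 A + ENNReal.ofReal m := by
  have := gaussianReal_map_add_const (μ := 0) (v := 1) m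
  rw [zero_add] at this
  rw [← Measure.map_apply (by fun_prop) hA, this]
  exact gaussianReal_le_add_of_nonneg hm hA

/-- The uniform law on `[-k, k]`. -/
noncomputable def uniformLaw (k : ℝ) : Measure ℝ :=
  (ENNReal.ofReal (2 * k))⁻¹ • volume.restrict (Icc (-k) k)

lemma isProbabilityMeasure_uniformLaw {k : ℝ} (hk : 0 < k) :
    IsProbabilityMeasure (uniformLaw k) := by
  refine ⟨?_⟩
  rw [uniformLaw, Measure.smul_apply, Measure.restrict_apply_univ, Real.volume_Icc, smul_eq_mul,
    show k - -k = 2 * k by ring]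
  exact ENNReal.inv_mul_cancel (by simpa using hk) ENNReal.ofReal_ne_top

lemma ae_mem_uniformLaw (k : ℝ) : ∀ᵐ x ∂uniformLaw k, x ∈ Icc (-k) k :=
  Measure.ae_smul_measure (ae_restrict_mem measurableSet_Icc) _

lemma volume_Icc_sdiff_Icc_le (k s : ℝ) :
    volume (Icc (-k + s) (k + s) \ Icc (-k) k) ≤ ENNReal.ofReal |s| := by
  rcases le_total 0 s with hs | hs
  · have : Icc (-k + s) (k + s) \ Icc (-k) k ⊆ Icc k (k + s) := by
      rintro x ⟨⟨h1, h2⟩, h3⟩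
      refine ⟨?_, h2⟩
      by_contra h
      exact h3 ⟨by linarith, by linarith⟩
    refine (measure_mono this).trans ?_
    rw [Real.volume_Icc, abs_of_nonneg hs]
    simp
  · have : Icc (-k + s) (k + s) \ Icc (-k) k ⊆ Icc (-k + s) (-k) := by
      rintro x ⟨⟨h1, h2⟩, h3⟩
      refine ⟨h1, ?_⟩
      by_contra h
      exact h3 ⟨by linarith, by linarith⟩
    refine (measure_mono this).trans ?_
    rw [Real.volume_Icc, abs_of_nonpos hs]
    simp

/-- Translating the uniform law on `[-k, k]` by `s` changes the mean of a function with values in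
`[0, 1]` by at most `|s| / (2 k)`. -/
lemma lintegral_uniformLaw_add_le {k : ℝ} (hk : 0 < k) (s : ℝ) {g : ℝ → ℝ≥0∞} (hg : Measurable g)
    (hg1 : ∀ x, g x ≤ 1) :
    ∫⁻ x, g (x + s) ∂uniformLaw k ≤ ∫⁻ x, g x ∂uniformLaw k + ENNReal.ofReal (|s| / (2 * k)) := by
  have h : ∫⁻ x in Icc (-k) k, g (x + s) ≤ (∫⁻ x in Icc (-k) k, g x) + ENNReal.ofReal |s| := by
    have e : ∫⁻ x in Icc (-k) k, g (x + s) = ∫⁻ x in Icc (-k + s) (k + s), g x := by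
      have mp := measurePreserving_add_right (volume : Measure ℝ) s
      rw [← mp.setLIntegral_comp_preimage measurableSet_Icc hg]
      congr 2
      ext x
      simp
    rw [e]
    calc ∫⁻ x in Icc (-k + s) (k + s), g x
        ≤ ∫⁻ x in Icc (-k) k ∪ (Icc (-k + s) (k + s) \ Icc (-k) k), g x :=
          lintegral_mono_set (by rw [union_sdiff_self]; exact subset_union_right)
      _ ≤ (∫⁻ x in Icc (-k) k, g x) + ∫⁻ x in Icc (-k + s) (k + s) \ Icc (-k) k, g x :=
          lintegral_union_le _ _ _
      _ ≤ (∫⁻ x in Icc (-k) k, g x) + ENNReal.ofReal |s| := by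
          gcongr
          calc ∫⁻ x in Icc (-k + s) (k + s) \ Icc (-k) k, g x
              ≤ ∫⁻ _ in Icc (-k + s) (k + s) \ Icc (-k) k, 1 := lintegral_mono fun x => hg1 x
            _ ≤ ENNReal.ofReal |s| := by simpa using volume_Icc_sdiff_Icc_le k s
  rw [uniformLaw, lintegral_smul_measure, lintegral_smul_measure, smul_eq_mul, smul_eq_mul]
  refine (mul_le_mul_right h _).trans ?_
  rw [mul_add, ENNReal.ofReal_div_of_pos (by positivity), ENNReal.div_eq_inv_mul]

section Shift

variable {H : Type} [NormedAddCommGroup H] [InnerProductSpace ℝ H] [CompleteSpace H]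

/-- Splitting off the component of an isonormal family in the direction of a unit vector `e` as an
independent standard normal variable. -/
lemma map_isonormal_eq_map_prod {ι : Type*} [Fintype ι] (f : ι → H) {e : H} (he : ‖e‖ = 1) :
    (noiseMeasure H).map (fun ω j => isonormal H (f j) ω)
      = ((gaussianReal 0 1).prod (noiseMeasure H)).map
        (fun p j => inner ℝ (f j) e * p.1 + isonormal H (f j - (inner ℝ (f j) e : ℝ) • e) p.2) := by
  have hmeas (j : ι) : Measurable fun p : ℝ × (NoiseIndex H → ℝ) =>
      inner ℝ (f j) e * p.1 + isonormal H (f j - (inner ℝ (f j) e : ℝ) • e) p.2 :=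
    (measurable_fst.const_mul _).add ((measurable_isonormal _).comp measurable_snd)
  refine map_eq_of_forall_map_sum_eq (P := noiseMeasure H)
    (P' := (gaussianReal 0 1).prod (noiseMeasure H)) (fun j => measurable_isonormal _) hmeas
    fun c => ?_
  rw [map_sum_isonormal]
  set F := ∑ j, c j • f j with hF
  set a : ℝ := inner ℝ F e with ha
  have hsum : (fun p : ℝ × (NoiseIndex H → ℝ) => ∑ j, c j * (inner ℝ (f j) e * p.1
      + isonormal H (f j - (inner ℝ (f j) e : ℝ) • e) p.2))
      =ᵐ[(gaussianReal 0 1).prod (noiseMeasure H)]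
      fun p => a * p.1 + isonormal H (F - a • e) p.2 := by
    have h1 := isonormal_sum_ae Finset.univ c fun j => f j - (inner ℝ (f j) e : ℝ) • e
    have h2 : ∑ j, c j • (f j - (inner ℝ (f j) e : ℝ) • e) = F - a • e := by
      simp only [smul_sub, Finset.sum_sub_distrib, hF, ha, sum_inner, real_inner_smul_left,
        smul_smul, Finset.sum_smul]
    rw [h2] at h1
    have h3 := (Measure.quasiMeasurePreserving_snd (μ := gaussianReal 0 1)
      (ν := noiseMeasure H)).ae h1
    filter_upwards [h3] with p hp
    rw [hp, ha, hF, sum_inner, Finset.sum_mul, ← Finset.sum_add_distrib]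
    exact Finset.sum_congr rfl fun j _ => by rw [real_inner_smul_left]; ring
  rw [Measure.map_congr hsum]
  have hX : HasLaw (fun p : ℝ × (NoiseIndex H → ℝ) => a * p.1) (gaussianReal 0 ⟨a ^ 2, sq_nonneg a⟩)
      ((gaussianReal 0 1).prod (noiseMeasure H)) := by
    refine ⟨(measurable_fst.const_mul a).aemeasurable, ?_⟩
    rw [show (fun p : ℝ × (NoiseIndex H → ℝ) => a * p.1) = (a * ·) ∘ Prod.fst from rfl,
      ← Measure.map_map (by fun_prop) measurable_fst, Measure.map_fst_prod, measure_univ, one_smul,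
      gaussianReal_map_const_mul, mul_zero, mul_one]
    rfl
  have hY : HasLaw (fun p : ℝ × (NoiseIndex H → ℝ) => isonormal H (F - a • e) p.2)
      (gaussianReal 0 (‖F - a • e‖₊ ^ 2)) ((gaussianReal 0 1).prod (noiseMeasure H)) := by
    refine ⟨((measurable_isonormal _).comp measurable_snd).aemeasurable, ?_⟩
    rw [show (fun p : ℝ × (NoiseIndex H → ℝ) => isonormal H (F - a • e) p.2)
        = isonormal H (F - a • e) ∘ Prod.snd from rfl,
      ← Measure.map_map (measurable_isonormal _) measurable_snd, Measure.map_snd_prod,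
      measure_univ, one_smul, map_isonormal]
  have hind : IndepFun (fun p : ℝ × (NoiseIndex H → ℝ) => a * p.1)
      (fun p => isonormal H (F - a • e) p.2) ((gaussianReal 0 1).prod (noiseMeasure H)) :=
    indepFun_prod (measurable_const_mul a) (measurable_isonormal _)
  have hlaw := gaussianReal_add_gaussianReal_of_indepFun hind hX.map_eq hY.map_eq
  have hlaw' : ((gaussianReal 0 1).prod (noiseMeasure H)).map
      (fun p => a * p.1 + isonormal H (F - a • e) p.2)
      = gaussianReal (0 + 0) (⟨a ^ 2, sq_nonneg a⟩ + ‖F - a • e‖₊ ^ 2) := hlaw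
  rw [hlaw', add_zero]
  congr 1
  refine NNReal.coe_injective ?_
  change ‖F‖ ^ 2 = a ^ 2 + ‖F - a • e‖ ^ 2
  rw [norm_sub_sq_real, norm_smul, he, real_inner_smul_right, ← ha, Real.norm_eq_abs, mul_one,
    sq_abs]
  ring

/-- A quantitative Cameron–Martin theorem: translating an isonormal process by `⟪·, δ⟫` changes
the probability of an event by at most `‖δ‖`. -/
lemma noiseMeasure_isonormal_add_inner_le {ι : Type*} [Fintype ι] (f : ι → H) (δ : H)
    {B : Set (ι → ℝ)} (hB : MeasurableSet B) :
    noiseMeasure H {ω | (fun j => isonormal H (f j) ω + inner ℝ (f j) δ) ∈ B}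
      ≤ noiseMeasure H {ω | (fun j => isonormal H (f j) ω) ∈ B} + ENNReal.ofReal ‖δ‖ := by
  by_cases hδ : δ = 0
  · simp [hδ]
  have hn : ‖δ‖ ≠ 0 := norm_ne_zero_iff.2 hδ
  obtain ⟨e, he, heδ⟩ : ∃ e : H, ‖e‖ = 1 ∧ δ = ‖δ‖ • e :=
    ⟨‖δ‖⁻¹ • δ, by rw [norm_smul, norm_inv, norm_norm, inv_mul_cancel₀ hn],
      by rw [smul_smul, mul_inv_cancel₀ hn, one_smul]⟩
  have hinn (g : H) : (inner ℝ g δ : ℝ) = ‖δ‖ * inner ℝ g e := by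
    rw [← real_inner_smul_right, ← heδ]
  have hI : Measurable fun (ω : NoiseIndex H → ℝ) j => isonormal H (f j) ω :=
    measurable_pi_lambda _ fun j => measurable_isonormal _
  set Φ : ℝ × (NoiseIndex H → ℝ) → ι → ℝ := fun p j =>
    inner ℝ (f j) e * p.1 + isonormal H (f j - (inner ℝ (f j) e : ℝ) • e) p.2 with hΦ
  have hΦm : Measurable Φ := measurable_pi_lambda _ fun j =>
    (measurable_fst.const_mul _).add ((measurable_isonormal _).comp measurable_snd)
  have key (C : Set (ι → ℝ)) (hC : MeasurableSet C) :
      noiseMeasure H {ω | (fun j => isonormal H (f j) ω) ∈ C}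
        = ∫⁻ ω, gaussianReal 0 1 {x | Φ (x, ω) ∈ C} ∂noiseMeasure H := by
    have := DFunLike.congr_fun (map_isonormal_eq_map_prod f he) C
    rw [Measure.map_apply hI hC, Measure.map_apply hΦm hC,
      Measure.prod_apply_symm (hΦm hC)] at this
    exact this
  have hB' : MeasurableSet {y : ι → ℝ | (fun j => y j + inner ℝ (f j) δ) ∈ B} :=
    (measurable_pi_lambda (fun (y : ι → ℝ) (j : ι) => y j + inner ℝ (f j) δ)
      fun j => (measurable_pi_apply j).add_const _) hB
  rw [key B hB]
  refine (key _ hB').le.trans ?_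
  calc ∫⁻ ω, gaussianReal 0 1 {x | Φ (x, ω) ∈ {y : ι → ℝ | (fun j => y j + inner ℝ (f j) δ) ∈ B}}
        ∂noiseMeasure H
      ≤ ∫⁻ ω, (gaussianReal 0 1 {x | Φ (x, ω) ∈ B} + ENNReal.ofReal ‖δ‖) ∂noiseMeasure H := by
        refine lintegral_mono fun ω => ?_
        have hset : {x | Φ (x, ω) ∈ {y : ι → ℝ | (fun j => y j + inner ℝ (f j) δ) ∈ B}}
            = (fun x => x + ‖δ‖) ⁻¹' {x | Φ (x, ω) ∈ B} := by
          ext x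
          have : (fun j => Φ (x, ω) j + inner ℝ (f j) δ) = Φ (x + ‖δ‖, ω) := by
            funext j
            simp only [hΦ]
            rw [hinn]
            ring
          simp only [mem_ofPred_eq, mem_preimage, this]
        rw [hset]
        exact gaussianReal_preimage_add_le (norm_nonneg _)
          ((hΦm.comp (measurable_id.prodMk measurable_const)) hB)
    _ = _ := by
        rw [lintegral_add_right _ measurable_const]
        simp

end Shift


/-! ### Hiding a random drift in the prior and in the noise -/

section Hiding

variable {X : Type*} [MeasurableSpace X] {ν : Measure X} [IsProbabilityMeasure ν]
  {G H : Type} [NormedAddCommGroup G] [InnerProductSpace ℝ G] [CompleteSpace G]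
  [NormedAddCommGroup H] [InnerProductSpace ℝ H] [CompleteSpace H]

lemma noiseMeasure_abs_isonormal_lt_le {A : G} (hA : A ≠ 0) (ε : ℝ) :
    noiseMeasure G {ω | |isonormal G A ω| < ε * ‖A‖} ≤ ENNReal.ofReal (2 * ε) := by
  have hA' : 0 < ‖A‖ := norm_pos_iff.2 hA
  have hunit : ‖‖A‖⁻¹ • A‖ = 1 := by rw [norm_smul, norm_inv, norm_norm, inv_mul_cancel₀ hA'.ne']
  have hlaw := map_isonormal (‖A‖⁻¹ • A)
  have hset : {ω | |isonormal G A ω| < ε * ‖A‖}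
      =ᵐ[noiseMeasure G] isonormal G (‖A‖⁻¹ • A) ⁻¹' Ioo (-ε) ε := by
    filter_upwards [isonormal_smul_ae (‖A‖⁻¹) A] with ω hω
    refine propext ?_
    change |isonormal G A ω| < ε * ‖A‖ ↔ isonormal G (‖A‖⁻¹ • A) ω ∈ Ioo (-ε) ε
    rw [hω, mem_Ioo, ← abs_lt, abs_mul, abs_inv, abs_norm, inv_mul_lt_iff₀ hA', mul_comm]
  rw [measure_congr hset, ← Measure.map_apply (measurable_isonormal _) measurableSet_Ioo, hlaw,
    show ‖‖A‖⁻¹ • A‖₊ ^ 2 = 1 from NNReal.coe_injective (by simp [hunit])]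
  refine (gaussianReal_one_le_volume 0 _).trans ?_
  rw [Real.volume_Ioo]
  exact ENNReal.ofReal_le_ofReal (by linarith)

lemma lintegral_isonormal_sq (f : G) :
    ∫⁻ ω, ENNReal.ofReal (isonormal G f ω ^ 2) ∂noiseMeasure G = ENNReal.ofReal (‖f‖ ^ 2) := by
  rw [← integral_isonormal_sq f, ofReal_integral_eq_lintegral_ofReal]
  · exact (Lp.memLp (isonormal G f)).integrable_sq
  · exact ae_of_all _ fun ω => sq_nonneg _

lemma noiseMeasure_lt_abs_isonormal_le {Q : G} {q K : ℝ} (hQ : ‖Q‖ ≤ q) (hq : 0 < q)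
    (hK : 0 < K) :
    noiseMeasure G {ω | K * q < |isonormal G Q ω|} ≤ ENNReal.ofReal (K⁻¹ ^ 2) := by
  have hm := mul_meas_ge_le_lintegral (μ := noiseMeasure G)
    (f := fun ω => ENNReal.ofReal (isonormal G Q ω ^ 2))
    (((measurable_isonormal Q).pow_const 2).ennreal_ofReal) (ENNReal.ofReal ((K * q) ^ 2))
  rw [lintegral_isonormal_sq] at hm
  have hpos : 0 < (K * q) ^ 2 := by positivity
  have hsub : {ω | K * q < |isonormal G Q ω|} ⊆
      {ω | ENNReal.ofReal ((K * q) ^ 2) ≤ ENNReal.ofReal (isonormal G Q ω ^ 2)} := by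
    intro ω hω
    refine ENNReal.ofReal_le_ofReal ?_
    rw [← sq_abs (isonormal G Q ω)]
    exact pow_le_pow_left₀ (by positivity) (le_of_lt hω) 2
  refine (measure_mono hsub).trans ?_
  have h2 : ENNReal.ofReal (K⁻¹ ^ 2) = ENNReal.ofReal (q ^ 2) / ENNReal.ofReal ((K * q) ^ 2) := by
    rw [← ENNReal.ofReal_div_of_pos hpos]
    congr 1
    field_simp
  rw [h2, ENNReal.le_div_iff_mul_le (Or.inl (ENNReal.ofReal_pos.2 hpos).ne')
    (Or.inl ENNReal.ofReal_ne_top),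
    mul_comm]
  exact hm.trans (ENNReal.ofReal_le_ofReal (pow_le_pow_left₀ (norm_nonneg _) hQ 2))

/-- The mean Euclidean norm of the vector `(isonormal (v i))_i` is at most its root mean square. -/
lemma lintegral_sqrt_sum_isonormal_sq_le {ι : Type*} [Fintype ι] (v : ι → G) {S : ℝ} (hS : 0 < S)
    (hv : ∑ i, ‖v i‖ ^ 2 ≤ S ^ 2) :
    ∫⁻ ω, ENNReal.ofReal √(∑ i, isonormal G (v i) ω ^ 2) ∂noiseMeasure G ≤ ENNReal.ofReal S := by
  have hpt (ω : NoiseIndex G → ℝ) : ENNReal.ofReal √(∑ i, isonormal G (v i) ω ^ 2)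
      ≤ ENNReal.ofReal (S / 2)
        + ENNReal.ofReal (2 * S)⁻¹ * ∑ i, ENNReal.ofReal (isonormal G (v i) ω ^ 2) := by
    have hnn : 0 ≤ ∑ i, isonormal G (v i) ω ^ 2 := Finset.sum_nonneg fun i _ => sq_nonneg _
    rw [← ENNReal.ofReal_sum_of_nonneg fun i _ => sq_nonneg _,
      ← ENNReal.ofReal_mul (by positivity), ← ENNReal.ofReal_add (by positivity) (by positivity)]
    refine ENNReal.ofReal_le_ofReal ?_
    set N := √(∑ i, isonormal G (v i) ω ^ 2) with hN
    rw [← Real.sq_sqrt hnn, ← hN]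
    have : S / 2 + (2 * S)⁻¹ * N ^ 2 - N = (S - N) ^ 2 / (2 * S) := by field_simp; ring
    have h2 : 0 ≤ (S - N) ^ 2 / (2 * S) := by positivity
    linarith
  refine (lintegral_mono hpt).trans ?_
  have hms (i : ι) : Measurable fun ω => ENNReal.ofReal (isonormal G (v i) ω ^ 2) :=
    ((measurable_isonormal (v i)).pow_const 2).ennreal_ofReal
  rw [lintegral_add_left measurable_const,
    lintegral_const_mul _ (Finset.measurable_fun_sum _ fun i _ => hms i),
    lintegral_finsetSum _ fun i _ => hms i]
  simp only [lintegral_isonormal_sq]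
  rw [lintegral_const, measure_univ, mul_one,
    ← ENNReal.ofReal_sum_of_nonneg fun i _ => sq_nonneg _,
    ← ENNReal.ofReal_mul (by positivity),
    ← ENNReal.ofReal_add (by positivity)
      (mul_nonneg (by positivity) (Finset.sum_nonneg fun i _ => sq_nonneg _))]
  refine ENNReal.ofReal_le_ofReal ?_
  calc S / 2 + (2 * S)⁻¹ * ∑ i, ‖v i‖ ^ 2 ≤ S / 2 + (2 * S)⁻¹ * S ^ 2 := by gcongr
    _ = S := by field_simp; ring

/-- The total variation cost in `drift_hiding`, as a function of the free truncation level `ε`. -/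
noncomputable def hidingCost (κ k ε q S₁ S₂ : ℝ) : ℝ :=
  2 * ε + ε ^ 2 + (S₂ + q / ε ^ 2 * S₁) / κ + q / ε ^ 2 / (2 * k)

/-- The deterministic core of `drift_hiding`: for frozen driving noise, a drift that is the sum of
a multiple `s` of the signal `a` and of a Cameron–Martin direction `⟪f, δ⟫` is hidden in the prior
and in the noise. -/
lemma lintegral_uniformLaw_noise_le {ι : Type*} [Fintype ι] (f : ι → H) {b : X → ι → ℝ}
    (hb : Measurable b) (a : ι → ℝ) (s : ℝ) (δ : H) {κ k : ℝ} (hκ : 0 < κ) (hk : 0 < k)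
    {B : Set (ι → ℝ)} (hB : MeasurableSet B) :
    ∫⁻ ζ, (noiseMeasure H).prod ν {p | (fun j => b p.2 j + ζ * a j
        + (s * a j + inner ℝ (f j) δ) + κ * isonormal H (f j) p.1) ∈ B} ∂uniformLaw k
      ≤ ∫⁻ ζ, (noiseMeasure H).prod ν {p | (fun j => b p.2 j + ζ * a j
          + κ * isonormal H (f j) p.1) ∈ B} ∂uniformLaw k
        + ENNReal.ofReal (‖δ‖ / κ + |s| / (2 * k)) := by
  have := isProbabilityMeasure_uniformLaw hk
  have hbj (j : ι) : Measurable fun x => b x j := (measurable_pi_apply j).comp hb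
  have hIj (j : ι) : Measurable fun p : (NoiseIndex H → ℝ) × X => isonormal H (f j) p.1 :=
    (measurable_isonormal _).comp measurable_fst
  set g : ℝ → ℝ≥0∞ := fun ζ => (noiseMeasure H).prod ν
    {p | (fun j => b p.2 j + ζ * a j + κ * isonormal H (f j) p.1) ∈ B} with hg
  have hgm : Measurable g := by
    have hm : Measurable fun p : ℝ × ((NoiseIndex H → ℝ) × X) =>
        fun j => b p.2.2 j + p.1 * a j + κ * isonormal H (f j) p.2.1 :=
      measurable_pi_lambda _ fun j =>
        (((hbj j).comp (measurable_snd.comp measurable_snd)).add (measurable_fst.mul_const _)).add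
          (((hIj j).comp measurable_snd).const_mul _)
    exact measurable_measure_prodMk_left (hm hB)
  have hpt (ζ : ℝ) : (noiseMeasure H).prod ν {p | (fun j => b p.2 j + ζ * a j
      + (s * a j + inner ℝ (f j) δ) + κ * isonormal H (f j) p.1) ∈ B}
      ≤ g (ζ + s) + ENNReal.ofReal (‖δ‖ / κ) := by
    have hm1 : Measurable fun p : (NoiseIndex H → ℝ) × X => fun j => b p.2 j + ζ * a j
        + (s * a j + inner ℝ (f j) δ) + κ * isonormal H (f j) p.1 :=
      measurable_pi_lambda _ fun j => ((((hbj j).comp measurable_snd).add_const _).add_const _).add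
        ((hIj j).const_mul _)
    have hm2 : Measurable fun p : (NoiseIndex H → ℝ) × X => fun j => b p.2 j + (ζ + s) * a j
        + κ * isonormal H (f j) p.1 :=
      measurable_pi_lambda _ fun j => (((hbj j).comp measurable_snd).add_const _).add
        ((hIj j).const_mul _)
    calc _ = ∫⁻ x, noiseMeasure H {ω | (fun j => b x j + ζ * a j
            + (s * a j + inner ℝ (f j) δ) + κ * isonormal H (f j) ω) ∈ B} ∂ν :=
          Measure.prod_apply_symm (hm1 hB)
      _ ≤ ∫⁻ x, (noiseMeasure H {ω | (fun j => b x j + (ζ + s) * a j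
            + κ * isonormal H (f j) ω) ∈ B} + ENNReal.ofReal (‖δ‖ / κ)) ∂ν := by
          refine lintegral_mono fun x => ?_
          have hB' : MeasurableSet {y : ι → ℝ | (fun j => b x j + (ζ + s) * a j + κ * y j) ∈ B} :=
            (measurable_pi_lambda (fun (y : ι → ℝ) (j : ι) => b x j + (ζ + s) * a j + κ * y j)
              fun j => ((measurable_pi_apply j).const_mul _).const_add _) hB
          have h := noiseMeasure_isonormal_add_inner_le f (κ⁻¹ • δ) hB'
          have e (ω : NoiseIndex H → ℝ) :
              (fun j => b x j + ζ * a j + (s * a j + inner ℝ (f j) δ) + κ * isonormal H (f j) ω)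
              = fun j => b x j + (ζ + s) * a j
                + κ * (isonormal H (f j) ω + inner ℝ (f j) (κ⁻¹ • δ)) := by
            funext j
            rw [real_inner_smul_right]
            field_simp
            ring
          simp only [e]
          refine h.trans (le_of_eq ?_)
          rw [norm_smul, norm_inv, Real.norm_of_nonneg hκ.le, div_eq_inv_mul]
          rfl
      _ = _ := by
          rw [lintegral_add_right _ measurable_const, hg]
          simp only [lintegral_const, measure_univ, mul_one]
          congr 1
          exact (Measure.prod_apply_symm (hm2 hB)).symm
  calc _ ≤ ∫⁻ ζ, (g (ζ + s) + ENNReal.ofReal (‖δ‖ / κ)) ∂uniformLaw k := lintegral_mono hpt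
    _ = ∫⁻ ζ, g (ζ + s) ∂uniformLaw k + ENNReal.ofReal (‖δ‖ / κ) := by
        rw [lintegral_add_right _ measurable_const]; simp
    _ ≤ ∫⁻ ζ, g ζ ∂uniformLaw k + ENNReal.ofReal (|s| / (2 * k))
          + ENNReal.ofReal (‖δ‖ / κ) := by
        gcongr
        exact lintegral_uniformLaw_add_le hk s hgm fun ζ => prob_le_one
    _ = _ := by
        rw [add_assoc, ← ENNReal.ofReal_add (by positivity) (by positivity), add_comm (|s| / _)]

/-- Among observations `b + ζ a + κ f` of a signal `a` with uniform random amplitude `ζ` in white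
noise, the presence of an additional random drift `d` cannot be detected, if `d` and `a` are, up to
the persistent parts `m Q` and `m A`, Cameron–Martin directions of small Hilbert–Schmidt size:
the persistent part of `d` is absorbed by the change of amplitude `isonormal Q / isonormal A`. -/
theorem drift_hiding {ι : Type*} [Fintype ι] (f : ι → H) (V₁ V₂ : H →ₗ[ℝ] G) (m : ι → ℝ) (A Q : G)
    {b : (NoiseIndex G → ℝ) → X → ι → ℝ} (hb : ∀ ω, Measurable (b ω)) {κ k ε q S₁ S₂ : ℝ}
    (hκ : 0 < κ) (hk : 0 < k) (hε : 0 < ε) (hq : 0 < q) (hS₁ : 0 < S₁) (hS₂ : 0 < S₂)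
    (hV₁ : ∀ (N : ℕ) (e : Fin N → H), Orthonormal ℝ e → ∑ i, ‖V₁ (e i)‖ ^ 2 ≤ S₁ ^ 2)
    (hV₂ : ∀ (N : ℕ) (e : Fin N → H), Orthonormal ℝ e → ∑ i, ‖V₂ (e i)‖ ^ 2 ≤ S₂ ^ 2)
    (hA : A ≠ 0) (hQ : ‖Q‖ ≤ q * ‖A‖) {a d : ι → G} (ha : ∀ j, a j = V₁ (f j) + m j • A)
    (hd : ∀ j, d j = V₂ (f j) + m j • Q) {B : Set (ι → ℝ)} (hB : MeasurableSet B) :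
    ∫⁻ ω, ∫⁻ ζ, (noiseMeasure H).prod ν {p | (fun j => b ω p.2 j + ζ * isonormal G (a j) ω
        + isonormal G (d j) ω + κ * isonormal H (f j) p.1) ∈ B} ∂uniformLaw k ∂noiseMeasure G
      ≤ ∫⁻ ω, ∫⁻ ζ, (noiseMeasure H).prod ν {p | (fun j => b ω p.2 j + ζ * isonormal G (a j) ω
        + κ * isonormal H (f j) p.1) ∈ B} ∂uniformLaw k ∂noiseMeasure G
        + ENNReal.ofReal (hidingCost κ k ε q S₁ S₂) := by
  classical
  have := isProbabilityMeasure_uniformLaw hk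
  have hAn : 0 < ‖A‖ := norm_pos_iff.2 hA
  -- An orthonormal basis of the span of the observation directions.
  set U : Submodule ℝ H := Submodule.span ℝ (range f) with hU
  have : FiniteDimensional ℝ U := FiniteDimensional.span_of_finite ℝ (finite_range f)
  set bU := stdOrthonormalBasis ℝ U
  set N := Module.finrank ℝ U
  set e : Fin N → H := fun i => (bU i : H) with he
  have heo : Orthonormal ℝ e := bU.orthonormal.comp_linearIsometry U.subtypeₗᵢ
  have hexp (j : ι) : f j = ∑ i, (inner ℝ (f j) (e i) : ℝ) • e i := by
    have hmem : f j ∈ U := Submodule.subset_span (mem_range_self j)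
    have h1 := congrArg (fun u : U => (u : H)) (bU.sum_repr' ⟨f j, hmem⟩)
    simp only [Submodule.coe_sum, Submodule.coe_smul, Submodule.coe_inner] at h1
    exact h1.symm.trans (Finset.sum_congr rfl fun i _ => by rw [real_inner_comm])
  have hVexp (V : H →ₗ[ℝ] G) (j : ι) :
      V (f j) = ∑ i, (inner ℝ (f j) (e i) : ℝ) • V (e i) := by
    conv_lhs => rw [hexp j]
    rw [map_sum]
    simp only [map_smul]
  set N₁ : (NoiseIndex G → ℝ) → ℝ := fun ω => √(∑ i, isonormal G (V₁ (e i)) ω ^ 2) with hN₁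
  set N₂ : (NoiseIndex G → ℝ) → ℝ := fun ω => √(∑ i, isonormal G (V₂ (e i)) ω ^ 2) with hN₂
  have hNm (V : H →ₗ[ℝ] G) : Measurable fun ω => √(∑ i, isonormal G (V (e i)) ω ^ 2) :=
    (Finset.measurable_fun_sum _ fun i _ => (measurable_isonormal _).pow_const 2).sqrt
  set ρ : ℝ := q / ε ^ 2 with hρ
  have hρ0 : 0 < ρ := by positivity
  -- The exceptional event: the available increment is too small, or the drift too large.
  set bad : Set (NoiseIndex G → ℝ) :=
    {ω | |isonormal G A ω| < ε * ‖A‖} ∪ {ω | ε⁻¹ * (q * ‖A‖) < |isonormal G Q ω|} with hbad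
  have hbadm : MeasurableSet bad :=
    (measurableSet_lt (measurable_isonormal A).abs measurable_const).union
      (measurableSet_lt measurable_const (measurable_isonormal Q).abs)
  have hbadP : noiseMeasure G bad ≤ ENNReal.ofReal (2 * ε + ε ^ 2) := by
    refine (measure_union_le _ _).trans ?_
    rw [ENNReal.ofReal_add (by positivity) (by positivity)]
    refine add_le_add (noiseMeasure_abs_isonormal_lt_le hA ε) ?_
    have := noiseMeasure_lt_abs_isonormal_le hQ (by positivity) (inv_pos.2 hε)
    rwa [inv_inv] at this
  set F₁ : (NoiseIndex G → ℝ) → ℝ≥0∞ := fun ω => ∫⁻ ζ, (noiseMeasure H).prod ν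
    {p | (fun j => b ω p.2 j + ζ * isonormal G (a j) ω + isonormal G (d j) ω
      + κ * isonormal H (f j) p.1) ∈ B} ∂uniformLaw k with hF₁
  set F₀ : (NoiseIndex G → ℝ) → ℝ≥0∞ := fun ω => ∫⁻ ζ, (noiseMeasure H).prod ν
    {p | (fun j => b ω p.2 j + ζ * isonormal G (a j) ω
      + κ * isonormal H (f j) p.1) ∈ B} ∂uniformLaw k with hF₀
  have hF₁le (ω) : F₁ ω ≤ 1 := by
    calc F₁ ω ≤ ∫⁻ _, 1 ∂uniformLaw k := lintegral_mono fun ζ => prob_le_one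
      _ = 1 := by simp
  have hlin (V : H →ₗ[ℝ] G) (P : G) (c : ι → G) (hc : ∀ j, c j = V (f j) + m j • P) :
      ∀ᵐ ω ∂noiseMeasure G, ∀ j, isonormal G (c j) ω
        = ∑ i, inner ℝ (f j) (e i) * isonormal G (V (e i)) ω + m j * isonormal G P ω := by
    rw [ae_all_iff]
    intro j
    rw [hc j, hVexp V j]
    filter_upwards [isonormal_add_ae (∑ i, (inner ℝ (f j) (e i) : ℝ) • V (e i)) (m j • P),
      isonormal_sum_ae Finset.univ (fun i => (inner ℝ (f j) (e i) : ℝ)) (fun i => V (e i)),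
      isonormal_smul_ae (m j) P] with ω h1 h2 h3
    rw [h1, h2, h3]
  have hpt : ∀ᵐ ω ∂noiseMeasure G, F₁ ω ≤ F₀ ω + (bad.indicator 1 ω
      + ENNReal.ofReal ((N₂ ω + ρ * N₁ ω) / κ + ρ / (2 * k))) := by
    filter_upwards [hlin V₁ A a ha, hlin V₂ Q d hd] with ω h1 h2
    by_cases hω : ω ∈ bad
    · rw [indicator_of_mem hω, Pi.one_apply, add_left_comm]
      exact (hF₁le ω).trans le_self_add
    rw [indicator_of_notMem hω, zero_add]
    have hgood : ε * ‖A‖ ≤ |isonormal G A ω| ∧ |isonormal G Q ω| ≤ ε⁻¹ * (q * ‖A‖) := by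
      constructor
      · exact not_lt.1 fun h => hω (Or.inl h)
      · exact not_lt.1 fun h => hω (Or.inr h)
    have hA0 : isonormal G A ω ≠ 0 := by
      rw [← abs_pos]; exact lt_of_lt_of_le (by positivity) hgood.1
    set s : ℝ := isonormal G Q ω / isonormal G A ω with hs
    have hsA : s * isonormal G A ω = isonormal G Q ω := div_mul_cancel₀ _ hA0
    have hsρ : |s| ≤ ρ := by
      rw [hs, abs_div, div_le_iff₀ (abs_pos.2 hA0)]
      calc |isonormal G Q ω| ≤ ε⁻¹ * (q * ‖A‖) := hgood.2
        _ = ρ * (ε * ‖A‖) := by rw [hρ]; field_simp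
        _ ≤ ρ * |isonormal G A ω| := by gcongr; exact hgood.1
    -- What the change of amplitude leaves over is a Cameron–Martin direction.
    set δ₁ : H := ∑ i, isonormal G (V₁ (e i)) ω • e i with hδ₁
    set δ₂ : H := ∑ i, isonormal G (V₂ (e i)) ω • e i with hδ₂
    have hnorm (V : H →ₗ[ℝ] G) : ‖∑ i, isonormal G (V (e i)) ω • e i‖
        = √(∑ i, isonormal G (V (e i)) ω ^ 2) := by
      rw [← Real.sqrt_sq (norm_nonneg (∑ i, isonormal G (V (e i)) ω • e i)),
        ← real_inner_self_eq_norm_sq, heo.inner_sum]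
      simp [pow_two]
    have hδ : ‖δ₂ - s • δ₁‖ ≤ N₂ ω + ρ * N₁ ω := by
      refine (norm_sub_le _ _).trans ?_
      rw [norm_smul, Real.norm_eq_abs, hδ₁, hδ₂, hnorm, hnorm]
      exact add_le_add le_rfl (mul_le_mul_of_nonneg_right hsρ (Real.sqrt_nonneg _))
    have hinner (j : ι) (V : H →ₗ[ℝ] G) : (inner ℝ (f j) (∑ i, isonormal G (V (e i)) ω • e i) : ℝ)
        = ∑ i, inner ℝ (f j) (e i) * isonormal G (V (e i)) ω := by
      rw [inner_sum]
      exact Finset.sum_congr rfl fun i _ => by rw [real_inner_smul_right, mul_comm]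
    have hdrift (j : ι) : isonormal G (d j) ω
        = s * isonormal G (a j) ω + inner ℝ (f j) (δ₂ - s • δ₁) := by
      rw [inner_sub_right, real_inner_smul_right, hδ₁, hδ₂, hinner, hinner, h1 j, h2 j, ← hsA]
      ring
    have hmain := lintegral_uniformLaw_noise_le (ν := ν) f (hb ω) (fun j => isonormal G (a j) ω) s
      (δ₂ - s • δ₁) hκ hk hB
    simp only [← hdrift] at hmain
    refine hmain.trans (add_le_add le_rfl (ENNReal.ofReal_le_ofReal ?_))
    gcongr
  calc ∫⁻ ω, F₁ ω ∂noiseMeasure G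
      ≤ ∫⁻ ω, (F₀ ω + (bad.indicator 1 ω
        + ENNReal.ofReal ((N₂ ω + ρ * N₁ ω) / κ + ρ / (2 * k)))) ∂noiseMeasure G :=
        lintegral_mono_ae hpt
    _ = ∫⁻ ω, F₀ ω ∂noiseMeasure G + (noiseMeasure G bad
        + ∫⁻ ω, ENNReal.ofReal ((N₂ ω + ρ * N₁ ω) / κ + ρ / (2 * k)) ∂noiseMeasure G) := by
        have hm3 : Measurable fun ω => ENNReal.ofReal ((N₂ ω + ρ * N₁ ω) / κ + ρ / (2 * k)) :=
          ((((hNm V₂).add ((hNm V₁).const_mul ρ)).div_const κ).add_const _).ennreal_ofReal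
        have hm2 : Measurable fun ω => (bad.indicator 1 ω : ℝ≥0∞)
            + ENNReal.ofReal ((N₂ ω + ρ * N₁ ω) / κ + ρ / (2 * k)) :=
          (measurable_one.indicator hbadm).add hm3
        rw [lintegral_add_right _ hm2, lintegral_add_right _ hm3, lintegral_indicator_one hbadm]
    _ ≤ ∫⁻ ω, F₀ ω ∂noiseMeasure G + ENNReal.ofReal (hidingCost κ k ε q S₁ S₂) := by
        gcongr
        have e1 (ω) : ENNReal.ofReal ((N₂ ω + ρ * N₁ ω) / κ + ρ / (2 * k))
            = ENNReal.ofReal κ⁻¹ * (ENNReal.ofReal (N₂ ω) + ENNReal.ofReal ρ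
              * ENNReal.ofReal (N₁ ω)) + ENNReal.ofReal (ρ / (2 * k)) := by
          have n1 : 0 ≤ N₁ ω := Real.sqrt_nonneg _
          have n2 : 0 ≤ N₂ ω := Real.sqrt_nonneg _
          rw [← ENNReal.ofReal_mul hρ0.le, ← ENNReal.ofReal_add n2 (by positivity),
            ← ENNReal.ofReal_mul (by positivity), ← ENNReal.ofReal_add (by positivity)
              (by positivity)]
          congr 1
          ring
        have hi1 := lintegral_sqrt_sum_isonormal_sq_le (fun i => V₁ (e i)) hS₁ (hV₁ N e heo)
        have hi2 := lintegral_sqrt_sum_isonormal_sq_le (fun i => V₂ (e i)) hS₂ (hV₂ N e heo)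
        have hm2 : Measurable fun ω => ENNReal.ofReal (N₂ ω) + ENNReal.ofReal ρ
            * ENNReal.ofReal (N₁ ω) :=
          (hNm V₂).ennreal_ofReal.add ((hNm V₁).ennreal_ofReal.const_mul _)
        simp only [e1]
        rw [lintegral_add_right _ measurable_const, lintegral_const_mul _ hm2,
          lintegral_add_left (hNm V₂).ennreal_ofReal,
          lintegral_const_mul _ (hNm V₁).ennreal_ofReal, lintegral_const, measure_univ, mul_one]
        calc _ ≤ ENNReal.ofReal (2 * ε + ε ^ 2) + (ENNReal.ofReal κ⁻¹ * (ENNReal.ofReal S₂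
              + ENNReal.ofReal ρ * ENNReal.ofReal S₁) + ENNReal.ofReal (ρ / (2 * k))) := by
              gcongr
          _ = ENNReal.ofReal (hidingCost κ k ε q S₁ S₂) := by
              rw [← ENNReal.ofReal_mul hρ0.le, ← ENNReal.ofReal_add hS₂.le (by positivity),
                ← ENNReal.ofReal_mul (by positivity), ← ENNReal.ofReal_add (by positivity)
                (by positivity), ← ENNReal.ofReal_add (by positivity) (by positivity)]
              congr 1
              rw [hidingCost, ← hρ]
              ring

end Hiding


/-! ### Calculus in `L²([0,1]; ℝ^m)` -/

section L2path

variable {m : ℕ}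

lemma memLp_of_bound {f : ℝ → EuclideanSpace ℝ (Fin m)} (hf : Measurable f) {C : ℝ}
    (hC : ∀ r ∈ Icc (0 : ℝ) 1, ‖f r‖ ≤ C) : MemLp f 2 (volume.restrict (Icc (0 : ℝ) 1)) :=
  MemLp.of_bound hf.aestronglyMeasurable C <| by
    filter_upwards [ae_restrict_mem measurableSet_Icc] with r hr using hC r hr

lemma toL2path_ae {f : ℝ → EuclideanSpace ℝ (Fin m)}
    (hf : MemLp f 2 (volume.restrict (Icc (0 : ℝ) 1))) :
    toL2path f =ᵐ[volume.restrict (Icc (0 : ℝ) 1)] f := by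
  rw [toL2path, dif_pos hf]; exact hf.coeFn_toLp

lemma toL2path_add {f g : ℝ → EuclideanSpace ℝ (Fin m)}
    (hf : MemLp f 2 (volume.restrict (Icc (0 : ℝ) 1)))
    (hg : MemLp g 2 (volume.restrict (Icc (0 : ℝ) 1))) :
    toL2path (fun r => f r + g r) = toL2path f + toL2path g := by
  rw [toL2path, toL2path, toL2path, dif_pos hf, dif_pos hg,
    dif_pos (show MemLp (fun r => f r + g r) 2 _ from hf.add hg)]
  rfl

lemma toL2path_sub {f g : ℝ → EuclideanSpace ℝ (Fin m)}
    (hf : MemLp f 2 (volume.restrict (Icc (0 : ℝ) 1)))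
    (hg : MemLp g 2 (volume.restrict (Icc (0 : ℝ) 1))) :
    toL2path (fun r => f r - g r) = toL2path f - toL2path g := by
  rw [toL2path, toL2path, toL2path, dif_pos hf, dif_pos hg,
    dif_pos (show MemLp (fun r => f r - g r) 2 _ from hf.sub hg)]
  rfl

lemma toL2path_smul {f : ℝ → EuclideanSpace ℝ (Fin m)}
    (hf : MemLp f 2 (volume.restrict (Icc (0 : ℝ) 1))) (c : ℝ) :
    toL2path (fun r => c • f r) = c • toL2path f := by
  rw [toL2path, toL2path, dif_pos hf,
    dif_pos (show MemLp (fun r => c • f r) 2 _ from hf.const_smul c)]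
  rfl

lemma inner_toL2path {f g : ℝ → EuclideanSpace ℝ (Fin m)}
    (hf : MemLp f 2 (volume.restrict (Icc (0 : ℝ) 1)))
    (hg : MemLp g 2 (volume.restrict (Icc (0 : ℝ) 1))) :
    (inner ℝ (toL2path f) (toL2path g) : ℝ) = ∫ r in Icc (0 : ℝ) 1, inner ℝ (f r) (g r) := by
  rw [L2.inner_def]
  refine integral_congr_ae ?_
  filter_upwards [toL2path_ae hf, toL2path_ae hg] with r h1 h2
  rw [h1, h2]

lemma norm_sq_toL2path {f : ℝ → EuclideanSpace ℝ (Fin m)}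
    (hf : MemLp f 2 (volume.restrict (Icc (0 : ℝ) 1))) :
    ‖toL2path f‖ ^ 2 = ∫ r in Icc (0 : ℝ) 1, ‖f r‖ ^ 2 := by
  rw [← real_inner_self_eq_norm_sq, inner_toL2path hf hf]
  simp only [real_inner_self_eq_norm_sq]

lemma norm_toL2path_le {f : ℝ → EuclideanSpace ℝ (Fin m)}
    (hf : MemLp f 2 (volume.restrict (Icc (0 : ℝ) 1))) {u v K : ℝ} (hK : 0 ≤ K)
    (h1 : ∀ r ∈ Icc (0 : ℝ) 1, ‖f r‖ ≤ (uIcc u v).indicator (fun _ => K) r) :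
    ‖toL2path f‖ ≤ K * √|v - u| := by
  refine le_of_sq_le_sq ?_ (by positivity)
  rw [norm_sq_toL2path hf, mul_pow, Real.sq_sqrt (abs_nonneg _)]
  have hI : IntegrableOn (fun r => (uIcc u v).indicator (fun _ => K ^ 2) r) (Icc (0 : ℝ) 1) :=
    (integrable_const _).indicator measurableSet_uIcc
  calc ∫ r in Icc (0 : ℝ) 1, ‖f r‖ ^ 2
      ≤ ∫ r in Icc (0 : ℝ) 1, (uIcc u v).indicator (fun _ => K ^ 2) r := by
        refine setIntegral_mono_on hf.integrable_norm_pow' hI measurableSet_Icc fun r hr => ?_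
        have h := h1 r hr
        by_cases hr' : r ∈ uIcc u v
        · rw [indicator_of_mem hr'] at h ⊢
          exact pow_le_pow_left₀ (norm_nonneg _) h 2
        · rw [indicator_of_notMem hr'] at h ⊢
          rw [le_antisymm h (norm_nonneg _)]; simp
    _ ≤ K ^ 2 * |v - u| := by
        rw [integral_indicator measurableSet_uIcc, setIntegral_const, smul_eq_mul, mul_comm]
        gcongr
        calc (volume.restrict (Icc (0 : ℝ) 1)).real (uIcc u v) ≤ volume.real (uIcc u v) :=
              ENNReal.toReal_mono (by rw [Real.volume_interval]; finiteness)
                (Measure.restrict_le_self _)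
          _ = |v - u| := Real.volume_real_interval

/-- For the integrand `ρ` of a Wiener integral `M(s) = ∫₀ˢ ρ dB`, the element of `L²` representing
`∫₀ᵘ M(s) ds`. -/
noncomputable def pathKernel (ρ : ℝ → EuclideanSpace ℝ (Fin m)) (u : ℝ) : L2path m :=
  toL2path fun r => max (u - r) 0 • ρ r

variable {ρ : ℝ → EuclideanSpace ℝ (Fin m)} {C : ℝ}

lemma memLp_pathKernel (hρ : Measurable ρ) (hC : ∀ r ∈ Icc (0 : ℝ) 1, ‖ρ r‖ ≤ C) (u : ℝ) :
    MemLp (fun r => max (u - r) 0 • ρ r) 2 (volume.restrict (Icc (0 : ℝ) 1)) := by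
  refine memLp_of_bound (C := |u| * C) (by fun_prop) fun r hr => ?_
  rw [norm_smul, Real.norm_eq_abs]
  have : |max (u - r) 0| ≤ |u| := by
    rw [abs_of_nonneg (le_max_right _ _)]
    exact max_le (by linarith [le_abs_self u, hr.1]) (abs_nonneg u)
  exact mul_le_mul this (hC r hr) (norm_nonneg _) (abs_nonneg u)

lemma memLp_indicator_Icc (hρ : Measurable ρ) (hC : ∀ r ∈ Icc (0 : ℝ) 1, ‖ρ r‖ ≤ C) (u : ℝ) :
    MemLp ((Icc 0 u).indicator ρ) 2 (volume.restrict (Icc (0 : ℝ) 1)) :=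
  (memLp_of_bound hρ hC).indicator measurableSet_Icc

lemma hasDerivAt_pathKernel (hρ : Measurable ρ) (hC : ∀ r ∈ Icc (0 : ℝ) 1, ‖ρ r‖ ≤ C) (u : ℝ) :
    HasDerivAt (pathKernel ρ) (toL2path ((Icc 0 u).indicator ρ)) u := by
  have hC0 : 0 ≤ C := (norm_nonneg _).trans (hC 0 (by simp))
  rw [hasDerivAt_iff_isLittleO, Asymptotics.isLittleO_iff]
  intro c hc
  have hlim : Tendsto (fun v : ℝ => C * √|v - u|) (𝓝 u) (𝓝 0) := by
    have : Continuous fun v : ℝ => C * √|v - u| := by fun_prop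
    simpa using this.tendsto u
  filter_upwards [hlim.eventually_lt_const hc] with v hv
  have hmv := memLp_pathKernel hρ hC v
  have hmu := memLp_pathKernel hρ hC u
  have hmi := memLp_indicator_Icc hρ hC u
  have hm1 : MemLp (fun r => max (v - r) 0 • ρ r - max (u - r) 0 • ρ r) 2
    (volume.restrict (Icc (0 : ℝ) 1)) := hmv.sub hmu
  have hm2 : MemLp (fun r => (v - u) • (Icc 0 u).indicator ρ r) 2
    (volume.restrict (Icc (0 : ℝ) 1)) := hmi.const_smul (v - u)
  rw [pathKernel, pathKernel, ← toL2path_sub hmv hmu, ← toL2path_smul hmi,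
    ← toL2path_sub hm1 hm2]
  refine (norm_toL2path_le (hm1.sub hm2) (u := u) (v := v)
    (K := |v - u| * C) (by positivity) fun r hr => ?_).trans ?_
  · have key : max (v - r) 0 • ρ r - max (u - r) 0 • ρ r - (v - u) • (Icc 0 u).indicator ρ r
        = (max (v - r) 0 - max (u - r) 0 - (v - u) * (Icc 0 u).indicator 1 r) • ρ r := by
      by_cases h : r ∈ Icc 0 u
      · simp only [indicator_of_mem h, Pi.one_apply]; module
      · simp only [indicator_of_notMem h]; module
    rw [Pi.sub_apply, key, norm_smul, Real.norm_eq_abs]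
    have hcoef : |max (v - r) 0 - max (u - r) 0 - (v - u) * (Icc 0 u).indicator 1 r|
        ≤ (uIcc u v).indicator (fun _ => |v - u|) r := by
      by_cases h : r ∈ Icc 0 u
      · rw [indicator_of_mem h, Pi.one_apply, mul_one,
          max_eq_left (a := u - r) (by linarith [h.2])]
        by_cases h' : r ∈ uIcc u v
        · rw [indicator_of_mem h']
          rcases le_total (v - r) 0 with h3 | h3
          · rw [max_eq_right h3, abs_of_nonneg (by linarith), abs_of_nonpos (by linarith [h.2])]
            linarith [h.2]
          · rw [max_eq_left h3]
            simp
        · rw [indicator_of_notMem h']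
          have h3 : 0 ≤ v - r := by
            by_contra h4
            exact h' (mem_uIcc.2 (Or.inr ⟨by linarith, h.2⟩))
          rw [max_eq_left h3]; simp
      · have hru : u < r := by
          by_contra h4
          exact h ⟨hr.1, not_lt.1 h4⟩
        rw [indicator_of_notMem h, mul_zero, sub_zero, max_eq_right (a := u - r) (by linarith),
          sub_zero, abs_of_nonneg (le_max_right _ _)]
        by_cases h' : r ∈ uIcc u v
        · rw [indicator_of_mem h']
          exact max_le (by linarith [le_abs_self (v - u)]) (abs_nonneg _)
        · rw [indicator_of_notMem h']
          have h3 : v - r ≤ 0 := by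
            by_contra h4
            exact h' (mem_uIcc.2 (Or.inl ⟨hru.le, by linarith⟩))
          rw [max_eq_right h3]
    by_cases h' : r ∈ uIcc u v
    · rw [indicator_of_mem h'] at hcoef ⊢
      exact mul_le_mul hcoef (hC r hr) (norm_nonneg _) (abs_nonneg _)
    · rw [indicator_of_notMem h'] at hcoef ⊢
      rw [le_antisymm hcoef (abs_nonneg _), zero_mul]
  · rw [Real.norm_eq_abs]
    calc |v - u| * C * √|v - u| = (C * √|v - u|) * |v - u| := by ring
      _ ≤ c * |v - u| := by gcongr

lemma continuous_toL2path_indicator (hρ : Measurable ρ)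
    (hC : ∀ r ∈ Icc (0 : ℝ) 1, ‖ρ r‖ ≤ C) :
    Continuous fun u : ℝ => toL2path ((Icc 0 u).indicator ρ) := by
  have hC0 : 0 ≤ C := (norm_nonneg _).trans (hC 0 (by simp))
  rw [continuous_iff_continuousAt]
  intro u
  rw [ContinuousAt, tendsto_iff_norm_sub_tendsto_zero]
  have hlim : Tendsto (fun v : ℝ => C * √|v - u|) (𝓝 u) (𝓝 0) := by
    have : Continuous fun v : ℝ => C * √|v - u| := by fun_prop
    simpa using this.tendsto u
  refine squeeze_zero (fun _ => norm_nonneg _) (fun v => ?_) hlim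
  have hmv := memLp_indicator_Icc hρ hC v
  have hmu := memLp_indicator_Icc hρ hC u
  rw [← toL2path_sub hmv hmu]
  refine norm_toL2path_le (hmv.sub hmu) hC0 fun r hr => ?_
  rw [Pi.sub_apply]
  by_cases h' : r ∈ uIcc u v
  · rw [indicator_of_mem h']
    by_cases h1 : r ∈ Icc 0 u <;> by_cases h2 : r ∈ Icc 0 v <;>
      simp [-mem_Icc, h1, h2, hC0, hC r hr]
  · have : r ∈ Icc 0 u ↔ r ∈ Icc 0 v := by
      rw [mem_uIcc, not_or] at h'
      constructor
      · rintro ⟨h1, h2⟩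
        exact ⟨h1, by by_contra h3; exact h'.2 ⟨by linarith, h2⟩⟩
      · rintro ⟨h1, h2⟩
        exact ⟨h1, by by_contra h3; exact h'.1 ⟨by linarith, h2⟩⟩
    rw [indicator_of_notMem h']
    by_cases h1 : r ∈ Icc 0 u
    · rw [indicator_of_mem h1, indicator_of_mem (this.1 h1)]; simp
    · rw [indicator_of_notMem h1, indicator_of_notMem (fun h => h1 (this.2 h))]; simp

lemma intervalIntegral_toL2path_indicator (hρ : Measurable ρ)
    (hC : ∀ r ∈ Icc (0 : ℝ) 1, ‖ρ r‖ ≤ C) (u : ℝ) :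
    ∫ s in (0 : ℝ)..u, toL2path ((Icc 0 s).indicator ρ) = pathKernel ρ u := by
  rw [intervalIntegral.integral_eq_sub_of_hasDerivAt
    (fun s _ => hasDerivAt_pathKernel hρ hC s)
    ((continuous_toL2path_indicator hρ hC).intervalIntegrable _ _)]
  have h0 : pathKernel ρ 0 = 0 := by
    rw [← norm_eq_zero, ← sq_eq_zero_iff, pathKernel,
      norm_sq_toL2path (memLp_pathKernel hρ hC 0)]
    refine (setIntegral_congr_fun measurableSet_Icc fun r hr => ?_).trans
      (by simp : ∫ _ in Icc (0 : ℝ) 1, (0 : ℝ) = 0)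
    simp [hr.1]
  rw [h0, sub_zero]

end L2path

/-! ### The law of the observation -/

section Law

variable {p d : ℕ}

/-- The rows of a matrix function are measurable and bounded on `[0,1]`. -/
def BoundedRows (σ : ℝ → Matrix (Fin d) (Fin p) ℝ) : Prop :=
  (∀ i, Measurable fun s => WithLp.toLp 2 (σ s i)) ∧
    ∃ C : ℝ, ∀ i, ∀ s ∈ Icc (0 : ℝ) 1, ‖WithLp.toLp 2 (σ s i)‖ ≤ C

lemma intervalIntegral_martingalePart {σ : ℝ → Matrix (Fin d) (Fin p) ℝ} (hσ : BoundedRows σ)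
    (i : Fin d) (u : ℝ) :
    ∫ s in (0 : ℝ)..u, martingalePart σ i s
      = isonormal (L2path p) (pathKernel (fun s => WithLp.toLp 2 (σ s i)) u) := by
  obtain ⟨h1, C, h2⟩ := hσ
  rw [← intervalIntegral_toL2path_indicator (h1 i) (h2 i)]
  exact (isonormal (L2path p)).toContinuousLinearMap.intervalIntegral_comp_comm
    ((continuous_toL2path_indicator (h1 i) (h2 i)).intervalIntegrable _ _)

/-- The path with initial slope `X(0)`, signal `isonormal (F u i)` and noise level `κ`. -/
noncomputable def signalPath (F : unitInterval → Fin d → L2path p) (κ : ℝ) (ω : Sample p d) :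
    Path d := fun u => WithLp.toLp 2 fun i =>
  (u : ℝ) * ω.2.2 i + isonormal (L2path p) (F u i) ω.1 + κ * noiseW i u ω.2.1

instance (ν : Measure (EuclideanSpace ℝ (Fin d))) [IsProbabilityMeasure ν] :
    IsProbabilityMeasure (sampleMeasure p d ν) := by
  unfold sampleMeasure; infer_instance

lemma measurable_noiseW (i : Fin d) (t : ℝ) : Measurable (noiseW i t) :=
  (Lp.stronglyMeasurable _).measurable

lemma measurable_signalPath (F : unitInterval → Fin d → L2path p) (κ : ℝ) :
    Measurable (signalPath F κ) := by
  refine measurable_pi_lambda _ fun u => ?_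
  refine (WithLp.measurable_toLp 2 (Fin d → ℝ)).comp (measurable_pi_lambda _ fun i => ?_)
  have h3 : Measurable fun ω : Sample p d => ω.2.2 i := by fun_prop
  exact ((h3.const_mul _).add ((measurable_isonormal _).comp measurable_fst)).add
    (((measurable_noiseW i u).comp (measurable_fst.comp measurable_snd)).const_mul _)

lemma obsLaw_eq_map_signalPath {σ : ℝ → Matrix (Fin d) (Fin p) ℝ} (hσ : BoundedRows σ) (η : ℝ)
    (ν : Measure (EuclideanSpace ℝ (Fin d))) (n : ℕ) :
    obsLaw σ η ν n = (sampleMeasure p d ν).map (signalPath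
      (fun u i => pathKernel (fun s => WithLp.toLp 2 (σ s i)) u)
      (η * (n : ℝ) ^ (-(1 / 2) : ℝ))) := by
  rw [obsLaw]
  congr 1
  funext ω u
  rw [obsPath, signalPath]
  congr 1
  funext i
  rw [intervalIntegral_martingalePart hσ]

/-- The law of a signal path depends on the signal only through its Gram matrix. -/
lemma map_signalPath_eq_of_inner_eq {F F' : unitInterval → Fin d → L2path p}
    (h : ∀ u i v j, inner ℝ (F u i) (F v j) = inner ℝ (F' u i) (F' v j)) (κ : ℝ)
    (ν : Measure (EuclideanSpace ℝ (Fin d))) [IsProbabilityMeasure ν] :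
    (sampleMeasure p d ν).map (signalPath F κ) = (sampleMeasure p d ν).map (signalPath F' κ) := by
  have hmeas (F : unitInterval → Fin d → L2path p) :
      AEMeasurable (fun ω u => signalPath F κ ω u) (sampleMeasure p d ν) :=
    (measurable_signalPath F κ).aemeasurable
  refine (map_eq_iff_forall_finset_map_restrict_eq (X := fun u ω => signalPath F κ ω u)
    (Y := fun u ω => signalPath F' κ ω u) (hmeas F) (hmeas F')).2 fun I => ?_
  -- On finitely many times, a signal path is a function of finitely many isonormal variables.
  let Ψ : (I × Fin d → ℝ) × ((NoiseIndex (L2path d) → ℝ) × EuclideanSpace ℝ (Fin d)) →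
      I → EuclideanSpace ℝ (Fin d) := fun z u => WithLp.toLp 2 fun i =>
    ((u : unitInterval) : ℝ) * z.2.2 i + z.1 (u, i) + κ * noiseW i (u : unitInterval) z.2.1
  have hΨ : Measurable Ψ := by
    refine measurable_pi_lambda _ fun u => ?_
    refine (WithLp.measurable_toLp 2 (Fin d → ℝ)).comp (measurable_pi_lambda _ fun i => ?_)
    exact (Measurable.add (by fun_prop) (by fun_prop)).add
      (((measurable_noiseW i _).comp (measurable_fst.comp measurable_snd)).const_mul _)
  have key (F : unitInterval → Fin d → L2path p) :
      (sampleMeasure p d ν).map (fun ω => I.restrict fun u => signalPath F κ ω u)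
        = (((noiseMeasure (L2path p)).map
            (fun ω (j : I × Fin d) => isonormal (L2path p) (F j.1 j.2) ω)).prod
          ((noiseMeasure (L2path d)).prod ν)).map Ψ := by
    have hX : Measurable fun ω (j : I × Fin d) => isonormal (L2path p) (F j.1 j.2) ω :=
      measurable_pi_lambda _ fun j => measurable_isonormal _
    have h1 := Measure.map_prod_map (noiseMeasure (L2path p)) ((noiseMeasure (L2path d)).prod ν)
      hX measurable_id
    rw [Measure.map_id] at h1
    rw [h1, Measure.map_map hΨ (hX.prodMap measurable_id)]
    rfl
  rw [key F, key F', map_isonormal_eq_of_inner_eq (f := fun j : I × Fin d => F j.1 j.2)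
    (f' := fun j : I × Fin d => F' j.1 j.2) fun j k => h _ _ _ _]

/-- The law of the observation depends on `σ` only through `σ σᵀ`. -/
lemma obsLaw_eq_of_mul_transpose_eq {σ σ' : ℝ → Matrix (Fin d) (Fin p) ℝ} (hσ : BoundedRows σ)
    (hσ' : BoundedRows σ') (h : ∀ s, σ s * (σ s).transpose = σ' s * (σ' s).transpose) (η : ℝ)
    (ν : Measure (EuclideanSpace ℝ (Fin d))) [IsProbabilityMeasure ν] (n : ℕ) :
    obsLaw σ η ν n = obsLaw σ' η ν n := by
  rw [obsLaw_eq_map_signalPath hσ, obsLaw_eq_map_signalPath hσ']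
  refine map_signalPath_eq_of_inner_eq (fun u i v j => ?_) _ ν
  have hrow (τ : ℝ → Matrix (Fin d) (Fin p) ℝ) (s : ℝ) :
      (inner ℝ (WithLp.toLp 2 (τ s i) : EuclideanSpace ℝ (Fin p)) (WithLp.toLp 2 (τ s j)) : ℝ)
        = (τ s * (τ s).transpose) i j := by
    rw [EuclideanSpace.inner_toLp_toLp, dotProduct_comm]
    simp [Matrix.mul_apply, dotProduct]
  obtain ⟨h1, C, h2⟩ := hσ
  obtain ⟨h1', C', h2'⟩ := hσ'
  rw [pathKernel, pathKernel, pathKernel, pathKernel,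
    inner_toL2path (memLp_pathKernel (h1 i) (h2 i) _) (memLp_pathKernel (h1 j) (h2 j) _),
    inner_toL2path (memLp_pathKernel (h1' i) (h2' i) _) (memLp_pathKernel (h1' j) (h2' j) _)]
  refine integral_congr_ae (ae_of_all _ fun s => ?_)
  simp only [real_inner_smul_left, real_inner_smul_right, hrow, h s]

end Law


/-! ### Bayesian lower bounds -/

/-- An inequality `μ B ≤ ν B + ε` between finite measures on a product space extends from cylinders
to all measurable sets. -/
lemma measure_le_add_of_forall_cylinder {T : Type*} {X : T → Type*}
    [∀ t, MeasurableSpace (X t)] {μ ν : Measure (∀ t, X t)} [IsFiniteMeasure μ]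
    [IsFiniteMeasure ν] {ε : ℝ≥0∞}
    (h : ∀ (I : Finset T) (S : Set (∀ i : I, X i)), MeasurableSet S →
      μ (cylinder I S) ≤ ν (cylinder I S) + ε)
    {B : Set (∀ t, X t)} (hB : MeasurableSet B) : μ B ≤ ν B + ε := by
  have hd : (μ + ν).MeasureDense (measurableCylinders X) :=
    Measure.MeasureDense.of_generateFrom_isSetAlgebra_finite _ isSetAlgebra_measurableCylinders
      generateFrom_measurableCylinders.symm
  refine ENNReal.le_of_forall_pos_le_add fun r hr _ => ?_
  obtain ⟨C, hC, hBC⟩ := hd.approx B hB (measure_ne_top _ _) (r : ℝ) (by exact_mod_cast hr)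
  obtain ⟨I, S, hS, rfl⟩ := (mem_measurableCylinders _).1 hC
  rw [ENNReal.ofReal_coe_nnreal] at hBC
  set D := symmDiff B (cylinder I S) with hD
  have h1 : μ B ≤ μ (cylinder I S) + μ (B \ cylinder I S) :=
    (measure_mono (by rw [union_sdiff_self]; exact subset_union_right)).trans (measure_union_le _ _)
  have h2 : ν (cylinder I S) ≤ ν B + ν (cylinder I S \ B) :=
    (measure_mono (by rw [union_sdiff_self]; exact subset_union_right)).trans (measure_union_le _ _)
  have h3 : μ (B \ cylinder I S) + ν (cylinder I S \ B) ≤ r := by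
    calc _ ≤ μ D + ν D := by
          gcongr
          · exact fun x hx => Or.inl hx
          · exact fun x hx => Or.inr hx
      _ ≤ r := by rw [← Measure.add_apply]; exact hBC.le
  calc μ B ≤ μ (cylinder I S) + μ (B \ cylinder I S) := h1
    _ ≤ (ν B + ν (cylinder I S \ B) + ε) + μ (B \ cylinder I S) := by
        gcongr
        exact (h I S hS).trans (by gcongr)
    _ = ν B + ε + (μ (B \ cylinder I S) + ν (cylinder I S \ B)) := by ring
    _ ≤ ν B + ε + r := by gcongr

lemma lintegral_le_add_of_forall_measure_le_add {Ω : Type*} [MeasurableSpace Ω] {μ ν : Measure Ω}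
    {ε : ℝ≥0∞} (h : ∀ B, MeasurableSet B → μ B ≤ ν B + ε) {φ : Ω → ℝ}
    (hφ : Measurable φ) (h01 : ∀ y, φ y ∈ Icc (0 : ℝ) 1) :
    ∫⁻ y, ENNReal.ofReal (φ y) ∂μ ≤ ∫⁻ y, ENNReal.ofReal (φ y) ∂ν + ε := by
  rw [lintegral_eq_lintegral_meas_lt μ (ae_of_all _ fun y => (h01 y).1) hφ.aemeasurable,
    lintegral_eq_lintegral_meas_lt ν (ae_of_all _ fun y => (h01 y).1) hφ.aemeasurable]
  have hpt (t : ℝ) (ht : t ∈ Ioi (0 : ℝ)) :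
      μ {y | t < φ y} ≤ ν {y | t < φ y} + (Ioc (0 : ℝ) 1).indicator (fun _ => ε) t := by
    by_cases h1 : t ≤ 1
    · rw [indicator_of_mem (show t ∈ Ioc (0 : ℝ) 1 from ⟨ht, h1⟩)]
      exact h _ (measurableSet_lt measurable_const hφ)
    · have : {y | t < φ y} = ∅ := by
        refine eq_empty_of_forall_notMem fun y hy => h1 ?_
        exact (le_of_lt hy).trans (h01 y).2
      simp [this]
  calc _ ≤ ∫⁻ t in Ioi (0 : ℝ), (ν {y | t < φ y} + (Ioc (0 : ℝ) 1).indicator (fun _ => ε) t) :=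
        setLIntegral_mono' measurableSet_Ioi hpt
    _ = (∫⁻ t in Ioi (0 : ℝ), ν {y | t < φ y})
        + ∫⁻ t in Ioi (0 : ℝ), (Ioc (0 : ℝ) 1).indicator (fun _ => ε) t :=
        lintegral_add_right _ (measurable_const.indicator measurableSet_Ioc)
    _ ≤ _ := by
        gcongr
        calc _ ≤ ∫⁻ t, (Ioc (0 : ℝ) 1).indicator (fun _ => ε) t := setLIntegral_le_lintegral _ _
          _ = ε := by rw [lintegral_indicator_const measurableSet_Ioc]; simp

section Mixture

variable {d : ℕ}

/-- The observation as a function of the noise and of an additional parameter `ζ`, for a signal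
`g ζ` that is jointly measurable in `ζ` and the noise. -/
noncomputable def mixPath (g : unitInterval → Fin d → ℝ × (NoiseIndex (L2path d) → ℝ) → ℝ) (κ : ℝ)
    (z : ℝ × Sample d d) : Path d := fun u => WithLp.toLp 2 fun i =>
  (u : ℝ) * z.2.2.2 i + g u i (z.1, z.2.1) + κ * noiseW i u z.2.2.1

variable {g : unitInterval → Fin d → ℝ × (NoiseIndex (L2path d) → ℝ) → ℝ} {κ : ℝ}

lemma measurable_mixPath (hg : ∀ u i, Measurable (g u i)) : Measurable (mixPath g κ) := by
  refine measurable_pi_lambda _ fun u => ?_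
  refine (WithLp.measurable_toLp 2 (Fin d → ℝ)).comp (measurable_pi_lambda _ fun i => ?_)
  have h3 : Measurable fun z : ℝ × Sample d d => z.2.2.2 i := by fun_prop
  have h4 : Measurable fun z : ℝ × Sample d d => (z.1, z.2.1) := by fun_prop
  have h5 : Measurable fun z : ℝ × Sample d d => z.2.2.1 := by fun_prop
  exact ((h3.const_mul _).add ((hg u i).comp h4)).add
    (((measurable_noiseW i u).comp h5).const_mul _)

lemma map_mixPath_eq_map_signalPath (hg : ∀ u i, Measurable (g u i)) {ζ : ℝ}
    {F : unitInterval → Fin d → L2path d}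
    (hF : ∀ u i, (fun ω => g u i (ζ, ω)) =ᵐ[noiseMeasure (L2path d)] isonormal (L2path d) (F u i))
    (ν : Measure (EuclideanSpace ℝ (Fin d))) [IsProbabilityMeasure ν] :
    (sampleMeasure d d ν).map (fun ω => mixPath g κ (ζ, ω))
      = (sampleMeasure d d ν).map (signalPath F κ) := by
  refine map_eq_of_forall_ae_eq (X := fun u ω => mixPath g κ (ζ, ω) u)
    (Y := fun u ω => signalPath F κ ω u)
    ((measurable_mixPath hg).comp measurable_prodMk_left).aemeasurable
    (measurable_signalPath F κ).aemeasurable fun u => ?_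
  have h : ∀ᵐ ω ∂noiseMeasure (L2path d), ∀ i, g u i (ζ, ω) = isonormal (L2path d) (F u i) ω :=
    ae_all_iff.2 fun i => hF u i
  have h2 : ∀ᵐ ω ∂sampleMeasure d d ν, ∀ i, g u i (ζ, ω.1) = isonormal (L2path d) (F u i) ω.1 :=
    Measure.quasiMeasurePreserving_fst.ae h
  filter_upwards [h2] with ω hω
  simp only [mixPath, signalPath, hω]

/-- The Bayes risk bound: if the mixtures over `ζ` of the laws in the null hypothesis and of those
in the alternative are `ε`-close in total variation, no test has a sum of errors below `1 - ε`. -/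
lemma one_le_firstKind_add_secondKind {η : ℝ} {n : ℕ}
    {ν : Measure (EuclideanSpace ℝ (Fin d))} [IsProbabilityMeasure ν]
    {𝓗₀ 𝓗₁ : Set (ℝ → Matrix (Fin d) (Fin d) ℝ)} {S₀ S₁ : ℝ → ℝ → Matrix (Fin d) (Fin d) ℝ}
    {k : ℝ} (hk : 0 < k) (hS₀ : ∀ ζ ∈ Icc (-k) k, S₀ ζ ∈ 𝓗₀) (hS₁ : ∀ ζ ∈ Icc (-k) k, S₁ ζ ∈ 𝓗₁)
    {g₀ g₁ : unitInterval → Fin d → ℝ × (NoiseIndex (L2path d) → ℝ) → ℝ}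
    (hg₀ : ∀ u i, Measurable (g₀ u i)) (hg₁ : ∀ u i, Measurable (g₁ u i))
    (hlaw₀ : ∀ ζ, spotLaw (S₀ ζ) η ν n
      = (sampleMeasure d d ν).map fun ω => mixPath g₀ κ (ζ, ω))
    (hlaw₁ : ∀ ζ, spotLaw (S₁ ζ) η ν n
      = (sampleMeasure d d ν).map fun ω => mixPath g₁ κ (ζ, ω)) {ε : ℝ≥0∞}
    (hTV : ∀ B, MeasurableSet B →
      ((uniformLaw k).prod (sampleMeasure d d ν)).map (mixPath g₁ κ) B
        ≤ ((uniformLaw k).prod (sampleMeasure d d ν)).map (mixPath g₀ κ) B + ε)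
    {φ : Path d → ℝ} (hφ : φ ∈ tests d) :
    1 ≤ firstKind η ν n 𝓗₀ φ + secondKind η ν n 𝓗₁ φ + ε := by
  have := isProbabilityMeasure_uniformLaw hk
  obtain ⟨hφm, h01⟩ := hφ
  have hmix {g : unitInterval → Fin d → ℝ × (NoiseIndex (L2path d) → ℝ) → ℝ}
      (hg : ∀ u i, Measurable (g u i)) {S : ℝ → ℝ → Matrix (Fin d) (Fin d) ℝ}
      (hlaw : ∀ ζ, spotLaw (S ζ) η ν n
        = (sampleMeasure d d ν).map fun ω => mixPath g κ (ζ, ω))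
      {𝓗 : Set (ℝ → Matrix (Fin d) (Fin d) ℝ)} (hS : ∀ ζ ∈ Icc (-k) k, S ζ ∈ 𝓗)
      {ψ : Path d → ℝ≥0∞} (hψ : Measurable ψ) :
      ∫⁻ y, ψ y ∂((uniformLaw k).prod (sampleMeasure d d ν)).map (mixPath g κ)
        ≤ ⨆ S ∈ 𝓗, ∫⁻ y, ψ y ∂spotLaw S η ν n := by
    have hm : Measurable fun z => ψ (mixPath g κ z) := hψ.comp (measurable_mixPath hg)
    rw [lintegral_map hψ (measurable_mixPath hg), lintegral_prod _ hm.aemeasurable]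
    calc _ ≤ ∫⁻ _, (⨆ S ∈ 𝓗, ∫⁻ y, ψ y ∂spotLaw S η ν n) ∂uniformLaw k := by
          refine lintegral_mono_ae ?_
          filter_upwards [ae_mem_uniformLaw k] with ζ hζ
          refine le_trans (le_of_eq ?_)
            (le_iSup₂ (f := fun S (_ : S ∈ 𝓗) => ∫⁻ y, ψ y ∂spotLaw S η ν n) (S ζ) (hS ζ hζ))
          rw [hlaw ζ]
          exact (lintegral_map hψ ((measurable_mixPath hg).comp measurable_prodMk_left)).symm
      _ = _ := by simp
  have hφ1 : Measurable fun y => ENNReal.ofReal (φ y) := hφm.ennreal_ofReal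
  have hφ2 : Measurable fun y => ENNReal.ofReal (1 - φ y) := (hφm.const_sub 1).ennreal_ofReal
  have := Measure.isProbabilityMeasure_map (μ := (uniformLaw k).prod (sampleMeasure d d ν))
    (measurable_mixPath (κ := κ) hg₁).aemeasurable
  set P₀ := ((uniformLaw k).prod (sampleMeasure d d ν)).map (mixPath g₀ κ)
  set P₁ := ((uniformLaw k).prod (sampleMeasure d d ν)).map (mixPath g₁ κ)
  calc (1 : ℝ≥0∞) = ∫⁻ y, (ENNReal.ofReal (φ y) + ENNReal.ofReal (1 - φ y)) ∂P₁ := by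
        have e (y : Path d) : ENNReal.ofReal (φ y) + ENNReal.ofReal (1 - φ y) = 1 := by
          rw [← ENNReal.ofReal_add (h01 y).1 (sub_nonneg.2 (h01 y).2)]; simp
        simp [e]
    _ = ∫⁻ y, ENNReal.ofReal (φ y) ∂P₁ + ∫⁻ y, ENNReal.ofReal (1 - φ y) ∂P₁ :=
        lintegral_add_left hφ1 _
    _ ≤ (∫⁻ y, ENNReal.ofReal (φ y) ∂P₀ + ε) + ∫⁻ y, ENNReal.ofReal (1 - φ y) ∂P₁ := by
        gcongr
        exact lintegral_le_add_of_forall_measure_le_add hTV hφm h01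
    _ ≤ (firstKind η ν n 𝓗₀ φ + ε) + secondKind η ν n 𝓗₁ φ := by
        gcongr
        · exact hmix hg₀ hlaw₀ hS₀ hφ1
        · exact hmix hg₁ hlaw₁ hS₁ hφ2
    _ = _ := by ring

lemma map_mixPath_cylinder {k : ℝ} (hk : 0 < k) (hg : ∀ u i, Measurable (g u i))
    (ν : Measure (EuclideanSpace ℝ (Fin d))) [IsProbabilityMeasure ν] {B : Set (Path d)}
    (hB : MeasurableSet B) :
    ((uniformLaw k).prod (sampleMeasure d d ν)).map (mixPath g κ) B
      = ∫⁻ ω, ∫⁻ ζ, (noiseMeasure (L2path d)).prod ν {p | mixPath g κ (ζ, ω, p) ∈ B}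
        ∂uniformLaw k ∂noiseMeasure (L2path d) := by
  have := isProbabilityMeasure_uniformLaw hk
  have hm : MeasurableSet {z : (ℝ × (NoiseIndex (L2path d) → ℝ)) ×
      ((NoiseIndex (L2path d) → ℝ) × EuclideanSpace ℝ (Fin d)) |
      mixPath g κ (z.1.1, z.1.2, z.2) ∈ B} := by
    have : Measurable fun z : (ℝ × (NoiseIndex (L2path d) → ℝ)) ×
      ((NoiseIndex (L2path d) → ℝ) × EuclideanSpace ℝ (Fin d)) =>
      ((z.1.1, z.1.2, z.2) : ℝ × Sample d d) := by fun_prop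
    exact ((measurable_mixPath hg).comp this) hB
  rw [Measure.map_apply (measurable_mixPath hg) hB,
    Measure.prod_apply (measurable_mixPath hg hB),
    lintegral_lintegral_swap (f := fun ω ζ => (noiseMeasure (L2path d)).prod ν
      {p | mixPath g κ (ζ, ω, p) ∈ B})]
  · refine lintegral_congr fun ζ => ?_
    rw [sampleMeasure, Measure.prod_apply]
    · rfl
    · exact measurable_prodMk_left (measurable_mixPath hg hB)
  · have := measurable_measure_prodMk_left (ν := (noiseMeasure (L2path d)).prod ν) hm
    exact (this.comp measurable_swap).aemeasurable

/-- The signal of the null hypothesis, of random amplitude `ζ` in the direction `a`. -/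
noncomputable def nullSignal (b a : unitInterval → Fin d → L2path d) (u : unitInterval) (i : Fin d)
    (z : ℝ × (NoiseIndex (L2path d) → ℝ)) : ℝ :=
  isonormal (L2path d) (b u i) z.2 + z.1 * isonormal (L2path d) (a u i) z.2

/-- The signal of the alternative, in which a drift `q` is added to the one of the null. -/
noncomputable def altSignal (b a q : unitInterval → Fin d → L2path d) (u : unitInterval)
    (i : Fin d) (z : ℝ × (NoiseIndex (L2path d) → ℝ)) : ℝ :=
  nullSignal b a u i z + isonormal (L2path d) (q u i) z.2

variable {b a q : unitInterval → Fin d → L2path d}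

lemma measurable_nullSignal (u : unitInterval) (i : Fin d) : Measurable (nullSignal b a u i) :=
  ((measurable_isonormal _).comp measurable_snd).add
    (measurable_fst.mul ((measurable_isonormal _).comp measurable_snd))

lemma measurable_altSignal (u : unitInterval) (i : Fin d) : Measurable (altSignal b a q u i) :=
  (measurable_nullSignal u i).add ((measurable_isonormal _).comp measurable_snd)

lemma nullSignal_ae (ζ : ℝ) (u : unitInterval) (i : Fin d) :
    (fun ω => nullSignal b a u i (ζ, ω)) =ᵐ[noiseMeasure (L2path d)]
      isonormal (L2path d) (b u i + ζ • a u i) := by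
  filter_upwards [isonormal_add_ae (b u i) (ζ • a u i), isonormal_smul_ae ζ (a u i)] with ω h1 h2
  rw [h1, h2, nullSignal]

lemma altSignal_ae (ζ : ℝ) (u : unitInterval) (i : Fin d) :
    (fun ω => altSignal b a q u i (ζ, ω)) =ᵐ[noiseMeasure (L2path d)]
      isonormal (L2path d) (b u i + ζ • a u i + q u i) := by
  filter_upwards [isonormal_add_ae (b u i + ζ • a u i) (q u i),
    nullSignal_ae (b := b) (a := a) ζ u i] with ω h1 h2
  rw [h1, ← h2, altSignal]

/-- The element of `L²` representing the noise `noiseW i t`. -/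
noncomputable def noiseKernel (t : ℝ) (i : Fin d) : L2path d :=
  toL2path ((Icc 0 t).indicator fun _ => EuclideanSpace.single i 1)

/-- `drift_hiding` for the mixtures of the observed paths. -/
lemma map_mixPath_altSignal_le (V₁ V₂ : L2path d →ₗ[ℝ] L2path d) (m : unitInterval → Fin d → ℝ)
    (A Q : L2path d) {κ k ε q₀ σ₁ σ₂ : ℝ} (hκ : 0 < κ) (hk : 0 < k) (hε : 0 < ε) (hq : 0 < q₀)
    (hσ₁ : 0 < σ₁) (hσ₂ : 0 < σ₂)
    (hV₁ : ∀ (N : ℕ) (e : Fin N → L2path d), Orthonormal ℝ e → ∑ i, ‖V₁ (e i)‖ ^ 2 ≤ σ₁ ^ 2)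
    (hV₂ : ∀ (N : ℕ) (e : Fin N → L2path d), Orthonormal ℝ e → ∑ i, ‖V₂ (e i)‖ ^ 2 ≤ σ₂ ^ 2)
    (hA : A ≠ 0) (hQ : ‖Q‖ ≤ q₀ * ‖A‖)
    (ha : ∀ u i, a u i = V₁ (noiseKernel u i) + m u i • A)
    (hd : ∀ u i, q u i = V₂ (noiseKernel u i) + m u i • Q)
    (ν : Measure (EuclideanSpace ℝ (Fin d))) [IsProbabilityMeasure ν] {B : Set (Path d)}
    (hB : MeasurableSet B) :
    ((uniformLaw k).prod (sampleMeasure d d ν)).map (mixPath (altSignal b a q) κ) B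
      ≤ ((uniformLaw k).prod (sampleMeasure d d ν)).map (mixPath (nullSignal b a) κ) B
        + ENNReal.ofReal (hidingCost κ k ε q₀ σ₁ σ₂) := by
  have := isProbabilityMeasure_uniformLaw hk
  have := Measure.isProbabilityMeasure_map (μ := (uniformLaw k).prod (sampleMeasure d d ν))
    (measurable_mixPath (κ := κ) (g := altSignal b a q) measurable_altSignal).aemeasurable
  have := Measure.isProbabilityMeasure_map (μ := (uniformLaw k).prod (sampleMeasure d d ν))
    (measurable_mixPath (κ := κ) (g := nullSignal b a) measurable_nullSignal).aemeasurable
  refine measure_le_add_of_forall_cylinder (fun I S hS => ?_) hB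
  rw [map_mixPath_cylinder hk measurable_altSignal ν (hS.cylinder I),
    map_mixPath_cylinder hk measurable_nullSignal ν (hS.cylinder I)]
  -- The set of the coordinates of paths at the times in `I` that lie in `S`.
  let Φ : (I × Fin d → ℝ) → I → EuclideanSpace ℝ (Fin d) := fun y u =>
    WithLp.toLp 2 fun i => y (u, i)
  have hΦ : Measurable Φ := measurable_pi_lambda _ fun u =>
    (WithLp.measurable_toLp 2 (Fin d → ℝ)).comp (measurable_pi_lambda _ fun i =>
      measurable_pi_apply _)
  have h := drift_hiding (ν := ν) (fun j : I × Fin d => noiseKernel (d := d) (j.1 : unitInterval)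
    j.2) V₁ V₂ (fun j => m j.1 j.2) A Q
    (b := fun ω x j => ((j.1 : unitInterval) : ℝ) * x j.2 + isonormal (L2path d) (b j.1 j.2) ω)
    (fun ω => measurable_pi_lambda _ fun j => by fun_prop) hκ hk hε hq hσ₁ hσ₂ hV₁ hV₂ hA hQ
    (a := fun j => a j.1 j.2) (d := fun j => q j.1 j.2) (fun j => ha _ _) (fun j => hd _ _)
    (hΦ hS)
  have e1 (ω : NoiseIndex (L2path d) → ℝ) (ζ : ℝ) : {p | mixPath (altSignal b a q) κ (ζ, ω, p)
      ∈ cylinder I S} = {p : (NoiseIndex (L2path d) → ℝ) × EuclideanSpace ℝ (Fin d) |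
        (fun j : I × Fin d => ((j.1 : unitInterval) : ℝ) * p.2 j.2
          + isonormal (L2path d) (b j.1 j.2) ω + ζ * isonormal (L2path d) (a j.1 j.2) ω
          + isonormal (L2path d) (q j.1 j.2) ω
          + κ * isonormal (L2path d) (noiseKernel (j.1 : unitInterval) j.2) p.1) ∈ Φ ⁻¹' S} := by
    ext p
    simp only [mem_ofPred_eq, mem_cylinder, mem_preimage]
    refine iff_of_eq (congrArg (· ∈ S) ?_)
    funext u
    simp only [Finset.restrict, mixPath, altSignal, nullSignal, Φ]
    congr 1
    funext i
    rw [noiseW, noiseKernel]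
    ring
  have e0 (ω : NoiseIndex (L2path d) → ℝ) (ζ : ℝ) : {p | mixPath (nullSignal b a) κ (ζ, ω, p)
      ∈ cylinder I S} = {p : (NoiseIndex (L2path d) → ℝ) × EuclideanSpace ℝ (Fin d) |
        (fun j : I × Fin d => ((j.1 : unitInterval) : ℝ) * p.2 j.2
          + isonormal (L2path d) (b j.1 j.2) ω + ζ * isonormal (L2path d) (a j.1 j.2) ω
          + κ * isonormal (L2path d) (noiseKernel (j.1 : unitInterval) j.2) p.1) ∈ Φ ⁻¹' S} := by
    ext p
    simp only [mem_ofPred_eq, mem_cylinder, mem_preimage]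
    refine iff_of_eq (congrArg (· ∈ S) ?_)
    funext u
    simp only [Finset.restrict, mixPath, nullSignal, Φ]
    congr 1
    funext i
    rw [noiseW, noiseKernel]
    ring
  simp only [e1, e0]
  exact h

end Mixture


/-! ### The drift operator of a signal supported on a short interval -/

section DriftOp

variable {d : ℕ}

lemma toL2path_congr {f g : ℝ → EuclideanSpace ℝ (Fin d)}
    (h : ∀ r ∈ Icc (0 : ℝ) 1, f r = g r) : toL2path f = toL2path g := by
  have hae : f =ᵐ[volume.restrict (Icc (0 : ℝ) 1)] g := by
    filter_upwards [ae_restrict_mem measurableSet_Icc] with r hr using h r hr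
  by_cases hf : MemLp f 2 (volume.restrict (Icc (0 : ℝ) 1))
  · have hg := (memLp_congr_ae hae).1 hf
    rw [toL2path, toL2path, dif_pos hf, dif_pos hg]
    exact MemLp.toLp_congr hf hg hae
  · rw [toL2path, toL2path, dif_neg hf, dif_neg fun hg => hf ((memLp_congr_ae hae).2 hg)]

lemma memLp_noiseKernel (u : ℝ) (i : Fin d) :
    MemLp ((Icc 0 u).indicator fun _ : ℝ => (EuclideanSpace.single i (1 : ℝ))) 2
      (volume.restrict (Icc (0 : ℝ) 1)) :=
  memLp_indicator_Icc (C := 1) measurable_const (fun _ _ => by simp) u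

lemma continuous_noiseKernel (i : Fin d) : Continuous fun u : ℝ => noiseKernel (d := d) u i :=
  continuous_toL2path_indicator (C := 1) measurable_const (fun _ _ => by simp)

lemma inner_noiseKernel {u r : ℝ} (hu : u ∈ Icc (0 : ℝ) 1) (hr : r ∈ Icc (0 : ℝ) 1)
    (i j : Fin d) :
    (inner ℝ (noiseKernel u i) (noiseKernel r j) : ℝ) = if i = j then min u r else 0 := by
  rw [noiseKernel, noiseKernel, inner_toL2path (memLp_noiseKernel u i) (memLp_noiseKernel r j)]
  have h (s : ℝ) : (inner ℝ ((Icc 0 u).indicator (fun _ : ℝ => EuclideanSpace.single i (1 : ℝ)) s)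
      ((Icc 0 r).indicator (fun _ : ℝ => EuclideanSpace.single j (1 : ℝ)) s) : ℝ)
      = (Icc 0 (min u r)).indicator (fun _ => if i = j then 1 else 0) s := by
    by_cases h1 : s ∈ Icc 0 u <;> by_cases h2 : s ∈ Icc 0 r
    · rw [indicator_of_mem h1, indicator_of_mem h2,
        indicator_of_mem (show s ∈ Icc 0 (min u r) from ⟨h1.1, le_min h1.2 h2.2⟩)]
      by_cases hij : i = j
      · simp [hij]
      · simp [hij, EuclideanSpace.inner_single_left]
    all_goals
      rw [indicator_of_notMem (s := Icc 0 (min u r)) (fun h => by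
        first
        | exact h1 ⟨h.1, h.2.trans (min_le_left _ _)⟩
        | exact h2 ⟨h.1, h.2.trans (min_le_right _ _)⟩)]
      simp [h1, h2]
  simp only [h]
  rw [setIntegral_indicator measurableSet_Icc, setIntegral_const,
    inter_eq_right.2 (Icc_subset_Icc_right (min_le_of_left_le hu.2)),
    Real.volume_real_Icc_of_le (le_min hu.1 hr.1)]
  simp

/-- The coefficient `⟨f, 1_{(r,T]} e_{i₁}⟩` of the drift operator. -/
noncomputable def driftCoeff (T : ℝ) (i₁ : Fin d) (f : L2path d) (r : ℝ) : ℝ :=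
  inner ℝ (noiseKernel T i₁ - noiseKernel r i₁) f

lemma continuous_driftCoeff (T : ℝ) (i₁ : Fin d) (f : L2path d) :
    Continuous (driftCoeff T i₁ f) :=
  (continuous_const.sub (continuous_noiseKernel i₁)).inner continuous_const

lemma norm_sq_noiseKernel_sub {T r : ℝ} (hT : T ∈ Icc (0 : ℝ) 1) (hr : r ∈ Icc (0 : ℝ) 1)
    (hrT : r ≤ T) (i₁ : Fin d) : ‖noiseKernel T i₁ - noiseKernel r i₁‖ ^ 2 = T - r := by
  rw [← real_inner_self_eq_norm_sq, inner_sub_left, inner_sub_right, inner_sub_right,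
    inner_noiseKernel hT hT, inner_noiseKernel hT hr, inner_noiseKernel hr hT,
    inner_noiseKernel hr hr]
  simp [hrT]

variable {w : ℝ → ℝ} {W : ℝ}

lemma memLp_smul_const (hw : Measurable w) (hW : ∀ r, |w r| ≤ W) (x : EuclideanSpace ℝ (Fin d)) :
    MemLp (fun r => w r • x) 2 (volume.restrict (Icc (0 : ℝ) 1)) :=
  memLp_of_bound (C := W * ‖x‖) (by fun_prop) fun r _ => by
    rw [norm_smul, Real.norm_eq_abs]; gcongr; exact hW r

lemma memLp_driftOp (hw : Measurable w) (hW : ∀ r, |w r| ≤ W) (x : EuclideanSpace ℝ (Fin d))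
    (T : ℝ) (i₁ : Fin d) (f : L2path d) :
    MemLp (fun r => (w r * driftCoeff T i₁ f r) • x) 2 (volume.restrict (Icc (0 : ℝ) 1)) := by
  obtain ⟨C, hC⟩ := (isCompact_Icc (a := (0 : ℝ)) (b := 1)).exists_bound_of_continuousOn
    (continuous_driftCoeff T i₁ f).continuousOn
  have h := (continuous_driftCoeff T i₁ f).measurable
  refine memLp_of_bound (C := W * C * ‖x‖) (by fun_prop) fun r hr => ?_
  have hW0 : 0 ≤ W := (abs_nonneg _).trans (hW r)
  rw [norm_smul, norm_mul, Real.norm_eq_abs (w r)]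
  gcongr
  exacts [hW r, hC r hr]

/-- The operator `f ↦ (r ↦ w(r) ⟨f, 1_{(r,T]} e_{i₁}⟩ x)`. It maps the element representing `W_u`
to the signal kernel `(u - r)^+ w(r) x` in coordinate `i₁`, up to a multiple of `w x`. -/
noncomputable def driftOp (hw : Measurable w) (hW : ∀ r, |w r| ≤ W) (x : EuclideanSpace ℝ (Fin d))
    (T : ℝ) (i₁ : Fin d) : L2path d →ₗ[ℝ] L2path d where
  toFun f := toL2path fun r => (w r * driftCoeff T i₁ f r) • x
  map_add' f g := by
    rw [← toL2path_add (memLp_driftOp hw hW x T i₁ f) (memLp_driftOp hw hW x T i₁ g)]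
    congr 1; funext r
    rw [driftCoeff, driftCoeff, driftCoeff, inner_add_right, mul_add, add_smul]
  map_smul' c f := by
    rw [RingHom.id_apply, ← toL2path_smul (memLp_driftOp hw hW x T i₁ f)]
    congr 1; funext r
    rw [driftCoeff, driftCoeff, real_inner_smul_right, smul_smul]; congr 1; ring

lemma driftOp_noiseKernel (hw : Measurable w) (hW : ∀ r, |w r| ≤ W)
    (x : EuclideanSpace ℝ (Fin d)) {T : ℝ} (hT : T ∈ Icc (0 : ℝ) 1) (hwT : ∀ r, T < r → w r = 0)
    (i₁ : Fin d) {u : ℝ} (hu : u ∈ Icc (0 : ℝ) 1) (i : Fin d) :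
    (if i = i₁ then pathKernel (fun r => w r • x) u else 0)
      = driftOp hw hW x T i₁ (noiseKernel u i)
        + (if i = i₁ then max (u - T) 0 else 0) • toL2path fun r => w r • x := by
  have h1 := memLp_smul_const hw hW x
  have h2 := memLp_driftOp hw hW x T i₁ (noiseKernel u i)
  have hsm (c : ℝ) : MemLp (fun r => c • w r • x) 2 (volume.restrict (Icc (0 : ℝ) 1)) :=
    h1.const_smul c
  rw [driftOp, LinearMap.coe_mk, AddHom.coe_mk, ← toL2path_smul h1,
    ← toL2path_add h2 (hsm _)]
  have h3 : (if i = i₁ then pathKernel (fun r => w r • x) u else 0)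
      = toL2path fun r => (if i = i₁ then max (u - r) 0 else 0) • (w r • x) := by
    split_ifs
    · rfl
    · simp only [zero_smul]
      have := toL2path_smul h1 0
      simpa using this.symm
  rw [h3]
  refine toL2path_congr fun r hr => ?_
  by_cases hrT : r ≤ T
  swap
  · simp [hwT r (not_le.1 hrT)]
  rw [driftCoeff, inner_sub_left, inner_noiseKernel hT hu, inner_noiseKernel hr hu, smul_smul,
    smul_smul, ← add_smul]
  congr 1
  by_cases hi : i = i₁
  · simp only [hi, if_true]
    rcases le_total u r with h | h
    · rw [max_eq_right (by linarith), max_eq_right (by linarith), min_eq_right (h.trans hrT),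
        min_eq_right h]; ring
    · rw [max_eq_left (by linarith : 0 ≤ u - r), min_eq_left h]
      rcases le_total u T with h' | h'
      · rw [max_eq_right (by linarith), min_eq_right h']; ring
      · rw [max_eq_left (by linarith), min_eq_left h']; ring
  · simp [hi, Ne.symm hi]

/-- The Hilbert–Schmidt norm of the drift operator is at most its weight times the length of the
interval, by Bessel's inequality at every time. -/
lemma sum_norm_sq_driftOp_le (hw : Measurable w) (hW : ∀ r, |w r| ≤ W)
    {x : EuclideanSpace ℝ (Fin d)} (hx : ‖x‖ = 1) {t T : ℝ} (htT : t ≤ T)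
    (hT : T ∈ Icc (0 : ℝ) 1) (hwt : ∀ r, r ∉ Icc t T → w r = 0) (i₁ : Fin d) (N : ℕ)
    (e : Fin N → L2path d) (he : Orthonormal ℝ e) :
    ∑ i, ‖driftOp hw hW x T i₁ (e i)‖ ^ 2 ≤ (W * (T - t)) ^ 2 := by
  have hmem (i : Fin N) := memLp_driftOp hw hW x T i₁ (e i)
  have h1 (i : Fin N) : ‖driftOp hw hW x T i₁ (e i)‖ ^ 2
      = ∫ r in Icc (0 : ℝ) 1, (w r * driftCoeff T i₁ (e i) r) ^ 2 := by
    rw [driftOp, LinearMap.coe_mk, AddHom.coe_mk, norm_sq_toL2path (hmem i)]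
    simp only [norm_smul, hx, mul_one, Real.norm_eq_abs, sq_abs]
  have hint (i : Fin N) : Integrable (fun r => (w r * driftCoeff T i₁ (e i) r) ^ 2)
      (volume.restrict (Icc (0 : ℝ) 1)) := by
    have := (hmem i).integrable_norm_pow (p := 2) two_ne_zero
    simpa only [norm_smul, hx, mul_one, Real.norm_eq_abs, sq_abs, Nat.cast_ofNat,
      ENNReal.toReal_ofNat] using this
  simp only [h1]
  rw [← integral_finsetSum _ fun i _ => hint i]
  have h2 : ∀ r ∈ Icc (0 : ℝ) 1, ∑ i, (w r * driftCoeff T i₁ (e i) r) ^ 2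
      ≤ (Icc t T).indicator (fun _ => W ^ 2 * (T - t)) r := by
    intro r hr
    by_cases hrt : r ∈ Icc t T
    swap
    · simp [hwt r hrt, hrt]
    rw [indicator_of_mem hrt]
    simp only [mul_pow, ← Finset.mul_sum]
    have hb := he.sum_inner_products_le (noiseKernel T i₁ - noiseKernel r i₁) (s := Finset.univ)
    rw [norm_sq_noiseKernel_sub hT hr hrt.2] at hb
    have hb' : ∑ i, driftCoeff T i₁ (e i) r ^ 2 ≤ T - t := by
      refine le_trans (le_of_eq ?_) (hb.trans (by linarith [hrt.1]))
      refine Finset.sum_congr rfl fun i _ => ?_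
      rw [driftCoeff, real_inner_comm, Real.norm_eq_abs, sq_abs]
    refine mul_le_mul ?_ hb' (Finset.sum_nonneg fun _ _ => sq_nonneg _) (sq_nonneg _)
    rw [← sq_abs]; exact pow_le_pow_left₀ (abs_nonneg _) (hW r) 2
  calc ∫ r in Icc (0 : ℝ) 1, ∑ i, (w r * driftCoeff T i₁ (e i) r) ^ 2
      ≤ ∫ r in Icc (0 : ℝ) 1, (Icc t T).indicator (fun _ => W ^ 2 * (T - t)) r :=
        setIntegral_mono_on (integrable_finsetSum _ fun i _ => hint i)
          ((integrable_const _).indicator measurableSet_Icc) measurableSet_Icc h2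
    _ ≤ (W * (T - t)) ^ 2 := by
        rw [setIntegral_indicator measurableSet_Icc, setIntegral_const, smul_eq_mul, mul_pow]
        have hv : volume.real (Icc (0 : ℝ) 1 ∩ Icc t T) ≤ T - t := by
          rw [← Real.volume_real_Icc_of_le htT]
          exact measureReal_mono inter_subset_right measure_Icc_lt_top.ne
        nlinarith [mul_le_mul_of_nonneg_right hv (by have := sub_nonneg.2 htT; positivity :
          0 ≤ W ^ 2 * (T - t))]

end DriftOp


/-! ### Lower bounds for ordered eigenvalues -/

/-- If the quadratic form of `A` is at least `μ ‖x‖²` on the span of the first `k` coordinate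
vectors, then `λ_k(A) ≥ μ`. Indeed this span meets the orthogonal complement of the first `k - 1`
eigenvectors, on which the form is at most `λ_k(A) ‖x‖²`. -/
lemma le_ordEig {d k : ℕ} (hk : 1 ≤ k) (hkd : k ≤ d) {A : Matrix (Fin d) (Fin d) ℝ}
    (hA : A.IsHermitian) {μ : ℝ}
    (h : ∀ x : Fin d → ℝ, (∀ i : Fin d, k ≤ i.val → x i = 0) →
      μ * ∑ i, x i ^ 2 ≤ dotProduct x (A.mulVec x)) : μ ≤ ordEig k A := by
  rw [ordEig, dif_pos ⟨hA, hk, hkd⟩]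
  have hcard : Fintype.card (Fin d) = d := Fintype.card_fin d
  set k₀ : Fin (Fintype.card (Fin d)) := ⟨k - 1, by rw [Fintype.card_fin]; omega⟩ with hk₀
  have hT : (Matrix.toEuclideanLin A).IsSymmetric := Matrix.isSymmetric_toEuclideanLin_iff.mpr hA
  set b := hT.eigenvectorBasis finrank_euclideanSpace with hb
  let f : EuclideanSpace ℝ (Fin d) →ₗ[ℝ] ({i : Fin (Fintype.card (Fin d)) // i ≠ k₀} → ℝ) :=
    LinearMap.pi fun i => if k ≤ i.val.val then
      (EuclideanSpace.proj (𝕜 := ℝ) (Fin.cast hcard i.val)).toLinearMap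
      else (innerSL ℝ (b i.val)).toLinearMap
  have hker : LinearMap.ker f ≠ ⊥ := by
    refine LinearMap.ker_ne_bot_of_finrank_lt ?_
    rw [Module.finrank_fintype_fun_eq_card, finrank_euclideanSpace, Fintype.card_subtype_compl,
      Fintype.card_subtype_eq]
    simp only [Fintype.card_fin]
    omega
  obtain ⟨x, hxk, hx0⟩ := (Submodule.ne_bot_iff _).1 hker
  have hx (i) : f x i = 0 := by rw [LinearMap.mem_ker.1 hxk]; rfl
  have h1 : ∀ i : Fin d, k ≤ i.val → x i = 0 := by
    intro i hi
    have := hx ⟨Fin.cast hcard.symm i, fun h => by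
      have := congrArg Fin.val h; simp [hk₀] at this; omega⟩
    simpa [f, hi] using this
  have h2 : ∀ i : Fin (Fintype.card (Fin d)), i.val < k - 1 → (inner ℝ (b i) x : ℝ) = 0 := by
    intro i hi
    have := hx ⟨i, fun h => by rw [h] at hi; simp [hk₀] at hi⟩
    simpa [f, show ¬ k ≤ i.val by omega] using this
  have h3 := h x h1
  have hn : ∑ i, x i ^ 2 = ‖x‖ ^ 2 := by
    rw [EuclideanSpace.norm_sq_eq]; simp
  have h4 : dotProduct x (A.mulVec x) = inner ℝ x (Matrix.toEuclideanLin A x) := by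
    rw [EuclideanSpace.inner_eq_star_dotProduct, dotProduct_comm]; rfl
  have h5 : (inner ℝ x (Matrix.toEuclideanLin A x) : ℝ)
      = ∑ i, hA.eigenvalues₀ i * (inner ℝ (b i) x : ℝ) ^ 2 := by
    rw [← b.sum_inner_mul_inner]
    refine Finset.sum_congr rfl fun i _ => ?_
    rw [← hT, hb, hT.apply_eigenvectorBasis, real_inner_comm]
    simp only [RCLike.ofReal_real_eq_id, id, real_inner_smul_left]
    rw [Matrix.IsHermitian.eigenvalues₀]; ring
  have h6 : (inner ℝ x (Matrix.toEuclideanLin A x) : ℝ) ≤ hA.eigenvalues₀ k₀ * ‖x‖ ^ 2 := by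
    rw [h5, ← b.sum_sq_norm_inner_right, Finset.mul_sum]
    refine Finset.sum_le_sum fun i _ => ?_
    rw [Real.norm_eq_abs, sq_abs]
    rcases lt_or_ge i.val (k - 1) with hi | hi
    · rw [h2 i hi]; simp
    · exact mul_le_mul_of_nonneg_right (hA.eigenvalues₀_antitone (show k₀ ≤ i from hi))
        (sq_nonneg _)
  rw [hn, h4] at h3
  exact le_of_mul_le_mul_right (h3.trans h6) (by positivity)

/-! ### Square roots of covariance matrices -/

section Sqrt

variable {d : ℕ}

open scoped Matrix.Norms.L2Operator in
lemma continuousOn_matrix_sqrt (d : ℕ) :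
    ContinuousOn (fun A : Matrix (Fin d) (Fin d) ℝ => CFC.sqrt A) {A | A.PosSemidef} := by
  have := CFC.continuousOn_sqrt (A := Matrix (Fin d) (Fin d) ℝ)
  simpa [Matrix.nonneg_iff_posSemidef] using this

lemma sqrt_mul_transpose_sqrt {A : Matrix (Fin d) (Fin d) ℝ} (hA : A.PosSemidef) :
    CFC.sqrt A * (CFC.sqrt A).transpose = A := by
  have h0 : 0 ≤ A := Matrix.nonneg_iff_posSemidef.2 hA
  have h1 : (CFC.sqrt A).PosSemidef := Matrix.nonneg_iff_posSemidef.1 (CFC.sqrt_nonneg A)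
  have h2 : (CFC.sqrt A).transpose = CFC.sqrt A := by
    have := h1.1
    rwa [Matrix.IsHermitian, Matrix.conjTranspose_eq_transpose_of_trivial] at this
  rw [h2, CFC.sqrt_mul_sqrt_self A h0]

lemma posSemidef_mul_transpose (σ : Matrix (Fin d) (Fin d) ℝ) :
    (σ * σ.transpose).PosSemidef := by
  rw [← Matrix.conjTranspose_eq_transpose_of_trivial]
  exact Matrix.posSemidef_self_mul_conjTranspose _

lemma norm_sq_row (σ : Matrix (Fin d) (Fin d) ℝ) (i : Fin d) :
    ‖WithLp.toLp 2 (σ i)‖ ^ 2 = (σ * σ.transpose) i i := by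
  rw [EuclideanSpace.norm_sq_eq, Matrix.mul_apply]
  simp [sq]

lemma BoundedRows.sqrt {σ : ℝ → Matrix (Fin d) (Fin d) ℝ} (hσ : BoundedRows σ) :
    BoundedRows fun s => CFC.sqrt (σ s * (σ s).transpose) := by
  obtain ⟨h1, C, h2⟩ := hσ
  have hpos (s : ℝ) := posSemidef_mul_transpose (σ s)
  refine ⟨fun i => ?_, C, fun i s hs => ?_⟩
  · have hent (i j : Fin d) : Measurable fun s => σ s i j :=
      (EuclideanSpace.proj (𝕜 := ℝ) j).continuous.measurable.comp (h1 i)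
    let _ : MeasurableSpace (Matrix (Fin d) (Fin d) ℝ) :=
      inferInstanceAs (MeasurableSpace (Fin d → Fin d → ℝ))
    have : BorelSpace (Matrix (Fin d) (Fin d) ℝ) :=
      inferInstanceAs (BorelSpace (Fin d → Fin d → ℝ))
    have hS : Measurable fun s => σ s * (σ s).transpose := by
      refine measurable_pi_lambda _ fun i => measurable_pi_lambda _ fun j => ?_
      simp only [Matrix.mul_apply, Matrix.transpose_apply]
      exact Finset.measurable_sum _ fun l _ => (hent i l).mul (hent j l)
    have hc : Continuous fun A : {A : Matrix (Fin d) (Fin d) ℝ | A.PosSemidef} =>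
        (WithLp.toLp 2 ((CFC.sqrt A.val) i) : EuclideanSpace ℝ (Fin d)) := by
      have := (continuousOn_iff_continuous_domRestrict.1 (continuousOn_matrix_sqrt d))
      exact (PiLp.continuous_toLp 2 _).comp ((continuous_apply i).comp this)
    exact hc.measurable.comp (hS.subtype_mk (h := hpos))
  · refine le_trans (le_of_sq_le_sq ?_ (norm_nonneg _)) (h2 i s hs)
    rw [norm_sq_row, norm_sq_row, sqrt_mul_transpose_sqrt (hpos s)]

/-- `spotLaw` may be computed with any bounded measurable factor of the spot covariance. -/
lemma spotLaw_eq_obsLaw {σ : ℝ → Matrix (Fin d) (Fin d) ℝ} (hσ : BoundedRows σ) (η : ℝ)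
    (ν : Measure (EuclideanSpace ℝ (Fin d))) [IsProbabilityMeasure ν] (n : ℕ) :
    spotLaw (fun s => σ s * (σ s).transpose) η ν n = obsLaw σ η ν n := by
  exact obsLaw_eq_of_mul_transpose_eq hσ.sqrt hσ
    (fun s => sqrt_mul_transpose_sqrt (posSemidef_mul_transpose _)) η ν n

end Sqrt


/-! ### The volatility matrices of the two hypotheses -/

section VolMatrix

variable {d r : ℕ}

/-- The volatility matrix with rows `√M e_i` for `i < r`, row `θ √M e_0 + q e_r` for `i = r`, and
zero rows below. For `q = 0` it has rank at most `r`; a small `q` makes the rank `r + 1`. -/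
noncomputable def volMatrix (hrd : r < d) (M θ q : ℝ) : Matrix (Fin d) (Fin d) ℝ := fun i =>
  if i.val < r then Pi.single i √M
  else if i.val = r then Pi.single ⟨0, by omega⟩ (θ * √M) + Pi.single ⟨r, hrd⟩ q
  else 0

variable (hrd : r < d) {M : ℝ} (θ q : ℝ)

lemma transpose_volMatrix_mulVec (hr : 1 ≤ r) (x : Fin d → ℝ) (j : Fin d) :
    ((volMatrix hrd M θ q).transpose.mulVec x) j =
      if j.val < r then √M * (x j + if j.val = 0 then θ * x ⟨r, hrd⟩ else 0)
      else if j.val = r then q * x ⟨r, hrd⟩ else 0 := by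
  have h (i : Fin d) : volMatrix hrd M θ q i j * x i
      = (if i = j then (if j.val < r then √M * x j else 0) else 0)
        + if i = ⟨r, hrd⟩ then ((if j.val = 0 then √M * (θ * x ⟨r, hrd⟩) else 0)
          + if j.val = r then q * x ⟨r, hrd⟩ else 0) else 0 := by
    rw [volMatrix]
    by_cases h1 : i.val < r
    · have hi : i ≠ ⟨r, hrd⟩ := fun h => by simp [h] at h1
      by_cases h2 : i = j
      · subst h2; simp [h1, hi]
      · simp [h1, hi, h2, Ne.symm h2]
    · by_cases h2 : i.val = r
      · obtain rfl : i = ⟨r, hrd⟩ := Fin.ext h2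
        have h3 : (⟨r, hrd⟩ : Fin d) = j → ¬ j.val < r := by rintro rfl; simp
        simp only [lt_self_iff_false, if_false, if_true, Pi.add_apply, Pi.single_apply, Fin.ext_iff]
        split_ifs <;> first | omega | ring1
      · have hi : i ≠ ⟨r, hrd⟩ := fun h => h2 (by simp [h])
        have h3 : i = j → ¬ j.val < r := by rintro rfl; exact h1
        simp only [h1, h2, hi, if_false, Pi.zero_apply, zero_mul, add_zero]
        split_ifs with h4 h5
        · exact absurd h5 (h3 h4)
        all_goals rfl
  simp only [Matrix.mulVec, dotProduct, Matrix.transpose_apply, h]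
  rw [Finset.sum_add_distrib, Finset.sum_ite_eq' Finset.univ j, Finset.sum_ite_eq']
  simp only [Finset.mem_univ, if_true]
  split_ifs <;> first | omega | ring1

lemma dotProduct_mul_transpose_mulVec (σ : Matrix (Fin d) (Fin d) ℝ) (x : Fin d → ℝ) :
    dotProduct x ((σ * σ.transpose).mulVec x) = ∑ j, (σ.transpose.mulVec x j) ^ 2 := by
  rw [← Matrix.mulVec_mulVec, Matrix.dotProduct_mulVec, ← Matrix.mulVec_transpose, dotProduct]
  simp [sq]

lemma le_ordEig_volMatrix_null (hr : 1 ≤ r) (hM : 0 ≤ M) :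
    M ≤ ordEig r (volMatrix hrd M θ q * (volMatrix hrd M θ q).transpose) := by
  refine le_ordEig hr hrd.le (posSemidef_mul_transpose _).1 fun x hx => ?_
  have hxr : x ⟨r, hrd⟩ = 0 := hx _ le_rfl
  rw [dotProduct_mul_transpose_mulVec, Finset.mul_sum]
  refine Finset.sum_le_sum fun j _ => ?_
  rw [transpose_volMatrix_mulVec hrd θ q hr, hxr]
  by_cases hj : j.val < r
  · simp [hj, mul_pow, Real.sq_sqrt hM]
  · rw [hx j (not_lt.1 hj)]; simp [hj]

/-- The quadratic form controls `x_0` through `x_0² ≤ 2 (x_0 + θ x_r)² + 2 x_r²`. -/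
lemma le_ordEig_volMatrix_alt (hr : 1 ≤ r) {μ : ℝ} (hμ : 0 ≤ μ) (hM : 2 * μ ≤ M)
    (hθ : |θ| ≤ 1) (hq : q ^ 2 = 3 * μ) :
    μ ≤ ordEig (r + 1) (volMatrix hrd M θ q * (volMatrix hrd M θ q).transpose) := by
  have hM0 : 0 ≤ M := by linarith
  refine le_ordEig (by omega) hrd (posSemidef_mul_transpose _).1 fun x hx => ?_
  rw [dotProduct_mul_transpose_mulVec, Finset.mul_sum]
  set y := x ⟨r, hrd⟩ with hy
  have hθ2 : (θ * y) ^ 2 ≤ y ^ 2 := by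
    rw [mul_pow]
    have : θ ^ 2 ≤ 1 := by rw [← sq_abs]; exact pow_le_one₀ (abs_nonneg _) hθ
    nlinarith [sq_nonneg y]
  have h0 : ∑ j : Fin d, ((if j = ⟨0, by omega⟩ then 2 * μ * y ^ 2 else 0)
      - if j = ⟨r, hrd⟩ then 2 * μ * y ^ 2 else 0) = 0 := by
    rw [Finset.sum_sub_distrib]; simp
  rw [← add_zero (∑ j, (Matrix.mulVec _ x j) ^ 2), ← h0, ← Finset.sum_add_distrib]
  refine Finset.sum_le_sum fun j _ => ?_
  rw [transpose_volMatrix_mulVec hrd θ q hr, ← hy]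
  simp only [Fin.ext_iff]
  by_cases h1 : j.val = 0
  · have h2 : ¬ j.val = r := by omega
    have h3 : j.val < r := by omega
    simp only [h1, if_true]
    rw [if_pos (by omega), if_neg (by omega), mul_pow, Real.sq_sqrt hM0]
    have h4 : x j ^ 2 ≤ 2 * (x j + θ * y) ^ 2 + 2 * y ^ 2 := by
      nlinarith [sq_nonneg (x j + 2 * (θ * y))]
    have := mul_le_mul_of_nonneg_left h4 hμ
    nlinarith [mul_le_mul_of_nonneg_right hM (sq_nonneg (x j + θ * y))]
  · by_cases h2 : j.val = r
    · obtain rfl : j = ⟨r, hrd⟩ := Fin.ext h2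
      rw [← hy]
      simp only [lt_irrefl, if_true, if_false, mul_pow, hq]
      rw [if_neg (by omega)]; nlinarith
    · by_cases h3 : j.val < r
      · simp only [h1, h2, h3, if_true, if_false, mul_pow, Real.sq_sqrt hM0, sub_zero, add_zero]
        exact mul_le_mul_of_nonneg_right (by linarith) (sq_nonneg _)
      · rw [hx j (by omega)]; simp [h1, h2, h3]

lemma rank_volMatrix_le (hr : 1 ≤ r) :
    (volMatrix hrd M θ 0 * (volMatrix hrd M θ 0).transpose).rank ≤ r := by
  refine (Matrix.rank_mul_le_left _ _).trans ?_
  have h : volMatrix hrd M θ 0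
      = volMatrix hrd M θ 0 * Matrix.diagonal
          fun j : Fin d => if j.val < r then (1 : ℝ) else 0 := by
    ext i j
    rw [Matrix.mul_diagonal]
    by_cases hj : j.val < r
    · simp [hj]
    · rw [if_neg hj, mul_zero, volMatrix]
      split_ifs with h1 h2
      · have : j ≠ i := fun h => hj (h ▸ h1)
        simp [this]
      · have : j.val ≠ 0 := by omega
        simp [Fin.ext_iff, this]
      · rfl
  rw [h]
  refine (Matrix.rank_mul_le_right _ _).trans ?_
  rw [Matrix.rank_diagonal]
  have : Fintype.card {j : Fin d // (if j.val < r then (1 : ℝ) else 0) ≠ 0}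
      ≤ Fintype.card (Fin r) :=
    Fintype.card_le_of_injective (fun j => ⟨j.val.val, by
      have := j.2; by_contra h; simp [h] at this⟩) fun a b hab => by
        simpa [Subtype.ext_iff, Fin.ext_iff] using hab
  simpa using this

lemma volMatrix_mul_transpose_sub (hr : 1 ≤ r) (hM : 0 ≤ M) (θ' : ℝ) :
    volMatrix hrd M θ 0 * (volMatrix hrd M θ 0).transpose
      - volMatrix hrd M θ' 0 * (volMatrix hrd M θ' 0).transpose
    = Matrix.single ⟨0, by omega⟩ ⟨r, hrd⟩ (M * (θ - θ'))
      + Matrix.single ⟨r, hrd⟩ ⟨0, by omega⟩ (M * (θ - θ'))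
      + Matrix.single ⟨r, hrd⟩ ⟨r, hrd⟩ (M * (θ ^ 2 - θ' ^ 2)) := by
  have hM' := Real.mul_self_sqrt hM
  ext i j
  have h (θ : ℝ) (i j : Fin d) : (volMatrix hrd M θ 0 * (volMatrix hrd M θ 0).transpose) i j
      = dotProduct (volMatrix hrd M θ 0 i) (volMatrix hrd M θ 0 j) := rfl
  have hlt (θ : ℝ) {i : Fin d} (hi : i.val < r) : volMatrix hrd M θ 0 i = Pi.single i √M := by
    rw [volMatrix, if_pos hi]
  have heq (θ : ℝ) {i : Fin d} (hi : i.val = r) :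
      volMatrix hrd M θ 0 i = Pi.single ⟨0, by omega⟩ (θ * √M) := by
    rw [volMatrix, if_neg (by omega), if_pos hi, Pi.single_zero, add_zero]
  have hgt (θ : ℝ) {i : Fin d} (hi : r < i.val) : volMatrix hrd M θ 0 i = 0 := by
    rw [volMatrix, if_neg (by omega), if_neg (by omega)]
  rw [Matrix.sub_apply, h, h]
  simp only [Matrix.add_apply, Matrix.single_apply, Fin.ext_iff]
  rcases lt_trichotomy i.val r with hi | hi | hi <;> rcases lt_trichotomy j.val r with hj | hj | hj
  · rw [hlt _ hi, hlt _ hj, hlt _ hi, hlt _ hj, sub_self]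
    simp [hi.ne', hj.ne']
  · rw [hlt _ hi, heq _ hj, hlt _ hi, heq _ hj]
    simp only [single_dotProduct, Pi.single_apply, Fin.ext_iff]
    split_ifs <;> first | omega | linear_combination (θ - θ') * hM' | simp
  · rw [hgt _ hj, hgt _ hj, dotProduct_zero, dotProduct_zero]
    rw [if_neg (by omega), if_neg (by omega), if_neg (by omega)]
    simp
  · rw [hlt _ hj, heq _ hi, hlt _ hj, heq _ hi]
    simp only [single_dotProduct, Pi.single_apply, Fin.ext_iff]
    split_ifs <;> first | omega | linear_combination (θ - θ') * hM' | simp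
  · rw [heq _ hi, heq _ hj, heq _ hi, heq _ hj]
    simp only [single_dotProduct, Pi.single_eq_same]
    rw [if_neg (by omega), if_neg (by omega), if_pos ⟨hi.symm, hj.symm⟩]
    linear_combination (θ ^ 2 - θ' ^ 2) * hM'
  · rw [hgt _ hj, hgt _ hj, dotProduct_zero, dotProduct_zero]
    rw [if_neg (by omega), if_neg (by omega), if_neg (by omega)]
    simp
  all_goals
    rw [hgt _ hi, hgt _ hi, zero_dotProduct, zero_dotProduct]
    rw [if_neg (by omega), if_neg (by omega), if_neg (by omega)]
    simp

lemma norm_toEuclideanCLM_single_le (i j : Fin d) (c : ℝ) :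
    ‖Matrix.toEuclideanCLM (𝕜 := ℝ) (Matrix.single i j c)‖ ≤ |c| := by
  refine ContinuousLinearMap.opNorm_le_bound _ (abs_nonneg c) fun x => ?_
  have : Matrix.toEuclideanCLM (𝕜 := ℝ) (Matrix.single i j c) x
      = EuclideanSpace.single i (c * x j) := by
    ext k
    rw [Matrix.ofLp_toEuclideanCLM]
    by_cases hk : k = i
    · subst hk; simp [Matrix.mulVec, dotProduct, Matrix.single_apply]
    · simp [Matrix.mulVec, dotProduct, hk, Ne.symm hk]
  rw [this, PiLp.norm_single, norm_mul, Real.norm_eq_abs]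
  gcongr
  exact PiLp.norm_apply_le x j

lemma norm_volMatrix_sub_le (hr : 1 ≤ r) (hM : 0 ≤ M) {θ θ' : ℝ} (h : |θ + θ'| ≤ 1) :
    ‖Matrix.toEuclideanCLM (𝕜 := ℝ) (volMatrix hrd M θ 0 * (volMatrix hrd M θ 0).transpose
      - volMatrix hrd M θ' 0 * (volMatrix hrd M θ' 0).transpose)‖ ≤ 3 * M * |θ - θ'| := by
  rw [volMatrix_mul_transpose_sub hrd θ hr hM, map_add, map_add]
  refine (norm_add₃_le).trans ?_
  have h1 : |M * (θ ^ 2 - θ' ^ 2)| ≤ |M * (θ - θ')| := by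
    rw [show M * (θ ^ 2 - θ' ^ 2) = M * (θ - θ') * (θ + θ') by ring, abs_mul _ (θ + θ')]
    exact mul_le_of_le_one_right (abs_nonneg _) h
  have h2 : |M * (θ - θ')| = M * |θ - θ'| := by rw [abs_mul, abs_of_nonneg hM]
  have := norm_toEuclideanCLM_single_le (d := d) ⟨0, by omega⟩ ⟨r, hrd⟩ (M * (θ - θ'))
  have := norm_toEuclideanCLM_single_le (d := d) ⟨r, hrd⟩ ⟨0, by omega⟩ (M * (θ - θ'))
  have := norm_toEuclideanCLM_single_le (d := d) ⟨r, hrd⟩ ⟨r, hrd⟩ (M * (θ ^ 2 - θ' ^ 2))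
  linarith

end VolMatrix


/-! ### The bump function -/

section Bump

/-- The triangular bump of height `1` supported on `[t, T]`. -/
noncomputable def bump (t T s : ℝ) : ℝ := max 0 (1 - |s - (t + T) / 2| * (2 / (T - t)))

variable {t T : ℝ}

lemma continuous_bump : Continuous (bump t T) := by unfold bump; fun_prop

lemma bump_nonneg (s : ℝ) : 0 ≤ bump t T s := le_max_left _ _

lemma bump_le_one (htT : t < T) (s : ℝ) : bump t T s ≤ 1 := by
  have := sub_pos.2 htT
  refine max_le zero_le_one (sub_le_self _ (by positivity))

lemma bump_eq_zero (htT : t < T) {s : ℝ} (hs : s ∉ Icc t T) : bump t T s = 0 := by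
  have h := sub_pos.2 htT
  refine max_eq_left ?_
  rw [sub_nonpos, mul_div_assoc', le_div_iff₀ h]
  have : t ≤ s → T < s := fun h1 => not_le.1 fun h2 => hs ⟨h1, h2⟩
  rcases lt_or_ge s t with h1 | h1
  · rw [abs_of_neg (by linarith)]; linarith
  · have := this h1
    rw [abs_of_pos (by linarith)]; linarith

/-- The bump is Hölder continuous of every order `β ≤ 1`, after rescaling its support. -/
lemma abs_bump_sub_le (htT : t < T) {β : ℝ} (hβ : β ∈ Ioc (0 : ℝ) 1) (s u : ℝ) :
    |bump t T s - bump t T u| ≤ 2 * (|s - u| / (T - t)) ^ β := by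
  have h := sub_pos.2 htT
  have hx : 0 ≤ |s - u| / (T - t) := by positivity
  rcases le_total 1 (|s - u| / (T - t)) with h1 | h1
  · have h2 : |bump t T s - bump t T u| ≤ 1 :=
      abs_sub_le_of_nonneg_of_le (bump_nonneg s) (bump_le_one htT s) (bump_nonneg u)
        (bump_le_one htT u)
    linarith [Real.one_le_rpow h1 hβ.1.le]
  · have h2 : |bump t T s - bump t T u| ≤ 2 * (|s - u| / (T - t)) := by
      refine (abs_max_sub_max_le_max _ _ _ _).trans ?_
      rw [sub_self, abs_zero, max_eq_right (abs_nonneg _), sub_sub_sub_cancel_left, ← sub_mul,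
        abs_mul, abs_of_pos (show 0 < 2 / (T - t) by positivity)]
      have h3 : |(|u - (t + T) / 2| - |s - (t + T) / 2|)| ≤ |s - u| := by
        refine (abs_abs_sub_abs_le_abs_sub _ _).trans ?_
        rw [sub_sub_sub_cancel_right, abs_sub_comm]
      calc _ ≤ |s - u| * (2 / (T - t)) := by gcongr
        _ = _ := by ring
    have h3 : |s - u| / (T - t) ≤ (|s - u| / (T - t)) ^ β := by
      simpa using Real.rpow_le_rpow_of_exponent_ge_of_imp hx h1 hβ.2 (by intro _ h; linarith)
    linarith

lemma le_integral_bump_sq (ht : 0 ≤ t) (htT : t < T) (hT : T ≤ 1) :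
    (T - t) / 8 ≤ ∫ s in Icc (0 : ℝ) 1, bump t T s ^ 2 := by
  have h := sub_pos.2 htT
  set m := (t + T) / 2 with hm
  have hsub : Icc (m - (T - t) / 4) (m + (T - t) / 4) ⊆ Icc (0 : ℝ) 1 :=
    Icc_subset_Icc (by linarith) (by linarith)
  have hint : IntegrableOn (fun s => bump t T s ^ 2) (Icc 0 1) :=
    (continuous_bump.pow 2).continuousOn.integrableOn_compact isCompact_Icc
  calc (T - t) / 8 = ∫ _ in Icc (m - (T - t) / 4) (m + (T - t) / 4), (1 / 4 : ℝ) := by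
        rw [setIntegral_const, Real.volume_real_Icc_of_le (by linarith), smul_eq_mul]; ring
    _ ≤ ∫ s in Icc (m - (T - t) / 4) (m + (T - t) / 4), bump t T s ^ 2 := by
        refine setIntegral_mono_on (integrable_const _) (hint.mono_set hsub) measurableSet_Icc
          fun s hs => ?_
        have h1 : 1 / 2 ≤ bump t T s := by
          refine le_max_of_le_right ?_
          have h2 : |s - m| ≤ (T - t) / 4 := abs_le.2 ⟨by linarith [hs.1], by linarith [hs.2]⟩
          have h3 : |s - m| * (2 / (T - t)) ≤ (T - t) / 4 * (2 / (T - t)) := by gcongr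
          have h4 : (T - t) / 4 * (2 / (T - t)) = 1 / 2 := by field_simp; norm_num
          linarith
        nlinarith
    _ ≤ _ := setIntegral_mono_set hint (ae_of_all _ fun s => sq_nonneg _) hsub.eventuallyLE

end Bump


/-! ### The two families of volatilities and their observation laws -/

section Families

variable {d r : ℕ}

/-- The kernel of the part of the signal common to both hypotheses. -/
noncomputable def baseKernel (r : ℕ) (M : ℝ) (u : unitInterval) (i : Fin d) : L2path d :=
  if i.val < r then pathKernel (fun _ => EuclideanSpace.single i √M) u else 0

/-- The kernel of a signal with weight `w` that is driven by the Brownian coordinate `j` and acts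
on the coordinate `i₁` of the observation. -/
noncomputable def coordKernel (i₁ j : Fin d) (w : ℝ → ℝ) (u : unitInterval) (i : Fin d) :
    L2path d :=
  if i = i₁ then pathKernel (fun s => w s • EuclideanSpace.single j 1) u else 0

lemma toLp_volMatrix (hrd : r < d) (M θ q : ℝ) (i : Fin d) :
    (WithLp.toLp 2 (volMatrix hrd M θ q i) : EuclideanSpace ℝ (Fin d))
      = if i.val < r then EuclideanSpace.single i √M
        else if i = ⟨r, hrd⟩ then (θ * √M) • EuclideanSpace.single ⟨0, by omega⟩ 1
          + q • EuclideanSpace.single ⟨r, hrd⟩ 1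
        else 0 := by
  ext j
  rw [volMatrix]
  simp only [Fin.ext_iff]
  split_ifs <;> simp [Pi.single_apply]

variable (hrd : r < d) {M a : ℝ} {g qf : ℝ → ℝ}

lemma boundedRows_volMatrix (ha : 0 ≤ a) (hg : Measurable g) (hg1 : ∀ s, |g s| ≤ 1)
    (hq : Measurable qf) {q₁ : ℝ} (hq1 : ∀ s, |qf s| ≤ q₁) (ζ : ℝ) :
    BoundedRows fun s => volMatrix hrd M (ζ * (a * g s)) (qf s) := by
  have hq0 : 0 ≤ q₁ := (abs_nonneg _).trans (hq1 0)
  refine ⟨fun i => ?_, √M + |ζ| * a * √M + q₁, fun i s _ => ?_⟩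
  · simp only [toLp_volMatrix]
    split_ifs <;> fun_prop
  · rw [toLp_volMatrix]
    have h1 : 0 ≤ √M := Real.sqrt_nonneg M
    have h2 : 0 ≤ |ζ| * a * √M := by positivity
    split_ifs
    · rw [PiLp.norm_single, Real.norm_eq_abs, abs_of_nonneg h1]; linarith
    · refine (norm_add_le _ _).trans ?_
      rw [norm_smul, norm_smul, PiLp.norm_single, PiLp.norm_single, norm_one, mul_one, mul_one,
        Real.norm_eq_abs, Real.norm_eq_abs, abs_mul, abs_mul, abs_mul, abs_of_nonneg h1,
        abs_of_nonneg ha]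
      have h3 : |ζ| * (a * |g s|) * √M ≤ |ζ| * a * √M := by
        rw [← mul_assoc]
        exact mul_le_mul_of_nonneg_right (mul_le_of_le_one_right (by positivity) (hg1 s)) h1
      linarith [hq1 s]
    · rw [norm_zero]; linarith

lemma pathKernel_volMatrix (ha : 0 ≤ a) (hg : Measurable g) (hg1 : ∀ s, |g s| ≤ 1)
    (hq : Measurable qf) {q₁ : ℝ} (hq1 : ∀ s, |qf s| ≤ q₁) (ζ : ℝ) (u : unitInterval)
    (i : Fin d) :
    pathKernel (fun s => WithLp.toLp 2 (volMatrix hrd M (ζ * (a * g s)) (qf s) i)) u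
      = baseKernel r M u i + ζ • coordKernel ⟨r, hrd⟩ ⟨0, by omega⟩ (fun s => a * √M * g s) u i
        + coordKernel ⟨r, hrd⟩ ⟨r, hrd⟩ qf u i := by
  have hw1 (s : ℝ) : |a * √M * g s| ≤ a * √M := by
    rw [abs_mul, abs_of_nonneg (by positivity)]
    exact mul_le_of_le_one_right (by positivity) (hg1 s)
  have hwm : Measurable fun s => a * √M * g s := hg.const_mul _
  have hm (w : ℝ → ℝ) (W : ℝ) (hw : Measurable w) (hW : ∀ s, |w s| ≤ W) (j : Fin d) :
      MemLp (fun s => max ((u : ℝ) - s) 0 • w s • (EuclideanSpace.single j (1 : ℝ))) 2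
        (volume.restrict (Icc (0 : ℝ) 1)) :=
    memLp_pathKernel (C := W) (ρ := fun s => w s • EuclideanSpace.single j (1 : ℝ))
      (hw.smul measurable_const) (fun s _ => by
      rw [norm_smul, PiLp.norm_single, norm_one, mul_one]; exact hW s) u
  simp only [toLp_volMatrix, baseKernel, coordKernel]
  by_cases h1 : i.val < r
  · have h2 : i ≠ ⟨r, hrd⟩ := fun h => by simp [h] at h1
    simp [h1, h2]
  · by_cases h2 : i = ⟨r, hrd⟩
    · simp only [h2, lt_irrefl, if_true, if_false, zero_add]
      have e1 := hm _ _ hwm hw1 ⟨0, by omega⟩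
      have e2 := hm qf q₁ hq hq1 ⟨r, hrd⟩
      rw [pathKernel, pathKernel, pathKernel, ← toL2path_smul e1, ← toL2path_add _ e2]
      · congr 1
        funext s
        rw [smul_add, smul_smul, smul_smul, smul_smul, smul_smul]
        congr 2
        ring
      · exact e1.const_smul ζ
    · simp only [h1, h2, if_false, smul_zero, add_zero]
      rw [pathKernel]
      simp only [smul_zero]
      have := toL2path_smul (hm qf q₁ hq hq1 i) 0
      simpa using this

lemma spotLaw_volMatrix (ha : 0 ≤ a) (hg : Measurable g) (hg1 : ∀ s, |g s| ≤ 1)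
    (hq : Measurable qf) {q₁ : ℝ} (hq1 : ∀ s, |qf s| ≤ q₁) (ζ η : ℝ)
    (ν : Measure (EuclideanSpace ℝ (Fin d))) [IsProbabilityMeasure ν] (n : ℕ) :
    spotLaw (fun s => volMatrix hrd M (ζ * (a * g s)) (qf s)
        * (volMatrix hrd M (ζ * (a * g s)) (qf s)).transpose) η ν n
      = (sampleMeasure d d ν).map fun ω => mixPath (altSignal (baseKernel r M)
          (coordKernel ⟨r, hrd⟩ ⟨0, by omega⟩ fun s => a * √M * g s)
          (coordKernel ⟨r, hrd⟩ ⟨r, hrd⟩ qf)) (η * (n : ℝ) ^ (-(1 / 2) : ℝ)) (ζ, ω) := by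
  have hb := boundedRows_volMatrix (M := M) hrd ha hg hg1 hq hq1 ζ
  rw [spotLaw_eq_obsLaw hb, obsLaw_eq_map_signalPath hb,
    map_mixPath_eq_map_signalPath measurable_altSignal fun u i => altSignal_ae ζ u i]
  simp only [pathKernel_volMatrix hrd ha hg hg1 hq hq1]

lemma altSignal_coordKernel_zero (b a : unitInterval → Fin d → L2path d) (i₁ j : Fin d) (ζ : ℝ)
    (ν : Measure (EuclideanSpace ℝ (Fin d))) [IsProbabilityMeasure ν] (κ : ℝ) :
    (sampleMeasure d d ν).map
        (fun ω => mixPath (altSignal b a (coordKernel i₁ j fun _ => 0)) κ (ζ, ω))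
      = (sampleMeasure d d ν).map (fun ω => mixPath (nullSignal b a) κ (ζ, ω)) := by
  have h0 (u : unitInterval) (i : Fin d) : coordKernel i₁ j (fun _ => 0) u i = 0 := by
    rw [coordKernel]
    split_ifs
    · have hm : MemLp (fun _ : ℝ => (0 : EuclideanSpace ℝ (Fin d))) 2
        (volume.restrict (Icc (0 : ℝ) 1)) := MemLp.zero'
      simpa [pathKernel] using toL2path_smul hm 0
    · rfl
  rw [map_mixPath_eq_map_signalPath measurable_altSignal fun u i => altSignal_ae ζ u i,
    map_mixPath_eq_map_signalPath measurable_nullSignal fun u i => nullSignal_ae ζ u i]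
  simp only [h0, add_zero]

/-- Indistinguishability at a fixed sample size. The hypotheses say that the bump fits the Hölder
constraint (`hL`), that the extra eigenvalue `μ` is either dominated by the bump or located at the
end of the observation interval (`hμ`), and that the signals are below the noise level
(`hs₁`, `hs₂`). -/
lemma one_le_firstKind_add_secondKind_volMatrix (hrd : r < d) (hr : 1 ≤ r)
    {t T β L lam μ h y ε s₁ s₂ η : ℝ}
    (ht : 0 ≤ t) (htT : t < T) (hT : T ≤ 1) (hβ : β ∈ Ioc (0 : ℝ) 1) (hM : 0 < M)
    (hlam : lam ≤ M) (ha : 0 < a) (ha1 : a ≤ 1) (hL : M * a ≤ L * (T - t) ^ β) (hμ0 : 0 ≤ μ)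
    (hμM : 2 * μ ≤ M) (hh : h ≤ T - t) (hy : 0 < y) (hε : 0 < ε)
    (hμ : T = 1 ∨ 24 * μ ≤ y ^ 2 * (a ^ 2 * M)) (hη : 0 < η) {n : ℕ} (hn : 1 ≤ n)
    (hs₁ : 0 < s₁) (hs₂ : 0 < s₂)
    (h₁ : a * √M * (T - t) ≤ η * (n : ℝ) ^ (-(1 / 2) : ℝ) * s₁)
    (h₂ : √(3 * μ) * (T - t) ≤ η * (n : ℝ) ^ (-(1 / 2) : ℝ) * s₂)
    (ν : Measure (EuclideanSpace ℝ (Fin d))) [IsProbabilityMeasure ν] {φ : Path d → ℝ}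
    (hφ : φ ∈ tests d) :
    1 ≤ firstKind η ν n (nullHyp d r (Icc 0 1) β L lam) φ
      + secondKind η ν n (altHyp d r t h μ) φ
      + ENNReal.ofReal (2 * ε + ε ^ 2 + (s₂ + y / ε ^ 2 * s₁) + 3 * (y / ε ^ 2)) := by
  have hT01 : T ∈ Icc (0 : ℝ) 1 := ⟨by linarith, hT⟩
  have htT0 := sub_pos.2 htT
  have hn0 : (0 : ℝ) < n := by exact_mod_cast hn
  set κ := η * (n : ℝ) ^ (-(1 / 2) : ℝ) with hκ
  have hκ0 : 0 < κ := mul_pos hη (Real.rpow_pos_of_pos hn0 _)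
  set g := bump t T with hg
  have hgm : Measurable g := continuous_bump.measurable
  have hg1 (s : ℝ) : |g s| ≤ 1 := by
    rw [abs_of_nonneg (bump_nonneg s)]; exact bump_le_one htT s
  set qf : ℝ → ℝ := (Icc t T).indicator fun _ => √(3 * μ) with hqf
  have hqm : Measurable qf := measurable_const.indicator measurableSet_Icc
  have hq1 (s : ℝ) : |qf s| ≤ √(3 * μ) := by
    by_cases hs : s ∈ Icc t T <;> simp [hqf, hs, abs_of_nonneg]
  have hθ {ζ : ℝ} (hζ : ζ ∈ Icc (-(1 / 6) : ℝ) (1 / 6)) (s : ℝ) : |ζ * (a * g s)| ≤ 1 / 6 := by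
    rw [abs_mul, abs_mul, abs_of_pos ha]
    calc |ζ| * (a * |g s|) ≤ 1 / 6 * (1 * 1) := by
          gcongr
          exacts [abs_le.2 hζ, hg1 s]
      _ = 1 / 6 := by norm_num
  set S : ℝ → (ℝ → ℝ) → ℝ → Matrix (Fin d) (Fin d) ℝ := fun ζ qf s =>
    volMatrix hrd M (ζ * (a * g s)) (qf s) * (volMatrix hrd M (ζ * (a * g s)) (qf s)).transpose
    with hS
  -- The range `|ζ| ≤ 1/6` compensates the factors `3` and `2` in the moduli of continuity of the
  -- covariance in `θ` and of the bump.
  have hS₀ : ∀ ζ ∈ Icc (-(1 / 6) : ℝ) (1 / 6),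
      S ζ (fun _ => 0) ∈ nullHyp d r (Icc 0 1) β L lam := by
    intro ζ hζ
    refine ⟨⟨fun s _ => posSemidef_mul_transpose _, fun s _ u _ => ?_⟩, fun s _ =>
      ⟨rank_volMatrix_le hrd _ hr, hlam.trans (le_ordEig_volMatrix_null hrd _ _ hr hM.le)⟩⟩
    refine (norm_volMatrix_sub_le hrd hr hM.le ?_).trans ?_
    · exact (abs_add_le _ _).trans (by linarith [hθ hζ s, hθ hζ u])
    · rw [← mul_sub, ← mul_sub, abs_mul, abs_mul, abs_of_pos ha]
      have e1 := abs_bump_sub_le htT hβ s u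
      have e2 : |ζ| ≤ 1 / 6 := abs_le.2 hζ
      have e3 : (0 : ℝ) ≤ (|s - u| / (T - t)) ^ β := by positivity
      calc 3 * M * (|ζ| * (a * |g s - g u|))
          ≤ 3 * M * (1 / 6 * (a * (2 * (|s - u| / (T - t)) ^ β))) := by gcongr
        _ = M * a * (|s - u| / (T - t)) ^ β := by ring
        _ ≤ L * (T - t) ^ β * (|s - u| / (T - t)) ^ β := by gcongr
        _ = L * |s - u| ^ β := by
            rw [Real.div_rpow (abs_nonneg _) htT0.le, mul_assoc, mul_div_cancel₀]
            exact (Real.rpow_pos_of_pos htT0 β).ne'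
  have hS₁ : ∀ ζ ∈ Icc (-(1 / 6) : ℝ) (1 / 6), S ζ qf ∈ altHyp d r t h μ := by
    intro ζ hζ
    refine ⟨fun s _ => posSemidef_mul_transpose _, fun i j => ?_, fun s hs => ?_⟩
    · obtain ⟨hm, C, hC⟩ := boundedRows_volMatrix (M := M) hrd ha.le hgm hg1 hqm hq1 ζ
      have hi := memLp_of_bound (hm i) (hC i)
      have hj := memLp_of_bound (hm j) (hC j)
      refine (L2.integrable_inner (𝕜 := ℝ)
        (toL2path fun s => WithLp.toLp 2 (volMatrix hrd M (ζ * (a * g s)) (qf s) i))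
        (toL2path fun s => WithLp.toLp 2 (volMatrix hrd M (ζ * (a * g s)) (qf s) j))).congr ?_
      filter_upwards [toL2path_ae hi, toL2path_ae hj] with s h1 h2
      rw [h1, h2, EuclideanSpace.inner_toLp_toLp, dotProduct_comm]
      simp [hS, Matrix.mul_apply, dotProduct]
    · -- The variance `3 μ` leaves `μ` for `x_r` after `2 μ` is spent on recovering `x_0`.
      refine le_ordEig_volMatrix_alt hrd _ _ hr hμ0 hμM ((hθ hζ s).trans (by norm_num)) ?_
      rw [hqf, indicator_of_mem (show s ∈ Icc t T from ⟨hs.1, by linarith [hs.2]⟩),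
        Real.sq_sqrt (by positivity)]
  have hlaw (qf : ℝ → ℝ) (hqm : Measurable qf) (q₁ : ℝ) (hq1 : ∀ s, |qf s| ≤ q₁) (ζ : ℝ) :=
    spotLaw_volMatrix (M := M) hrd ha.le hgm hg1 hqm hq1 ζ η ν n
  refine one_le_firstKind_add_secondKind (k := 1 / 6) (κ := κ) (by norm_num) hS₀ hS₁
    (g₀ := nullSignal _ _) (g₁ := altSignal _ _ _) measurable_nullSignal measurable_altSignal
    (fun ζ => (hlaw (fun _ => 0) measurable_const 0 (fun _ => by simp) ζ).trans
      (altSignal_coordKernel_zero _ _ _ _ ζ ν κ))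
    (fun ζ => hlaw qf hqm _ hq1 ζ) (fun B hB => ?_) hφ
  -- The weights of the bump and of the perturbation, and their drift operators.
  have hwm : Measurable fun s => a * √M * g s := hgm.const_mul _
  have hw1 (s : ℝ) : |a * √M * g s| ≤ a * √M := by
    rw [abs_mul, abs_of_nonneg (by positivity)]
    exact mul_le_of_le_one_right (by positivity) (hg1 s)
  have hw0 (s : ℝ) (hs : s ∉ Icc t T) : a * √M * g s = 0 := by
    rw [hg, bump_eq_zero htT hs, mul_zero]
  have hq0 (s : ℝ) (hs : s ∉ Icc t T) : qf s = 0 := indicator_of_notMem hs _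
  set i₁ : Fin d := ⟨r, hrd⟩ with hi₁
  set x₀ : EuclideanSpace ℝ (Fin d) := EuclideanSpace.single ⟨0, by omega⟩ 1 with hx₀
  set x₁ : EuclideanSpace ℝ (Fin d) := EuclideanSpace.single i₁ 1 with hx₁
  set A : L2path d := toL2path fun s => (a * √M * g s) • x₀ with hA
  set Q : L2path d := toL2path fun s => qf s • x₁ with hQ
  have hAn : a ^ 2 * M * ((T - t) / 8) ≤ ‖A‖ ^ 2 := by
    rw [hA, norm_sq_toL2path (memLp_smul_const hwm hw1 x₀)]
    have e (s : ℝ) : ‖(a * √M * g s) • x₀‖ ^ 2 = a ^ 2 * M * g s ^ 2 := by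
      rw [norm_smul, hx₀, PiLp.norm_single, norm_one, mul_one, Real.norm_eq_abs, sq_abs, mul_pow,
        mul_pow, Real.sq_sqrt hM.le]
    simp only [e]
    rw [integral_const_mul]
    gcongr
    exact le_integral_bump_sq ht htT hT
  have hA0 : A ≠ 0 := by
    intro h0
    rw [h0, norm_zero] at hAn
    have : 0 < a ^ 2 * M * ((T - t) / 8) := by positivity
    linarith
  have hQn : ‖Q‖ ≤ √(3 * μ) * √|T - t| := by
    refine norm_toL2path_le (memLp_smul_const hqm hq1 x₁) (Real.sqrt_nonneg _) fun s _ => ?_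
    rw [uIcc_of_le htT.le, norm_smul, hx₁, PiLp.norm_single, norm_one, mul_one]
    by_cases hs : s ∈ Icc t T <;> simp [hqf, hs, abs_of_nonneg]
  have hσ₁ := sum_norm_sq_driftOp_le hwm hw1 (x := x₀) (by simp [hx₀]) htT.le hT01 hw0 i₁
  have hσ₂ := sum_norm_sq_driftOp_le hqm hq1 (x := x₁) (by simp [hx₁]) htT.le hT01 hq0 i₁
  have hcost : hidingCost κ (1 / 6) ε y (κ * s₁) (κ * s₂)
      = 2 * ε + ε ^ 2 + (s₂ + y / ε ^ 2 * s₁) + 3 * (y / ε ^ 2) := by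
    rw [hidingCost]; field_simp; ring
  rw [← hcost]
  have hV {w : ℝ → ℝ} {W s : ℝ} (hw : Measurable w) (hW : ∀ s, |w s| ≤ W)
      (x : EuclideanSpace ℝ (Fin d)) (hWs : W * (T - t) ≤ κ * s)
      (hσ : ∀ (N : ℕ) (e : Fin N → L2path d), Orthonormal ℝ e →
        ∑ i, ‖driftOp hw hW x T i₁ (e i)‖ ^ 2 ≤ (W * (T - t)) ^ 2) (N : ℕ)
      (e : Fin N → L2path d) (he : Orthonormal ℝ e) :
      ∑ i, ‖driftOp hw hW x T i₁ (e i)‖ ^ 2 ≤ (κ * s) ^ 2 := by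
    have : 0 ≤ W := (abs_nonneg _).trans (hW 0)
    exact (hσ N e he).trans (by gcongr)
  refine map_mixPath_altSignal_le (driftOp hwm hw1 x₀ T i₁) (driftOp hqm hq1 x₁ T i₁)
    (fun u i => if i = i₁ then max ((u : ℝ) - T) 0 else 0) A (if T = 1 then 0 else Q) hκ0
    (by norm_num) hε hy (by positivity) (by positivity) (hV hwm hw1 x₀ h₁ hσ₁)
    (hV hqm hq1 x₁ h₂ hσ₂) hA0 ?_ (fun u i => ?_) (fun u i => ?_) ν hB
  · split_ifs with hT1
    · rw [norm_zero]; positivity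
    refine le_of_sq_le_sq ?_ (by positivity)
    have h3 := hμ.resolve_left hT1
    calc ‖Q‖ ^ 2 ≤ (√(3 * μ) * √|T - t|) ^ 2 := by gcongr
      _ = 3 * μ * (T - t) := by
          rw [mul_pow, Real.sq_sqrt (by positivity), Real.sq_sqrt (abs_nonneg _),
            abs_of_pos htT0]
      _ ≤ y ^ 2 * (a ^ 2 * M * ((T - t) / 8)) := by
          have := mul_le_mul_of_nonneg_right h3 htT0.le
          linarith
      _ ≤ (y * ‖A‖) ^ 2 := by rw [mul_pow]; gcongr
  · exact driftOp_noiseKernel hwm hw1 x₀ hT01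
      (fun s hs => hw0 s fun h => absurd h.2 (not_le.2 hs)) i₁ u.2 i
  · rw [coordKernel, driftOp_noiseKernel hqm hq1 x₁ hT01
      (fun s hs => hq0 s fun h => absurd h.2 (not_le.2 hs)) i₁ u.2 i]
    congr 1
    by_cases hT1 : T = 1
    · -- At the end of the observation interval there is no drift after the bump.
      have : (if i = i₁ then max ((u : ℝ) - T) 0 else 0) = 0 := by
        rw [max_eq_right (by linarith [u.2.2]), ite_self]
      rw [this, zero_smul, zero_smul]
    · rw [if_neg hT1]

end Families


/-! ### The detection rate and the block length -/

section Rate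

variable {β L lam : ℝ} {n : ℕ}

/-- The branch of the minimum in the detection rate `v` that is active is the branch of the maximum
in the block length `B` that is active, so that `v = 1 / (n B²)`. The last identity says that a
bump of relative height `L B^β / M`, with `M` the size of the leading eigenvalues, contributes
`v` to the diagonal of the covariance. -/
lemma detectionRate_blockLength (hβ : 0 < β) (hL : 0 < L) (hlam : 0 ≤ lam) (hn : 1 ≤ n) :
    0 < blockLength β L lam n ∧ detectionRate β L lam n * blockLength β L lam n ^ 2 = (n : ℝ)⁻¹ ∧
      detectionRate β L lam n * max lam (L * blockLength β L lam n ^ β)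
        = (L * blockLength β L lam n ^ β) ^ 2 := by
  have hn0 : (0 : ℝ) < n := by exact_mod_cast hn
  have hβ2 : β + 2 ≠ 0 := by positivity
  have hβ1 : β + 1 ≠ 0 := by positivity
  set x := (L * n) ^ (-1 / (β + 2)) with hx
  have hx0 : 0 < x := Real.rpow_pos_of_pos (by positivity) _
  have hxp : L * n * (x ^ β * x ^ 2) = 1 := by
    rw [← Real.rpow_natCast x 2, ← Real.rpow_add hx0, hx, ← Real.rpow_mul (by positivity)]
    rw [show -1 / (β + 2) * (β + ((2 : ℕ) : ℝ)) = -1 by push_cast; field_simp, Real.rpow_neg_one]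
    exact mul_inv_cancel₀ (by positivity)
  have hxβ : 0 < x ^ β := Real.rpow_pos_of_pos hx0 _
  have hv₁ : L ^ (2 / (β + 2)) * (n : ℝ) ^ (-β / (β + 2)) = (n : ℝ)⁻¹ * (x ^ 2)⁻¹ := by
    rw [← Real.rpow_natCast x 2, hx, ← Real.rpow_mul (by positivity),
      ← Real.rpow_neg (by positivity), Real.mul_rpow hL.le hn0.le, mul_left_comm,
      ← Real.rpow_neg_one (n : ℝ), ← Real.rpow_add hn0]
    congr 2
    · push_cast; field_simp
    · push_cast; field_simp; ring
  have hx2 : (n : ℝ)⁻¹ * (x ^ 2)⁻¹ = L * x ^ β := by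
    field_simp
    linear_combination -hxp
  rcases hlam.eq_or_lt with h0 | h0
  · have hB : blockLength β L lam n = x := by rw [blockLength, if_pos h0.symm]
    have hv : detectionRate β L lam n = (n : ℝ)⁻¹ * (x ^ 2)⁻¹ := by
      rw [detectionRate, if_pos h0.symm, hv₁]
    rw [hB, hv]
    refine ⟨hx0, by field_simp, ?_⟩
    rw [hx2, ← h0, max_eq_right (by positivity)]; ring
  · set y := (lam⁻¹ * L ^ 2 * n) ^ (-1 / (2 * β + 2)) with hy
    have hy0 : 0 < y := Real.rpow_pos_of_pos (by positivity) _
    have hyβ : 0 < y ^ β := Real.rpow_pos_of_pos hy0 _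
    have hyp : L ^ 2 * n * ((y ^ β) ^ 2 * y ^ 2) = lam := by
      have h1 : lam⁻¹ * L ^ 2 * n * ((y ^ β) ^ 2 * y ^ 2) = 1 := by
        rw [← mul_pow, ← Real.rpow_add_one hy0.ne', ← Real.rpow_natCast (y ^ (β + 1)) 2, hy,
          ← Real.rpow_mul (by positivity), ← Real.rpow_mul (by positivity),
          show -1 / (2 * β + 2) * ((β + 1) * ((2 : ℕ) : ℝ)) = -1 by push_cast; field_simp,
          Real.rpow_neg_one]
        exact mul_inv_cancel₀ (by positivity)
      field_simp at h1
      linear_combination h1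
    have hv₂ : (lam⁻¹ * L ^ 2) ^ (1 / (β + 1)) * (n : ℝ) ^ (-β / (β + 1))
        = (n : ℝ)⁻¹ * (y ^ 2)⁻¹ := by
      rw [← Real.rpow_natCast y 2, hy, ← Real.rpow_mul (by positivity),
        ← Real.rpow_neg (by positivity), Real.mul_rpow (by positivity) hn0.le, mul_left_comm,
        ← Real.rpow_neg_one (n : ℝ), ← Real.rpow_add hn0]
      congr 2
      · push_cast; field_simp
      · push_cast; field_simp; ring
    have hB : blockLength β L lam n = max y x := by rw [blockLength, if_neg h0.ne']
    have hv : detectionRate β L lam n = min ((n : ℝ)⁻¹ * (y ^ 2)⁻¹) ((n : ℝ)⁻¹ * (x ^ 2)⁻¹) := by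
      rw [detectionRate, if_neg h0.ne', hv₁, hv₂]
    rw [hB, hv]
    rcases le_total y x with h | h
    · have h1 : (n : ℝ)⁻¹ * (x ^ 2)⁻¹ ≤ (n : ℝ)⁻¹ * (y ^ 2)⁻¹ := by gcongr
      rw [max_eq_right h, min_eq_right h1]
      refine ⟨hx0, by field_simp, ?_⟩
      have h2 : lam ≤ L * x ^ β := by
        calc lam = L ^ 2 * n * ((y ^ β) ^ 2 * y ^ 2) := hyp.symm
          _ ≤ L ^ 2 * n * ((x ^ β) ^ 2 * x ^ 2) := by gcongr
          _ = L * x ^ β := by linear_combination L * x ^ β * hxp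
      rw [max_eq_right h2, hx2]; ring
    · have h1 : (n : ℝ)⁻¹ * (y ^ 2)⁻¹ ≤ (n : ℝ)⁻¹ * (x ^ 2)⁻¹ := by gcongr
      rw [max_eq_left h, min_eq_left h1]
      refine ⟨hy0, by field_simp, ?_⟩
      have h3 : 1 ≤ L * n * (y ^ β * y ^ 2) := by rw [← hxp]; gcongr
      have h2 : L * y ^ β ≤ lam := by
        rw [← hyp]
        have := mul_le_mul_of_nonneg_left h3 (show 0 ≤ L * y ^ β by positivity)
        linarith
      rw [max_eq_left h2, ← hyp]
      field_simp

end Rate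

/-! ### Choice of the constant -/

/-- The total cost of hiding the perturbation is arbitrarily small for a small constant `c`. -/
lemma exists_constant {η τ : ℝ} (hη : 0 < η) (hτ : 0 < τ) (hτ1 : τ < 1) :
    ∃ c > 0, c ≤ 1 / 2 ∧ ∃ ε > 0, 2 * ε + ε ^ 2 + (√(3 * c) / η + √(24 * c) / ε ^ 2 * (1 / η))
      + 3 * (√(24 * c) / ε ^ 2) ≤ τ := by
  set ε := τ / 6 with hε
  have hε0 : 0 < ε := by positivity
  set K := √3 / η + √24 / ε ^ 2 * (1 / η) + 3 * (√24 / ε ^ 2) with hK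
  have hK0 : 0 < K := by positivity
  refine ⟨min (1 / 2) ((τ / (2 * K)) ^ 2), by positivity, min_le_left _ _, ε, hε0, ?_⟩
  set c := min (1 / 2) ((τ / (2 * K)) ^ 2) with hc
  have h1 : √c ≤ τ / (2 * K) := Real.sqrt_le_left (by positivity) |>.2 (min_le_right _ _)
  have h2 : √c * K ≤ τ / 2 := by
    calc √c * K ≤ τ / (2 * K) * K := by gcongr
      _ = τ / 2 := by field_simp
  rw [Real.sqrt_mul (by norm_num), Real.sqrt_mul (by norm_num)]
  have h3 : √3 * √c / η + √24 * √c / ε ^ 2 * (1 / η) + 3 * (√24 * √c / ε ^ 2) = √c * K := by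
    rw [hK]; ring
  have h4 : ε ^ 2 ≤ ε := by nlinarith
  linarith

/-- The bound behind both parts of the theorem, valid at every sample size. -/
lemma exists_forall_le_firstKind_add_secondKind {d r : ℕ} (hr : 1 ≤ r) (hrd : r < d) {t : ℝ}
    (ht : t ∈ Ico (0 : ℝ) 1) {η : ℝ} (hη : 0 < η) {α' : ℝ} (hα : α' ∈ Ioo (0 : ℝ) 1) :
    ∃ c > 0, ∀ β ∈ Ioc (0 : ℝ) 1, ∀ (ν : Measure (EuclideanSpace ℝ (Fin d)))
      [IsProbabilityMeasure ν] (L lam h : ℕ → ℝ), Setting t β c L lam h → ∀ n, 1 ≤ n →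
      ∀ φ ∈ tests d, ENNReal.ofReal α'
        ≤ firstKind η ν n (nullHyp d r (Icc 0 1) β (L n) (lam n)) φ
          + secondKind η ν n (altHyp d r t (h n) (c * detectionRate β (L n) (lam n) n)) φ := by
  obtain ⟨c, hc, hc2, ε, hε, hτ⟩ := exists_constant hη (sub_pos.2 hα.2) (by linarith [hα.1])
  refine ⟨c, hc, fun β hβ ν _ L lam h hS n hn φ hφ => ?_⟩
  have hn0 : (0 : ℝ) < n := by exact_mod_cast hn
  have hL := hS.L_pos n
  obtain ⟨hB, hvB, hvM⟩ := detectionRate_blockLength hβ.1 hL (hS.lam_nonneg n) hn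
  set B := blockLength β (L n) (lam n) n
  set v := detectionRate β (L n) (lam n) n
  set M := max (lam n) (L n * B ^ β) with hMdef
  have hBβ : 0 < B ^ β := Real.rpow_pos_of_pos hB _
  have hM : 0 < M := lt_max_of_lt_right (by positivity)
  have hv : 0 < v := by
    refine pos_of_mul_pos_left (b := B ^ 2) ?_ (by positivity)
    rw [hvB]; positivity
  have hvM' : v ≤ M := by
    refine le_of_mul_le_mul_right (hvM.le.trans ?_) hM
    rw [← sq]
    gcongr
    exact le_max_right _ _
  -- The bump lives on `[t, T]`, of length the block length unless this exceeds `1 - t`.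
  set h' := min B (1 - t) with hh'
  have h'0 : 0 < h' := lt_min hB (sub_pos.2 ht.2)
  have hTt : t + h' - t = h' := by ring
  have hhn : h n ≤ h' := by
    refine le_min ((hS.h_le n hn).trans ?_) (hS.h_mem n).2
    refine mul_le_of_le_one_left hB.le (Real.rpow_le_one hc.le (by linarith) ?_)
    have := hβ.1
    positivity
  set a := L n * h' ^ β / M with ha
  have h'β : h' ^ β ≤ B ^ β := Real.rpow_le_rpow h'0.le (min_le_left _ _) hβ.1.le
  have ha0 : 0 < a := by
    have := Real.rpow_pos_of_pos h'0 β
    positivity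
  have haB : a ≤ L n * B ^ β / M := by rw [ha]; gcongr
  have hvsq : (L n * B ^ β / M * √M) ^ 2 = v := by
    rw [mul_pow, div_pow, Real.sq_sqrt hM.le, ← hvM]; field_simp
  have hvB' : √v * B = (n : ℝ) ^ (-(1 / 2) : ℝ) := by
    rw [← Real.sqrt_sq hB.le, ← Real.sqrt_mul hv.le, hvB, Real.sqrt_eq_rpow,
      ← Real.rpow_neg_one, ← Real.rpow_mul hn0.le]
    norm_num
  have ha_sqrt : a * √M * h' ≤ (n : ℝ) ^ (-(1 / 2) : ℝ) := by
    rw [← hvB', ← hvsq, Real.sqrt_sq (by positivity)]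
    gcongr
    exact min_le_left _ _
  have hkey := one_le_firstKind_add_secondKind_volMatrix hrd hr (t := t) (T := t + h') (β := β)
    (L := L n) (lam := lam n) (M := M) (a := a) (μ := c * v) (h := h n) (y := √(24 * c)) (ε := ε)
    (s₁ := 1 / η) (s₂ := √(3 * c) / η) (η := η) (n := n) ht.1 (by linarith)
    (by linarith [min_le_right B (1 - t)]) hβ hM (le_max_left _ _) ha0
    (haB.trans (div_le_one_of_le₀ (le_max_right _ _) hM.le))
    (by rw [hTt, ha]; exact (mul_div_cancel₀ _ hM.ne').le) (by positivity) (by nlinarith)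
    (by rw [hTt]; exact hhn) (by positivity) hε ?_ hη hn (by positivity) (by positivity)
    (by rw [hTt]; refine ha_sqrt.trans (le_of_eq ?_); field_simp) ?_ ν hφ
  · have h1 : ENNReal.ofReal α' + ENNReal.ofReal (1 - α') = 1 := by
      rw [← ENNReal.ofReal_add hα.1.le (sub_nonneg.2 hα.2.le)]; simp
    rw [← h1] at hkey
    exact (ENNReal.add_le_add_iff_right ENNReal.ofReal_ne_top).1
      (hkey.trans (add_le_add_right (ENNReal.ofReal_le_ofReal hτ) _))
  · rcases le_total B (1 - t) with h1 | h1
    · right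
      have h2 : h' = B := min_eq_left h1
      rw [ha, h2, Real.sq_sqrt (by positivity)]
      have h3 : (L n * B ^ β / M) ^ 2 * M = v := by
        rw [← hvsq, mul_pow _ √M, Real.sq_sqrt hM.le]
      rw [h3]; linarith
    · left
      rw [hh', min_eq_right h1]; ring
  · rw [hTt, ← mul_assoc, Real.sqrt_mul (by positivity)]
    calc √(3 * c) * √v * h' ≤ √(3 * c) * (√v * B) := by
          rw [mul_assoc]; gcongr; exact min_le_left _ _
      _ = _ := by rw [hvB']; field_simp

end RankTest

theorem mainTheorem6 {d r : ℕ} (hr : 1 ≤ r) (hrd : r < d) {t : ℝ} (ht : t ∈ Ico (0 : ℝ) 1)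
    {η : ℝ} (hη : 0 < η) :
    (∀ α' ∈ Ioo (0 : ℝ) 1, ∃ c > 0, ∀ β ∈ Ioc (0 : ℝ) 1,
      ∀ (ν : Measure (EuclideanSpace ℝ (Fin d))) [IsProbabilityMeasure ν] (L lam h : ℕ → ℝ),
      RankTest.Setting t β c L lam h →
      ENNReal.ofReal α' ≤ liminf (fun n : ℕ =>
        ⨅ φ ∈ RankTest.tests d,
          RankTest.firstKind η ν n (RankTest.nullHyp d r (Icc 0 1) β (L n) (lam n)) φ
          + RankTest.secondKind η ν n
              (RankTest.altHyp d r t (h n) (c * RankTest.detectionRate β (L n) (lam n) n)) φ)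
        atTop) ∧
    (∀ α ∈ Ioo (0 : ℝ) 1, ∃ c > 0, ∀ β ∈ Ioc (0 : ℝ) 1,
      ∀ (ν : Measure (EuclideanSpace ℝ (Fin d))) [IsProbabilityMeasure ν] (L lam h : ℕ → ℝ),
      RankTest.Setting t β c L lam h →
      ∀ φ : ℕ → RankTest.Path d → ℝ, (∀ n, φ n ∈ RankTest.tests d) →
      (∀ᶠ n in atTop, RankTest.firstKind η ν n
        (RankTest.nullHyp d r (Icc 0 1) β (L n) (lam n)) (φ n) ≤ ENNReal.ofReal α) →
      ¬ Tendsto (fun n : ℕ => RankTest.secondKind η ν n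
        (RankTest.altHyp d r t (h n) (c * RankTest.detectionRate β (L n) (lam n) n)) (φ n))
        atTop (𝓝 0)) := by
  refine ⟨fun α' hα => ?_, fun α hα => ?_⟩
  · obtain ⟨c, hc, H⟩ :=
      RankTest.exists_forall_le_firstKind_add_secondKind hr hrd ht hη hα
    refine ⟨c, hc, fun β hβ ν _ L lam h hS => le_liminf_of_le (by isBoundedDefault) ?_⟩
    filter_upwards [eventually_ge_atTop 1] with n hn
    exact le_iInf₂ fun φ hφ => H β hβ ν L lam h hS n hn φ hφ
  · have hα' : (1 + α) / 2 ∈ Ioo (0 : ℝ) 1 := ⟨by linarith [hα.1], by linarith [hα.2]⟩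
    obtain ⟨c, hc, H⟩ :=
      RankTest.exists_forall_le_firstKind_add_secondKind hr hrd ht hη hα'
    refine ⟨c, hc, fun β hβ ν _ L lam h hS φ hφ h1 h2 => ?_⟩
    have hlim := h2.const_add (ENNReal.ofReal α)
    rw [add_zero] at hlim
    have h3 : ENNReal.ofReal ((1 + α) / 2) ≤ ENNReal.ofReal α := by
      refine ge_of_tendsto hlim ?_
      filter_upwards [h1, eventually_ge_atTop 1] with n hn1 hn
      exact (H β hβ ν L lam h hS n hn (φ n) (hφ n)).trans (add_le_add_left hn1 _)
    rw [ENNReal.ofReal_le_ofReal_iff hα.1.le] at h3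
    linarith [hα.2]
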